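/- **Setting.** Let $J\subset\mathbb C$ be a simple (open or closed) oriented regular piecewise smooth curve, let $\partial J$ be the set of its end points (empty if $J$ is closed) and $\mathring J=J\setminus\partial J$. Let $N\ge 0$ and let $\boldsymbol E_L=(f_1,\dots,f_N)^T$, $\boldsymbol E_R=(e_1,\dots,e_N)^T$ be continuous, piecewise smooth $\mathbb C^N$-valued functions on $J$ (smooth up to the end points of each of finitely many arcs that make up $J$) with $(\boldsymbol E_L(\lambda),\boldsymbol E_R(\lambda))=0$ for all $\lambda\in J$, where $(\boldsymbol x,\boldsymbol y)=\sum_a x_a y_a$. Put $\widetilde V(\lambda,\mu)=\frac{(\boldsymbol E_L(\lambda),\boldsymbol E_R(\mu))}{\lambda-\mu}$. Let $c_1,\dots,c_N\in\mathbb R\setminus\{0\}$, $\gamma_1,\dots,\gamma_N\in\mathbb C$, $v_1,\dots,v_N\in\{1,\dots,N\}$, and let $\boldsymbol e_1,\dots,\boldsymbol e_N$ be the standard basis of $\mathbb C^N$. Let $\chi$ be a solution of the Riemann--Hilbert problem associated with $\widetilde V$: $\chi$ is an $N\times N$ matrix function, holomorphic on $\mathbb C\setminus J$, that extends continuously to $\mathring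 J$ from the left ($\chi_+$) and from the right ($\chi_-$); entrywise $\chi(z)=O(\ln|z-a|)$ as $z\to a$ for every $a\in\partial J$, and $\chi(z)=I_N+O(z^{-1})$ as $z\to\infty$; and $$\chi_-(z)=\chi_+(z)\,\big(I_N+2i\pi\,\boldsymbol E_R(z)\boldsymbol E_L^T(z)\big),\qquad z\in\mathring J .$$ Let $\boldsymbol F_L$ be a continuous solution on $J$ of $$\boldsymbol F_L(\lambda)+\int_J\widetilde V(\lambda,\mu)\,\boldsymbol F_L(\mu)\,d\mu=\boldsymbol E_L(\lambda),\qquad \lambda\in J .$$ Let $\Gamma(J)$ be a small counterclockwise loop around $J$, i.e. a closed piecewise $C^1$ curve in $\mathbb C\setminus J$ with winding number $1$ around every point of $J$, such that, $D$ being the union of $\Gamma(J)$ with the set of points around which $\Gamma(J)$ has non-zero winding number, $z-w+ic_n\neq0$ for all $z,w\in D$ and all $n$. For an $m\times m$ matrix kernel $K$ on a curve $C$, the Fredholm determinant is $$\det_C[I+K]=\sum_{n\ge0}\frac1{n!}\sum_{k_1,\dots,k_n=1}^m\int_{C^n}\det\big[K_{k_ik_j}(z_i,z_j)\big]_{i,j=1}^n\,dz_1\cdots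 dz_n .$$ **Proposition.** Let $$W(\lambda,\mu)=-\sum_{n=1}^N\gamma_n\,\frac{(\boldsymbol F_L(\lambda),\chi(\mu-ic_n)\boldsymbol e_n)\,(\boldsymbol e_{v_n},\boldsymbol E_R(\mu))}{\lambda-\mu+ic_n},\qquad \lambda,\mu\in J,$$ and let $\mathcal M$ be the $N\times N$ matrix kernel on $\Gamma(J)$ with entries $$\mathcal M_{k\ell}(\lambda,\mu)=\gamma_k\,\frac{(\boldsymbol e_{v_k},\chi^{-1}(\lambda)\,\chi(\mu-ic_\ell)\,\boldsymbol e_\ell)}{2i\pi(\lambda-\mu+ic_\ell)},\qquad \lambda,\mu\in\Gamma(J).$$ Then the Fredholm series of $W$ on $J$ and of $\mathcal M$ on $\Gamma(J)$ consist of convergent integrals and converge absolutely, and $$\det_J[I+W]=\det_{\Gamma(J)}[I+\mathcal M].$$ -/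

import Mathlib

noncomputable section

namespace ShiftKernel

/-- `f : [0,1] → E` is continuous, and it is of class `C^n` up to the end points on every
closed subinterval of `[0,1]` that has no point of the finite set `B` in its interior. -/
def PiecewiseContDiff {E : Type*} [NormedAddCommGroup E] [NormedSpace ℝ E]
    (n : WithTop ℕ∞) (f : ℝ → E) (B : Finset ℝ) : Prop :=
  ContinuousOn f (Set.Icc 0 1) ∧
    ∀ s t : ℝ, 0 ≤ s → s < t → t ≤ 1 → (∀ u ∈ B, u ∉ Set.Ioo s t) →
      ContDiffOn ℝ n f (Set.Icc s t)

/-- The support of a curve parametrised by `[0,1]`. -/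
def support (γ : ℝ → ℂ) : Set ℂ := γ '' Set.Icc 0 1

/-- The set of end points of a curve (empty if the curve is closed). -/
def endPoints (γ : ℝ → ℂ) : Set ℂ := {a | γ 0 ≠ γ 1 ∧ (a = γ 0 ∨ a = γ 1)}

/-- The curve without its end points. -/
def openArc (γ : ℝ → ℂ) : Set ℂ := support γ \ endPoints γ

/-- A simple (open or closed) regular piecewise smooth oriented curve, parametrised by `[0,1]`;
the break points of the parametrisation belong to `B`. -/
structure IsPiecewiseSmoothCurve (γ : ℝ → ℂ) (B : Finset ℝ) : Prop where
  smooth : PiecewiseContDiff ((⊤ : ℕ∞) : WithTop ℕ∞) γ B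
  regular : ∀ s t : ℝ, 0 ≤ s → s < t → t ≤ 1 → (∀ u ∈ B, u ∉ Set.Ioo s t) →
    ∀ u ∈ Set.Icc s t, derivWithin γ (Set.Icc s t) u ≠ 0
  simple : ∀ s ∈ Set.Icc (0 : ℝ) 1, ∀ t ∈ Set.Icc (0 : ℝ) 1, γ s = γ t →
    s = t ∨ (s = 0 ∧ t = 1) ∨ (s = 1 ∧ t = 0)

/-- The integral `∫_γ f(z) dz`. -/
def curveInt (γ : ℝ → ℂ) (f : ℂ → ℂ) : ℂ := ∫ t in (0 : ℝ)..1, f (γ t) * deriv γ t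

/-- The index (winding number) of the closed curve `Γ` around `z`. -/
def index (Γ : ℝ → ℂ) (z : ℂ) : ℂ :=
  (2 * Real.pi * Complex.I)⁻¹ * curveInt Γ (fun w => (w - z)⁻¹)

/-! ### Fredholm determinants -/

/-- The integrand `det [K_{k_i k_j}(γ(t_i), γ(t_j))] ∏ γ'(t_i)` of the Fredholm series of the
matrix kernel `K`. -/
def fredholmIntegrand {ι : Type*} (γ : ℝ → ℂ) (K : ℂ → ℂ → Matrix ι ι ℂ) (n : ℕ)
    (k : Fin n → ι) (t : Fin n → ℝ) : ℂ :=
  (Matrix.of fun i j : Fin n => K (γ (t i)) (γ (t j)) (k i) (k j)).det * ∏ i, deriv γ (t i)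

/-- The `n`-th term
`(1/n!) ∑_{k ∈ ι^n} ∫_{γ^n} det [K_{k_i k_j}(z_i, z_j)] dz_1 ⋯ dz_n` of the Fredholm series. -/
def fredholmTerm {ι : Type*} [Fintype ι] (γ : ℝ → ℂ) (K : ℂ → ℂ → Matrix ι ι ℂ) (n : ℕ) : ℂ :=
  (n.factorial : ℂ)⁻¹ *
    ∑ k : Fin n → ι, ∫ t in Set.Icc (0 : Fin n → ℝ) 1, fredholmIntegrand γ K n k t

/-- The Fredholm series of `K` on `γ` is well defined: its terms are convergent integrals and the
series converges absolutely. -/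
def FredholmConvergent {ι : Type*} [Fintype ι] (γ : ℝ → ℂ) (K : ℂ → ℂ → Matrix ι ι ℂ) : Prop :=
  (∀ (n : ℕ) (k : Fin n → ι),
    MeasureTheory.IntegrableOn (fredholmIntegrand γ K n k) (Set.Icc (0 : Fin n → ℝ) 1)) ∧
  Summable (fredholmTerm γ K)

/-- The Fredholm determinant `det_γ [I + K]` of the integral operator with matrix kernel `K`
on `L²(γ) ⊗ ℂ^ι`. -/
def fredholmDet {ι : Type*} [Fintype ι] (γ : ℝ → ℂ) (K : ℂ → ℂ → Matrix ι ι ℂ) : ℂ :=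
  ∑' n, fredholmTerm γ K n

/-- A scalar kernel as a `1 × 1` matrix kernel. -/
def scalarKernel (K : ℂ → ℂ → ℂ) : ℂ → ℂ → Matrix Unit Unit ℂ :=
  fun x y => Matrix.of fun _ _ => K x y

/-! ### The integrable kernel and its Riemann--Hilbert problem -/

/-- The integrable kernel `(E_L(x), E_R(y)) / (x - y)`. -/
def integrableKernel {N : ℕ} (EL ER : ℂ → Fin N → ℂ) (x y : ℂ) : ℂ :=
  dotProduct (EL x) (ER y) / (x - y)

/-- `F_L` is a continuous solution on the curve of
`F_L(x) + ∫ Ṽ(x,y) F_L(y) dy = E_L(x)`, with `Ṽ` the integrable kernel. -/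
structure IsLeftSolution {N : ℕ} (γ : ℝ → ℂ) (EL ER FL : ℂ → Fin N → ℂ) : Prop where
  continuousOn : ContinuousOn FL (support γ)
  equation : ∀ x ∈ support γ, ∀ j : Fin N,
    FL x j + curveInt γ (fun y => integrableKernel EL ER x y * FL y j) = EL x j

/-- `L` and `R` are a left and a right side of the curve: disjoint open sets off the curve that
together with the curve fill a neighbourhood of each point that is not an end point, `L` being
on the left and `R` on the right of the curve. -/
structure AreSides (γ : ℝ → ℂ) (B : Finset ℝ) (L R : Set ℂ) : Prop where
  isOpen_left : IsOpen L
  isOpen_right : IsOpen R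
  disjoint : Disjoint L R
  left_off : Disjoint L (support γ)
  right_off : Disjoint R (support γ)
  cover : ∀ s ∈ openArc γ, L ∪ R ∪ support γ ∈ nhds s
  left : ∀ t ∈ Set.Ioo (0 : ℝ) 1, t ∉ B →
    ∀ᶠ ε : ℝ in nhdsWithin 0 (Set.Ioi 0), γ t + ε * (Complex.I * deriv γ t) ∈ L
  right : ∀ t ∈ Set.Ioo (0 : ℝ) 1, t ∉ B →
    ∀ᶠ ε : ℝ in nhdsWithin 0 (Set.Ioi 0), γ t - ε * (Complex.I * deriv γ t) ∈ R

/-- `χp` and `χm` are the continuous boundary values of `χ` on the curve without its end points,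
from the left and from the right: `χ` extends continuously to the curve from either side. -/
def HasBoundaryValues {N : ℕ} (γ : ℝ → ℂ) (B : Finset ℝ)
    (χ χp χm : ℂ → Matrix (Fin N) (Fin N) ℂ) : Prop :=
  ContinuousOn χp (openArc γ) ∧ ContinuousOn χm (openArc γ) ∧
  ∃ L R : Set ℂ, AreSides γ B L R ∧
    ∀ s ∈ openArc γ,
      Filter.Tendsto χ (nhdsWithin s L) (nhds (χp s)) ∧
      Filter.Tendsto χ (nhdsWithin s R) (nhds (χm s))

/-- `χ` solves the Riemann--Hilbert problem attached to the integrable kernel. -/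
structure SolvesRHP {N : ℕ} (γ : ℝ → ℂ) (B : Finset ℝ) (EL ER : ℂ → Fin N → ℂ)
    (χ : ℂ → Matrix (Fin N) (Fin N) ℂ) : Prop where
  holomorphic : ∀ i j, DifferentiableOn ℂ (fun z => χ z i j) (support γ)ᶜ
  atEndPoints : ∀ a ∈ endPoints γ, ∀ i j,
    Asymptotics.IsBigO (nhdsWithin a (support γ)ᶜ) (fun z => χ z i j)
      (fun z => Real.log ‖z - a‖)
  atInfinity : ∀ i j,
    Asymptotics.IsBigO (Bornology.cobounded ℂ)
      (fun z => χ z i j - (1 : Matrix (Fin N) (Fin N) ℂ) i j) (fun z => z⁻¹)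
  jump : ∃ χp χm : ℂ → Matrix (Fin N) (Fin N) ℂ, HasBoundaryValues γ B χ χp χm ∧
    ∀ s ∈ openArc γ,
      χm s = χp s * (1 + (2 * Real.pi * Complex.I) • Matrix.vecMulVec (ER s) (EL s))

/-! ### The two kernels and the loop -/

/-- The kernel `W`. -/
def kernelW {N : ℕ} (c : Fin N → ℝ) (g : Fin N → ℂ) (v : Fin N → Fin N)
    (ER FL : ℂ → Fin N → ℂ) (χ : ℂ → Matrix (Fin N) (Fin N) ℂ) (x y : ℂ) : ℂ :=
  -∑ n : Fin N, g n *
    (dotProduct (FL x) ((χ (y - Complex.I * c n)).mulVec (Pi.single n 1)) *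
      dotProduct (Pi.single (v n) 1) (ER y)) / (x - y + Complex.I * c n)

/-- The matrix kernel `M`. -/
def kernelM {N : ℕ} (c : Fin N → ℝ) (g : Fin N → ℂ) (v : Fin N → Fin N)
    (χ : ℂ → Matrix (Fin N) (Fin N) ℂ) (x y : ℂ) : Matrix (Fin N) (Fin N) ℂ :=
  Matrix.of fun k l =>
    g k * dotProduct (Pi.single (v k) 1)
        (((χ x)⁻¹ * χ (y - Complex.I * c l)).mulVec (Pi.single l 1)) /
      (2 * Real.pi * Complex.I * (x - y + Complex.I * c l))

/-- The points lying on the closed curve `Γ` or encircled by it. -/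
def filled (Γ : ℝ → ℂ) : Set ℂ := support Γ ∪ {z | index Γ z ≠ 0}

/-- `Γ` is a small counterclockwise loop around the curve `γ`: it is a closed piecewise `C^1`
curve off `γ` of index one around each point of `γ`, and it is small enough for the set it
encloses to be disjoint from its translates by `i c_n` (so that neither the zeros of
`z - w + i c_n` nor the singularities of `χ(z - i c_n)` are met in it). -/
structure IsSmallLoopAround {N : ℕ} (γ : ℝ → ℂ) (c : Fin N → ℝ) (Γ : ℝ → ℂ) (BΓ : Finset ℝ) :
    Prop where
  smooth : PiecewiseContDiff 1 Γ BΓ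
  closed : Γ 0 = Γ 1
  disjoint : Disjoint (support Γ) (support γ)
  index_eq_one : ∀ z ∈ support γ, index Γ z = 1
  small : ∀ n, ∀ z ∈ filled Γ, ∀ w ∈ filled Γ, z - w + Complex.I * c n ≠ 0

end ShiftKernel

end

/-!
The argument rests on an explicit inverse of the solution `χ` of the Riemann--Hilbert problem, `Ψ(z)
= 1 + ∫_J E_R(s) F_L(s)ᵀ / (s - z) ds` (`cauchyInverse`), and on the fact that contour integrals
against `Ψ` over the loop collapse onto `J`.

*Why `χ Ψ = 1`* (`mul_cauchyInverse_eq_one`). Both factors tend to one at infinity, so that by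
Liouville's theorem it is enough to extend the product holomorphically across `J`. Near a regular
point of `J`, Cauchy's theorem on a curvilinear box writes `χ` as a holomorphic function minus the
Cauchy integral of the density `p E_Lᵀ` with `p = χ₊ E_R` (`IsBox.exists_eq_add_cauchyTransform`).
The product of the two Cauchy integrals that occur in `χ Ψ` has the numerator `(E_L(s), E_R(t))`,
which vanishes to first order on the diagonal; by partial fractions it is a difference of two single
Cauchy integrals, and the integral equations satisfied by `p` and `F_L` say that all singular terms
cancel (`sum_mul_eqMod_zero`, `exists_extension_of_regular`). Contraction with `E_L` or `E_R`
removes every singular integral in this computation, so that boundary values are only ever taken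
under the integral sign and neither Hölder continuity of densities nor the Plemelj formulas are
needed.

At the remaining finitely many points of `J` (end points and junctions of the smooth arcs) nothing
is assumed on the angle between the arcs. There `χ` is at most logarithmic and `Ψ` is bounded by the
potential `∫_J |ds| / |s - z|`. Hence `χ Ψ` is at most `|z - a|` times a function that is integrable
on the plane near `a` (`exists_enorm_mul_cauchyInverse_le`); as `J` is a null set, the mean value
inequality on the disc of radius `|z - a| / 2` around `z` turns this into `o(1 / |z - a|)`
(`isLittleO_of_enorm_le`), and the isolated singularity is removable.

*Why the determinants agree.* Put `κ_{pl}(z, w) = χ_{pl}(w - i c_l) / (z - w + i c_l)`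
(`shiftedKernel`). With `χ⁻¹ = Ψ`, multilinearity in rows and columns expands the `n`-th Fredholm
terms of both kernels over the same multi-indices into integrals of the same determinants of `κ`
(`shiftedDet`): over the loop with the weights `Ψ_{v_k p}(z_i) / (2πi)`, and over `J` with the
weights `-E_{R,v_k}(z_i) F_{L,p}(z_i)`, up to the common factors `γ_k`. These determinants are
holomorphic in each point near the filled loop, because the latter is disjoint from its translates
by `i c_l`. For such functions the two weights are interchangeable: the loop has index one around
the points of `J`, so Cauchy's formula in its homology form (`IsClosedCurve.curveInt_div_sub`, by
Dixon's argument) and Fubini's theorem apply (`IsSmallLoopAround.integral_mul_cauchyInverse`).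
Moving one variable at a time (`setIntegral_pi_contour`) yields equality term by term
(`fredholmTerm_kernelW_eq`). Absolute convergence follows from Hadamard's inequality, since `W` is
bounded on `J` (`summable_fredholmTerm`), and carries over to the series on the loop.
-/

noncomputable section

open Set Filter Topology MeasureTheory Metric

namespace ShiftKernel

/-! ### Holomorphic dependence of integrals on a parameter -/

/-- An integral of holomorphic functions that are locally dominated by an integrable function is
holomorphic; the bound on the derivatives comes from Cauchy's estimate. -/
theorem differentiableOn_integral_of_dominated {α : Type*} [MeasurableSpace α] {μ : Measure α}
    {F : ℂ → α → ℂ} {U : Set ℂ}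
    (hmeas : ∀ z ∈ U, AEStronglyMeasurable (F z) μ)
    (hdiff : ∀ᵐ a ∂μ, DifferentiableOn ℂ (fun z => F z a) U)
    (hbound : ∀ z ∈ U, ∃ r > 0, ball z r ⊆ U ∧ ∃ b : α → ℝ, Integrable b μ ∧
      ∀ᵐ a ∂μ, ∀ w ∈ ball z r, ‖F w a‖ ≤ b a) :
    DifferentiableOn ℂ (fun z => ∫ a, F z a ∂μ) U := by
  intro z hz
  obtain ⟨r, hr, hrU, b, hb, hFb⟩ := hbound z hz
  have hzr : z ∈ ball z r := mem_ball_self hr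
  have hdz : ∀ᵐ a ∂μ, ∀ w ∈ ball z r, HasDerivAt (fun z => F z a) (deriv (fun z => F z a) w) w := by
    filter_upwards [hdiff] with a ha w hw
    exact (ha.differentiableAt (mem_of_superset (isOpen_ball.mem_nhds hw) hrU)).hasDerivAt
  have key := hasDerivAt_integral_of_dominated_loc_of_deriv_le (μ := μ) (F := F)
    (F' := fun w a => deriv (fun z => F z a) w) (x₀ := z) (s := ball z (r / 2))
    (bound := fun a => b a / (r / 2)) (ball_mem_nhds z (by positivity))
    (by filter_upwards [isOpen_ball.mem_nhds hzr] with w hw using hmeas w (hrU hw))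
    (hb.mono' (hmeas z hz) (by filter_upwards [hFb] with a ha using ha z hzr))
    ?_ ?_ (hb.div_const _) ?_
  · exact key.2.differentiableAt.differentiableWithinAt
  · have hs : Tendsto (fun n : ℕ => z + ((r / 2 * ((n : ℝ) + 1)⁻¹ : ℝ) : ℂ)) atTop (𝓝[≠] z) := by
      refine tendsto_nhdsWithin_iff.2 ⟨?_, Eventually.of_forall fun n => ?_⟩
      · have h1 : Tendsto (fun n : ℕ => (r / 2 * ((n : ℝ) + 1)⁻¹ : ℝ)) atTop (𝓝 (r / 2 * 0)) := by
          refine Tendsto.const_mul _ ?_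
          simpa using tendsto_one_div_add_atTop_nhds_zero_nat (𝕜 := ℝ)
        have h2 := (Complex.continuous_ofReal.tendsto _).comp h1
        simpa using h2.const_add z
      · have : (r / 2 * ((n : ℝ) + 1)⁻¹ : ℝ) ≠ 0 := by positivity
        rw [mem_compl_singleton_iff, Ne, add_eq_left, Complex.ofReal_eq_zero]
        exact this
    have hsU : ∀ n : ℕ, z + ((r / 2 * ((n : ℝ) + 1)⁻¹ : ℝ) : ℂ) ∈ ball z r := by
      intro n
      have h0 : (0 : ℝ) < (n : ℝ) + 1 := by positivity
      have h1 : ((n : ℝ) + 1)⁻¹ ≤ 1 := inv_le_one_of_one_le₀ (by linarith [n.cast_nonneg (α := ℝ)])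
      rw [mem_ball, dist_eq_norm, add_sub_cancel_left, Complex.norm_real, Real.norm_eq_abs,
        abs_of_pos (by positivity)]
      nlinarith
    refine aestronglyMeasurable_of_tendsto_ae atTop
      (f := fun (n : ℕ) a => slope (fun z => F z a) z (z + ((r / 2 * ((n : ℝ) + 1)⁻¹ : ℝ) : ℂ)))
      (fun n => ?_) ?_
    · simp only [slope_def_field]
      exact ((hmeas _ (hrU (hsU n))).sub (hmeas z hz)).mul aestronglyMeasurable_const
    · filter_upwards [hdz] with a ha
      exact (hasDerivAt_iff_tendsto_slope.1 (ha z hzr)).comp hs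
  · filter_upwards [hFb, hdz] with a ha hda w hw
    have hsub : closedBall w (r / 2) ⊆ ball z r := by
      intro x hx
      rw [mem_ball] at hw ⊢
      rw [mem_closedBall] at hx
      linarith [dist_triangle x w z]
    refine Complex.norm_deriv_le_of_forall_mem_sphere_norm_le (by positivity) ?_ ?_
    · refine (DifferentiableOn.diffContOnCl ?_)
      intro x hx
      exact (hda x (hsub (closure_ball_subset_closedBall hx))).differentiableAt.differentiableWithinAt
    · intro x hx
      exact ha x (hsub (sphere_subset_closedBall hx))
  · filter_upwards [hdz] with a ha w hw
    exact ha w (ball_subset_ball (by linarith) hw)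

/-- The divided difference of a holomorphic function is jointly continuous, also on the diagonal. -/
theorem continuousOn_dslope_prod {f : ℂ → ℂ} {U : Set ℂ} (hU : IsOpen U)
    (hf : DifferentiableOn ℂ f U) :
    ContinuousOn (fun p : ℂ × ℂ => dslope f p.1 p.2) (U ×ˢ U) := by
  rintro ⟨a, b⟩ ⟨ha, hb⟩
  refine ContinuousAt.continuousWithinAt ?_
  simp only at ha hb
  rcases eq_or_ne b a with rfl | hab
  · have hst : HasStrictDerivAt f (deriv f b) b :=
      (hf.analyticAt (hU.mem_nhds hb)).hasStrictDerivAt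
    have hcd : ContinuousAt (deriv f) b := ((hf.deriv hU).continuousOn).continuousAt (hU.mem_nhds hb)
    rw [Metric.continuousAt_iff']
    intro ε hε
    have h1 := hst.isLittleO.def (half_pos hε)
    have h2 : ∀ᶠ p : ℂ × ℂ in 𝓝 (b, b), dist (deriv f p.1) (deriv f b) < ε :=
      (continuousAt_fst (p := ((b, b) : ℂ × ℂ))).eventually (Metric.continuousAt_iff'.1 hcd ε hε)
    filter_upwards [h1, h2] with p hp1 hp2
    simp only [dslope_same]
    rcases eq_or_ne p.2 p.1 with h | h
    · rw [h, dslope_same]; exact hp2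
    · rw [dslope_of_ne _ h, slope_def_field, dist_eq_norm]
      have hne : p.2 - p.1 ≠ 0 := sub_ne_zero.2 h
      have h3 : (f p.2 - f p.1) / (p.2 - p.1) - deriv f b
          = (f p.1 - f p.2 - (p.1 - p.2) • deriv f b) / (p.1 - p.2) := by
        have : p.1 - p.2 ≠ 0 := sub_ne_zero.2 h.symm
        rw [smul_eq_mul]; field_simp; ring
      rw [h3, norm_div, div_lt_iff₀ (norm_pos_iff.2 (sub_ne_zero.2 h.symm))]
      refine lt_of_le_of_lt hp1 ?_
      have : 0 < ‖p.1 - p.2‖ := norm_pos_iff.2 (sub_ne_zero.2 h.symm)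
      nlinarith
  · have hev : ∀ᶠ p : ℂ × ℂ in 𝓝 (a, b), p.2 ≠ p.1 :=
      (isOpen_ne_fun continuous_snd continuous_fst).mem_nhds hab
    have hfa := (hf.continuousOn.continuousAt (hU.mem_nhds ha))
    have hfb := (hf.continuousOn.continuousAt (hU.mem_nhds hb))
    have hc : ContinuousAt (fun p : ℂ × ℂ => (f p.2 - f p.1) / (p.2 - p.1)) (a, b) := by
      refine ContinuousAt.div ?_ (continuousAt_snd.sub continuousAt_fst) (sub_ne_zero.2 hab)
      exact (ContinuousAt.comp (f := Prod.snd) (x := (a, b)) hfb continuousAt_snd).sub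
        (ContinuousAt.comp (f := Prod.fst) (x := (a, b)) hfa continuousAt_fst)
    refine hc.congr ?_
    filter_upwards [hev] with p hp
    rw [dslope_of_ne _ hp, slope_def_field]

/-- The Cauchy integral `∫ ρ(u) / (c(u) - z) du` of the density `ρ` along `c`. -/
def cauchyTransform (c ρ : ℝ → ℂ) (a b : ℝ) (z : ℂ) : ℂ := ∫ u in a..b, ρ u / (c u - z)

section CauchyTransform
variable {c ρ : ℝ → ℂ} {a b : ℝ}

theorem intervalIntegrable_div_sub (hab : a ≤ b) (hc : ContinuousOn c (Icc a b))
    (hρ : IntervalIntegrable ρ volume a b) {z : ℂ} (hz : z ∉ c '' Icc a b) :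
    IntervalIntegrable (fun u => ρ u / (c u - z)) volume a b := by
  simp only [div_eq_mul_inv]
  refine hρ.mul_continuousOn ?_
  rw [uIcc_of_le hab]
  exact (hc.sub continuousOn_const).inv₀ fun u hu h => hz ⟨u, hu, sub_eq_zero.1 h⟩

theorem differentiableOn_cauchyTransform (hab : a ≤ b) (hc : ContinuousOn c (Icc a b))
    (hρ : IntervalIntegrable ρ volume a b) :
    DifferentiableOn ℂ (cauchyTransform c ρ a b) (c '' Icc a b)ᶜ := by
  have hK : IsClosed (c '' Icc a b) := (isCompact_Icc.image_of_continuousOn hc).isClosed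
  unfold cauchyTransform
  simp only [intervalIntegral.integral_of_le hab]
  have hmem : ∀ᵐ u ∂volume.restrict (Ioc a b), u ∈ Ioc a b := ae_restrict_mem measurableSet_Ioc
  refine differentiableOn_integral_of_dominated (fun z hz => ?_) ?_ (fun z hz => ?_)
  · exact ((intervalIntegrable_iff_integrableOn_Ioc_of_le hab).1
      (intervalIntegrable_div_sub hab hc hρ hz)).aestronglyMeasurable
  · filter_upwards [hmem] with u hu
    refine DifferentiableOn.div (differentiableOn_const _)
      ((differentiableOn_const _).sub differentiableOn_id) fun z hz h => ?_
    exact hz ⟨u, Ioc_subset_Icc_self hu, sub_eq_zero.1 h⟩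
  · obtain ⟨ε, hε, hball⟩ := Metric.isOpen_iff.1 hK.isOpen_compl z hz
    refine ⟨ε / 2, half_pos hε, (ball_subset_ball (by linarith)).trans hball,
      fun u => ‖ρ u‖ / (ε / 2),
      (((intervalIntegrable_iff_integrableOn_Ioc_of_le hab).1 hρ).norm.div_const _), ?_⟩
    filter_upwards [hmem] with u hu w hw
    rw [norm_div]
    have : ε ≤ dist (c u) z := by
      by_contra! h
      exact hball h ⟨u, Ioc_subset_Icc_self hu, rfl⟩
    have h2 : ε / 2 ≤ ‖c u - w‖ := by
      rw [← dist_eq_norm]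
      rw [mem_ball] at hw
      linarith [dist_triangle (c u) w z]
    gcongr

theorem tendsto_cauchyTransform_cocompact (hab : a ≤ b) (hc : ContinuousOn c (Icc a b))
    (hρ : IntervalIntegrable ρ volume a b) :
    Tendsto (cauchyTransform c ρ a b) (cocompact ℂ) (𝓝 0) := by
  obtain ⟨R, hR⟩ := isCompact_Icc.exists_bound_of_continuousOn hc
  have hρ' := (intervalIntegrable_iff_integrableOn_Ioc_of_le hab).1 hρ
  set I := ∫ u in Ioc a b, ‖ρ u‖
  have hlim : Tendsto (fun z : ℂ => I / (‖z‖ - R)) (cocompact ℂ) (𝓝 0) := by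
    refine Tendsto.div_atTop tendsto_const_nhds ?_
    exact tendsto_atTop_add_const_right _ _ (tendsto_norm_cocompact_atTop (E := ℂ))
  refine squeeze_zero_norm' ?_ hlim
  filter_upwards [(tendsto_norm_cocompact_atTop (E := ℂ)).eventually_gt_atTop R] with z hz
  unfold cauchyTransform
  rw [intervalIntegral.integral_of_le hab]
  have hpos : 0 < ‖z‖ - R := by linarith
  calc ‖∫ u in Ioc a b, ρ u / (c u - z)‖ ≤ ∫ u in Ioc a b, ‖ρ u‖ / (‖z‖ - R) := by
        refine norm_integral_le_of_norm_le (hρ'.norm.div_const _) ?_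
        filter_upwards [ae_restrict_mem measurableSet_Ioc] with u hu
        rw [norm_div]
        have h1 := hR u (Ioc_subset_Icc_self hu)
        have h2 : ‖z‖ - R ≤ ‖c u - z‖ := by
          have := norm_sub_norm_le z (c u)
          rw [norm_sub_rev] at this
          linarith
        gcongr
    _ = I / (‖z‖ - R) := integral_div _ _

/-- Averages of divided differences of a holomorphic function are holomorphic. -/
theorem differentiableOn_integral_dslope (hab : a ≤ b) (hc : ContinuousOn c (Icc a b))
    (hρ : IntervalIntegrable ρ volume a b) {U : Set ℂ} (hU : IsOpen U) {f : ℂ → ℂ}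
    (hf : DifferentiableOn ℂ f U) (hcU : MapsTo c (Icc a b) U) :
    DifferentiableOn ℂ (fun z => ∫ u in a..b, ρ u * dslope f (c u) z) U := by
  simp only [intervalIntegral.integral_of_le hab]
  have hρ' := (intervalIntegrable_iff_integrableOn_Ioc_of_le hab).1 hρ
  have hmem : ∀ᵐ u ∂volume.restrict (Ioc a b), u ∈ Ioc a b := ae_restrict_mem measurableSet_Ioc
  have hcont := continuousOn_dslope_prod hU hf
  refine differentiableOn_integral_of_dominated (fun z hz => ?_) ?_ (fun z hz => ?_)
  · refine hρ'.aestronglyMeasurable.mul ?_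
    refine (ContinuousOn.aestronglyMeasurable (s := Icc a b) ?_ measurableSet_Icc).mono_measure
      (Measure.restrict_mono Ioc_subset_Icc_self le_rfl)
    exact hcont.comp (f := fun u => (c u, z)) (hc.prodMk continuousOn_const)
      fun u hu => ⟨hcU hu, hz⟩
  · filter_upwards [hmem] with u hu
    exact (differentiableOn_const _).mul ((Complex.differentiableOn_dslope
      (hU.mem_nhds (hcU (Ioc_subset_Icc_self hu)))).2 hf)
  · obtain ⟨ε, hε, hball⟩ := Metric.isOpen_iff.1 hU z hz
    have hKc : IsCompact ((c '' Icc a b) ×ˢ closedBall z (ε / 2)) :=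
      (isCompact_Icc.image_of_continuousOn hc).prod (isCompact_closedBall _ _)
    obtain ⟨M, hM⟩ := hKc.exists_bound_of_continuousOn (hcont.mono (prod_mono hcU.image_subset
      ((closedBall_subset_ball (by linarith)).trans hball)))
    refine ⟨ε / 2, half_pos hε, (ball_subset_ball (by linarith)).trans hball,
      fun u => ‖ρ u‖ * M, hρ'.norm.mul_const _, ?_⟩
    filter_upwards [hmem] with u hu w hw
    rw [norm_mul]
    gcongr
    exact hM (c u, w) ⟨⟨u, Ioc_subset_Icc_self hu, rfl⟩, ball_subset_closedBall hw⟩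

end CauchyTransform

/-! ### Cauchy's theorem in its homology form -/

/-- The data of a closed curve that the winding number argument uses. -/
structure IsClosedCurve (Γ : ℝ → ℂ) (B : Finset ℝ) : Prop where
  continuousOn : ContinuousOn Γ (Icc 0 1)
  hasDerivAt : ∀ u ∈ Ioo (0 : ℝ) 1 \ B, HasDerivAt Γ (deriv Γ u) u
  integrable : IntervalIntegrable (deriv Γ) volume 0 1
  closed : Γ 0 = Γ 1

namespace IsClosedCurve
variable {Γ : ℝ → ℂ} {B : Finset ℝ}

/-- The logarithmic derivative of a function along a closed curve integrates to zero as long as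
the values stay in the domain of the logarithm. -/
theorem integral_logDeriv_eq_zero (h : IsClosedCurve Γ B) {q q' : ℂ → ℂ}
    (hq : ∀ w ∈ support Γ, HasDerivAt q (q' w) w) (hs : ∀ w ∈ support Γ, q w ∈ Complex.slitPlane)
    (hc : ContinuousOn q' (support Γ)) :
    ∫ u in (0 : ℝ)..1, q' (Γ u) / q (Γ u) * deriv Γ u = 0 := by
  have hmaps : MapsTo Γ (Icc 0 1) (support Γ) := fun u hu => ⟨u, hu, rfl⟩
  have hqc : ContinuousOn (fun u => q (Γ u)) (Icc 0 1) :=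
    ContinuousOn.comp (t := support Γ)
      (fun w hw => (hq w hw).continuousAt.continuousWithinAt) h.continuousOn hmaps
  rw [integral_eq_of_hasDerivAt_off_countable_of_le (fun u => Complex.log (q (Γ u))) _ zero_le_one
    B.countable_toSet (hqc.clog fun u hu => hs _ (hmaps hu)), h.closed, sub_self]
  · intro u hu
    have hu' : u ∈ Icc (0 : ℝ) 1 := Ioo_subset_Icc_self hu.1
    have h1 : HasDerivAt (fun u => q (Γ u)) (q' (Γ u) * deriv Γ u) u :=
      (hq _ (hmaps hu')).comp u (h.hasDerivAt u hu)
    convert! h1.clog_real (hs _ (hmaps hu')) using 1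
    ring
  · refine h.integrable.continuousOn_mul ?_
    rw [uIcc_of_le zero_le_one]
    exact (hc.comp h.continuousOn hmaps).div hqc fun u hu =>
      Complex.slitPlane_ne_zero (hs _ (hmaps hu))

theorem isClosed_support (h : IsClosedCurve Γ B) : IsClosed (support Γ) :=
  (isCompact_Icc.image_of_continuousOn h.continuousOn).isClosed

/-- The index does not change on a disc around `z` that does not meet the curve. -/
theorem index_eq (h : IsClosedCurve Γ B) {z w : ℂ}
    (hzw : ∀ x ∈ support Γ, ‖w - z‖ < ‖x - z‖) : index Γ w = index Γ z := by
  have hz : ∀ x ∈ support Γ, x - z ≠ 0 := fun x hx h0 => by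
    have := hzw x hx; rw [h0, norm_zero] at this; linarith [norm_nonneg (w - z)]
  have hw : ∀ x ∈ support Γ, x - w ≠ 0 := fun x hx h0 => by
    have := hzw x hx; rw [sub_eq_zero.1 h0] at this; exact lt_irrefl _ this
  have hmaps : MapsTo Γ (Icc 0 1) (support Γ) := fun u hu => ⟨u, hu, rfl⟩
  -- on the curve the quotient `(x - w) / (x - z)` stays in the disc of radius one around one
  have key := h.integral_logDeriv_eq_zero (q := fun x => (x - w) / (x - z))
    (q' := fun x => (1 * (x - z) - (x - w) * 1) / (x - z) ^ 2)
    (fun x hx => ((hasDerivAt_id x).sub_const w).div ((hasDerivAt_id x).sub_const z) (hz x hx))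
    (fun x hx => by
      refine Complex.ball_one_subset_slitPlane ?_
      rw [mem_ball, dist_eq_norm]
      have : (x - w) / (x - z) - 1 = (z - w) / (x - z) := by
        have := hz x hx; field_simp; ring
      rw [this, norm_div, div_lt_one (norm_pos_iff.2 (hz x hx)), norm_sub_rev]
      exact hzw x hx)
    (by
      refine ContinuousOn.div (by fun_prop) (by fun_prop) fun x hx => pow_ne_zero 2 (hz x hx))
  unfold index curveInt
  congr 1
  have hi : ∀ y, (∀ x ∈ support Γ, x - y ≠ 0) →
      IntervalIntegrable (fun t => (Γ t - y)⁻¹ * deriv Γ t) volume 0 1 := by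
    intro y hy
    refine h.integrable.continuousOn_mul ?_
    rw [uIcc_of_le zero_le_one]
    exact (h.continuousOn.sub continuousOn_const).inv₀ fun u hu => hy _ (hmaps hu)
  rw [← sub_eq_zero, ← intervalIntegral.integral_sub (hi w hw) (hi z hz), ← key]
  refine intervalIntegral.integral_congr fun u hu => ?_
  rw [uIcc_of_le zero_le_one] at hu
  have h1 := hz _ (hmaps hu)
  have h2 := hw _ (hmaps hu)
  field_simp

/-- The index vanishes around the points that are farther from the origin than the curve. -/
theorem index_eq_zero_of_large (h : IsClosedCurve Γ B) {z : ℂ}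
    (hz : ∀ x ∈ support Γ, ‖x‖ < ‖z‖) : index Γ z = 0 := by
  have hmaps : MapsTo Γ (Icc 0 1) (support Γ) := fun u hu => ⟨u, hu, rfl⟩
  have hz0 : z ≠ 0 := by
    have := hz _ (hmaps (left_mem_Icc.2 zero_le_one))
    exact norm_pos_iff.1 (lt_of_le_of_lt (norm_nonneg _) this)
  have hxz : ∀ x ∈ support Γ, x - z ≠ 0 := fun x hx h0 => by
    have := hz x hx; rw [sub_eq_zero.1 h0] at this; exact lt_irrefl _ this
  have key := h.integral_logDeriv_eq_zero (q := fun x => (x - z) / (-z))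
    (q' := fun x => 1 / (-z))
    (fun x hx => ((hasDerivAt_id x).sub_const z).div_const _)
    (fun x hx => by
      refine Complex.ball_one_subset_slitPlane ?_
      rw [mem_ball, dist_eq_norm]
      have : (x - z) / (-z) - 1 = x / (-z) := by field_simp; ring
      rw [this, norm_div, norm_neg, div_lt_one (norm_pos_iff.2 hz0)]
      exact hz x hx)
    continuousOn_const
  unfold index curveInt
  rw [show (∫ t in (0 : ℝ)..1, (Γ t - z)⁻¹ * deriv Γ t)
      = ∫ u in (0 : ℝ)..1, 1 / (-z) / ((Γ u - z) / (-z)) * deriv Γ u from ?_, key, mul_zero]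
  refine intervalIntegral.integral_congr fun u hu => ?_
  rw [uIcc_of_le zero_le_one] at hu
  have h1 := hxz _ (hmaps hu)
  field_simp

/-- Cauchy's integral formula for a closed curve that has index zero around every point outside
the domain of the function. Dixon's argument: the average over the curve of the divided
differences of `f` extends to an entire function that vanishes at infinity. -/
theorem curveInt_div_sub (h : IsClosedCurve Γ B) {U : Set ℂ} (hU : IsOpen U)
    (hΓU : support Γ ⊆ U) (hind : ∀ z, z ∉ U → index Γ z = 0) {f : ℂ → ℂ}
    (hf : DifferentiableOn ℂ f U) {z : ℂ} (hz : z ∈ U) (hzΓ : z ∉ support Γ) :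
    curveInt Γ (fun w => f w / (w - z)) = 2 * Real.pi * Complex.I * index Γ z * f z := by
  classical
  have hmaps : MapsTo Γ (Icc 0 1) (support Γ) := fun u hu => ⟨u, hu, rfl⟩
  have hfc : ContinuousOn (fun u => f (Γ u)) (uIcc 0 1) := by
    rw [uIcc_of_le zero_le_one]
    exact hf.continuousOn.comp h.continuousOn fun u hu => hΓU (hmaps hu)
  have hρ : IntervalIntegrable (fun u => f (Γ u) * deriv Γ u) volume 0 1 :=
    h.integrable.continuousOn_mul hfc
  set C : ℂ → ℂ := cauchyTransform Γ (fun u => f (Γ u) * deriv Γ u) 0 1 with hC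
  set D : ℂ → ℂ := fun z => ∫ u in (0 : ℝ)..1, deriv Γ u * dslope f (Γ u) z with hD
  have hCd : DifferentiableOn ℂ C (support Γ)ᶜ :=
    differentiableOn_cauchyTransform zero_le_one h.continuousOn hρ
  have hDd : DifferentiableOn ℂ D U :=
    differentiableOn_integral_dslope zero_le_one h.continuousOn h.integrable hU hf
      fun u hu => hΓU (hmaps hu)
  have hDC : ∀ w, w ∉ support Γ → D w = C w - 2 * Real.pi * Complex.I * index Γ w * f w := by
    intro w hw
    have hpi : (2 * Real.pi * Complex.I : ℂ) ≠ 0 := Complex.two_pi_I_ne_zero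
    have hi1 := intervalIntegrable_div_sub zero_le_one h.continuousOn hρ hw
    have hi2 := intervalIntegrable_div_sub zero_le_one h.continuousOn
      (h.integrable.mul_const (f w)) hw
    have e1 : 2 * Real.pi * Complex.I * index Γ w * f w
        = ∫ u in (0 : ℝ)..1, deriv Γ u * f w / (Γ u - w) := by
      unfold index curveInt
      rw [← mul_assoc, mul_inv_cancel₀ hpi, one_mul, ← intervalIntegral.integral_mul_const]
      congr 1; ext u; ring
    rw [hC, e1, cauchyTransform, ← intervalIntegral.integral_sub hi1 hi2]
    refine intervalIntegral.integral_congr fun u hu => ?_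
    rw [uIcc_of_le zero_le_one] at hu
    have hne : w ≠ Γ u := fun h0 => hw (h0 ▸ hmaps hu)
    simp only [dslope_of_ne _ hne, slope_def_field]
    have h1 : w - Γ u ≠ 0 := sub_ne_zero.2 hne
    have h2 : Γ u - w ≠ 0 := sub_ne_zero.2 hne.symm
    field_simp
    ring
  -- `D` on `U` and `C` off `U` fit together: near a point outside `U` the index is zero, and
  -- there `D` and `C` agree
  set G : ℂ → ℂ := fun w => if w ∈ U then D w else C w with hG
  have hGC : ∀ w, w ∉ support Γ → index Γ w = 0 → G w = C w := by
    intro w hw hi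
    simp only [hG]
    split_ifs
    · rw [hDC w hw, hi]; ring
    · rfl
  have hGd : Differentiable ℂ G := by
    intro w
    by_cases hw : w ∈ U
    · refine (hDd.differentiableAt (hU.mem_nhds hw)).congr_of_eventuallyEq ?_
      filter_upwards [hU.mem_nhds hw] with x hx using if_pos hx
    · have hwΓ : w ∈ (support Γ)ᶜ := fun h0 => hw (hΓU h0)
      obtain ⟨ε, hε, hball⟩ := Metric.isOpen_iff.1 h.isClosed_support.isOpen_compl w hwΓ
      refine (hCd.differentiableAt
        (h.isClosed_support.isOpen_compl.mem_nhds hwΓ)).congr_of_eventuallyEq ?_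
      filter_upwards [ball_mem_nhds w hε] with x hx
      refine hGC x (hball hx) ?_
      rw [h.index_eq (z := w), hind w hw]
      intro y hy
      rw [mem_ball, dist_eq_norm] at hx
      refine lt_of_lt_of_le hx ?_
      by_contra! h0
      exact hball (by rwa [mem_ball, dist_eq_norm]) hy
  have hlim : Tendsto G (cocompact ℂ) (𝓝 0) := by
    refine (tendsto_cauchyTransform_cocompact zero_le_one h.continuousOn hρ).congr' ?_
    obtain ⟨R, hR⟩ := isCompact_Icc.exists_bound_of_continuousOn h.continuousOn
    filter_upwards [(tendsto_norm_cocompact_atTop (E := ℂ)).eventually_gt_atTop R] with w hw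
    have hlt : ∀ x ∈ support Γ, ‖x‖ < ‖w‖ := by
      rintro _ ⟨u, hu, rfl⟩
      exact lt_of_le_of_lt (hR u hu) hw
    exact (hGC w (fun h0 => lt_irrefl _ (hlt w h0)) (h.index_eq_zero_of_large hlt)).symm
  have h0 := hGd.apply_eq_of_tendsto_cocompact z hlim
  rw [hG] at h0
  simp only [if_pos hz] at h0
  rw [hDC z hzΓ, sub_eq_zero] at h0
  rw [← h0, hC, curveInt, cauchyTransform]
  congr 1; ext u; ring

end IsClosedCurve

/-! ### Piecewise smooth curves -/

section Piecewise
variable {E : Type*} [NormedAddCommGroup E] [NormedSpace ℝ E] {f : ℝ → E} {B : Finset ℝ}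
  {n : WithTop ℕ∞}

theorem exists_pos_forall_notMem_Ioo (B : Finset ℝ) (u : ℝ) :
    ∃ ε > 0, ∀ x ∈ B, x ≠ u → ε ≤ |x - u| := by
  induction B using Finset.induction_on with
  | empty => exact ⟨1, one_pos, by simp⟩
  | insert y B _ ih =>
    obtain ⟨ε, hε, h⟩ := ih
    rcases eq_or_ne y u with rfl | hy
    · refine ⟨ε, hε, fun x hx hne => ?_⟩
      rcases Finset.mem_insert.1 hx with rfl | hx
      · exact absurd rfl hne
      · exact h x hx hne
    · refine ⟨min ε |y - u|, lt_min hε (abs_pos.2 (sub_ne_zero.2 hy)), fun x hx hne => ?_⟩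
      rcases Finset.mem_insert.1 hx with rfl | hx
      · exact min_le_right _ _
      · exact (min_le_left _ _).trans (h x hx hne)

theorem PiecewiseContDiff.contDiffAt (h : PiecewiseContDiff n f B) {u : ℝ}
    (hu : u ∈ Ioo (0 : ℝ) 1 \ B) : ContDiffAt ℝ n f u := by
  obtain ⟨ε, hε, hB⟩ := exists_pos_forall_notMem_Ioo B u
  obtain ⟨⟨h0, h1⟩, huB⟩ := hu
  have hcd := h.2 (max 0 (u - ε)) (min 1 (u + ε)) (le_max_left _ _)
    (by rw [max_lt_iff, lt_min_iff, lt_min_iff]; refine ⟨⟨?_, ?_⟩, ?_, ?_⟩ <;> linarith)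
    (min_le_left _ _) ?_
  · refine hcd.contDiffAt (Icc_mem_nhds ?_ ?_)
    · exact max_lt h0 (by linarith)
    · exact lt_min h1 (by linarith)
  · intro x hx hx'
    have hne : x ≠ u := fun h => huB (h ▸ hx)
    have h2 := hB x hx hne
    have h3 := (le_max_right 0 (u - ε)).trans_lt hx'.1
    have h4 := hx'.2.trans_le (min_le_right 1 (u + ε))
    have : |x - u| < ε := abs_lt.2 ⟨by linarith, by linarith⟩
    linarith

theorem PiecewiseContDiff.hasDerivAt (h : PiecewiseContDiff n f B) (hn : n ≠ 0) {u : ℝ}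
    (hu : u ∈ Ioo (0 : ℝ) 1 \ B) : HasDerivAt f (deriv f u) u :=
  ((h.contDiffAt hu).differentiableAt hn).hasDerivAt

theorem exists_bound_deriv_Ioo (hn : 1 ≤ n) {s t : ℝ} (hst : s < t)
    (h : ContDiffOn ℝ n f (Icc s t)) : ∃ C, ∀ w ∈ Ioo s t, ‖deriv f w‖ ≤ C := by
  obtain ⟨C, hC⟩ := isCompact_Icc.exists_bound_of_continuousOn
    (h.continuousOn_derivWithin (uniqueDiffOn_Icc hst) hn)
  refine ⟨C, fun w hw => ?_⟩
  rw [← derivWithin_of_mem_nhds (Icc_mem_nhds hw.1 hw.2)]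
  exact hC w (Ioo_subset_Icc_self hw)

/-- The derivative is bounded off a finite set, by compactness of the parameter interval: each
parameter has one-sided neighbourhoods on which the function is smooth up to the boundary. -/
theorem PiecewiseContDiff.exists_bound_deriv (h : PiecewiseContDiff n f B) (hn : 1 ≤ n) :
    ∃ (C : ℝ) (F : Finset ℝ), ∀ w ∈ Ioo (0 : ℝ) 1, w ∉ F → ‖deriv f w‖ ≤ C := by
  classical
  suffices ∃ (C : ℝ) (F : Finset ℝ), ∀ w ∈ Icc (0 : ℝ) 1, w ∈ Ioo (0 : ℝ) 1 → w ∉ F →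
      ‖deriv f w‖ ≤ C by
    obtain ⟨C, F, h⟩ := this
    exact ⟨C, F, fun w hw => h w (Ioo_subset_Icc_self hw) hw⟩
  refine isCompact_Icc.induction_on (p := fun s => ∃ (C : ℝ) (F : Finset ℝ), ∀ w ∈ s,
    w ∈ Ioo (0 : ℝ) 1 → w ∉ F → ‖deriv f w‖ ≤ C) ⟨0, ∅, by simp⟩ ?_ ?_ ?_
  · rintro s t hst ⟨C, F, h⟩
    exact ⟨C, F, fun w hw => h w (hst hw)⟩
  · rintro s t ⟨C, F, h⟩ ⟨C', F', h'⟩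
    refine ⟨max C C', F ∪ F', fun w hw hw1 hw2 => ?_⟩
    rw [Finset.mem_union, not_or] at hw2
    rcases hw with hw | hw
    · exact (h w hw hw1 hw2.1).trans (le_max_left _ _)
    · exact (h' w hw hw1 hw2.2).trans (le_max_right _ _)
  · intro u hu
    obtain ⟨ε, hε, hB⟩ := exists_pos_forall_notMem_Ioo B u
    have hL : ∃ C, ∀ w ∈ Ioo (max 0 (u - ε)) u, ‖deriv f w‖ ≤ C := by
      rcases hu.1.eq_or_lt with rfl | h0
      · exact ⟨0, fun w hw => absurd (hw.2) (not_lt.2 ((le_max_left _ _).trans hw.1.le))⟩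
      · refine exists_bound_deriv_Ioo hn (max_lt h0 (by linarith))
          (h.2 _ _ (le_max_left _ _) (max_lt h0 (by linarith)) hu.2 fun x hx hx' => ?_)
        have h2 := hB x hx hx'.2.ne
        have h3 := (le_max_right 0 (u - ε)).trans_lt hx'.1
        have : |x - u| < ε := abs_lt.2 ⟨by linarith, by linarith [hx'.2]⟩
        linarith
    have hR : ∃ C, ∀ w ∈ Ioo u (min 1 (u + ε)), ‖deriv f w‖ ≤ C := by
      rcases hu.2.eq_or_lt with rfl | h0
      · exact ⟨0, fun w hw => absurd (hw.1) (not_lt.2 (hw.2.le.trans (min_le_left _ _)))⟩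
      · refine exists_bound_deriv_Ioo hn (lt_min h0 (by linarith))
          (h.2 _ _ hu.1 (lt_min h0 (by linarith)) (min_le_left _ _) fun x hx hx' => ?_)
        have h2 := hB x hx hx'.1.ne'
        have h3 := hx'.2.trans_le (min_le_right 1 (u + ε))
        have : |x - u| < ε := abs_lt.2 ⟨by linarith [hx'.1], by linarith⟩
        linarith
    obtain ⟨C, hC⟩ := hL
    obtain ⟨C', hC'⟩ := hR
    refine ⟨Ioo (u - ε) (u + ε), mem_nhdsWithin_of_mem_nhds (Ioo_mem_nhds (by linarith)
      (by linarith)), max C C', {u}, fun w hw hw1 hw2 => ?_⟩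
    rw [Finset.mem_singleton] at hw2
    rcases lt_or_gt_of_ne hw2 with h | h
    · exact (hC w ⟨max_lt hw1.1 hw.1, h⟩).trans (le_max_left _ _)
    · exact (hC' w ⟨h, lt_min hw1.2 hw.2⟩).trans (le_max_right _ _)

theorem PiecewiseContDiff.intervalIntegrable_deriv [CompleteSpace E]
    [SecondCountableTopology E] (h : PiecewiseContDiff n f B)
    (hn : 1 ≤ n) : IntervalIntegrable (deriv f) volume 0 1 := by
  borelize E
  obtain ⟨C, F, hC⟩ := h.exists_bound_deriv hn
  rw [intervalIntegrable_iff_integrableOn_Ioo_of_le zero_le_one]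
  refine Measure.integrableOn_of_bounded (M := C) (by simp)
    (measurable_deriv f).stronglyMeasurable.aestronglyMeasurable ?_
  have hF : ∀ᵐ w ∂(volume.restrict (Ioo (0 : ℝ) 1)), w ∉ F :=
    ae_restrict_of_ae (measure_eq_zero_iff_ae_notMem.1 (F.finite_toSet.measure_zero _))
  filter_upwards [ae_restrict_mem measurableSet_Ioo, hF] with w hw hw2 using hC w hw hw2

end Piecewise

theorem IsSmallLoopAround.isClosedCurve {N : ℕ} {γ : ℝ → ℂ} {c : Fin N → ℝ} {Γ : ℝ → ℂ}
    {BΓ : Finset ℝ} (h : IsSmallLoopAround γ c Γ BΓ) : IsClosedCurve Γ BΓ where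
  continuousOn := h.smooth.1
  hasDerivAt _ hu := h.smooth.hasDerivAt one_ne_zero hu
  integrable := h.smooth.intervalIntegrable_deriv le_rfl
  closed := h.closed

/-! ### Curvilinear boxes along a regular arc -/

/-- Cauchy's theorem for the curvilinear parallelogram `γ(u) + τ e`. -/
theorem integral_boundary_parallelogram {γ : ℝ → ℂ} {α β τ₁ τ₂ : ℝ} (hαβ : α ≤ β) (hτ : τ₁ ≤ τ₂)
    (e : ℂ) (hγ : ∀ u ∈ Icc α β, HasDerivAt γ (deriv γ u) u)
    (hγ' : ContinuousOn (deriv γ) (Icc α β)) {O : Set ℂ} (hO : IsOpen O) {g : ℂ → ℂ}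
    (hg : DifferentiableOn ℂ g O)
    (hmem : ∀ u ∈ Icc α β, ∀ τ ∈ Icc τ₁ τ₂, γ u + τ * e ∈ O) :
    (∫ u in α..β, g (γ u + τ₂ * e) * deriv γ u) - (∫ u in α..β, g (γ u + τ₁ * e) * deriv γ u)
      = ∫ τ in τ₁..τ₂, e * (g (γ β + τ * e) - g (γ α + τ * e)) := by
  have hγc : ContinuousOn γ (Icc α β) := fun u hu => (hγ u hu).continuousAt.continuousWithinAt
  have hΦ : ContinuousOn (fun p : ℝ × ℝ => γ p.1 + p.2 * e) (Icc α β ×ˢ Icc τ₁ τ₂) := by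
    refine ContinuousOn.add (hγc.comp continuousOn_fst fun p hp => hp.1) ?_
    fun_prop
  have hΦm : MapsTo (fun p : ℝ × ℝ => γ p.1 + p.2 * e) (Icc α β ×ˢ Icc τ₁ τ₂) O :=
    fun p hp => hmem _ hp.1 _ hp.2
  have hG : ContinuousOn (fun p : ℝ × ℝ => g (γ p.1 + p.2 * e) * deriv γ p.1)
      (Icc α β ×ˢ Icc τ₁ τ₂) :=
    (hg.continuousOn.comp hΦ hΦm).mul (hγ'.comp continuousOn_fst fun p hp => hp.1)
  have hG' : ContinuousOn (fun p : ℝ × ℝ => deriv g (γ p.1 + p.2 * e) * e * deriv γ p.1)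
      (Icc α β ×ˢ Icc τ₁ τ₂) :=
    (((hg.deriv hO).continuousOn.comp hΦ hΦm).mul continuousOn_const).mul
      (hγ'.comp continuousOn_fst fun p hp => hp.1)
  obtain ⟨M, hM⟩ := (isCompact_Icc.prod isCompact_Icc).exists_bound_of_continuousOn hG
  obtain ⟨M', hM'⟩ := (isCompact_Icc.prod isCompact_Icc).exists_bound_of_continuousOn hG'
  have hslice : ∀ τ ∈ Icc τ₁ τ₂, ContinuousOn (fun u => g (γ u + τ * e) * deriv γ u) (Icc α β) :=
    fun τ hτ => hG.comp (f := fun u => (u, τ)) (by fun_prop) fun u hu => ⟨hu, hτ⟩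
  have hslice' : ∀ τ ∈ Icc τ₁ τ₂,
      ContinuousOn (fun u => deriv g (γ u + τ * e) * e * deriv γ u) (Icc α β) :=
    fun τ hτ => hG'.comp (f := fun u => (u, τ)) (by fun_prop) fun u hu => ⟨hu, hτ⟩
  have hmeas : ∀ h : ℝ → ℂ, ContinuousOn h (Icc α β) →
      AEStronglyMeasurable h (volume.restrict (uIoc α β)) := by
    intro h hh
    rw [uIoc_of_le hαβ]
    exact (hh.aestronglyMeasurable measurableSet_Icc).mono_measure
      (Measure.restrict_mono Ioc_subset_Icc_self le_rfl)
  have hder : ∀ u ∈ Icc α β, ∀ τ ∈ Icc τ₁ τ₂,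
      HasDerivAt (fun τ : ℝ => g (γ u + τ * e) * deriv γ u)
        (deriv g (γ u + τ * e) * e * deriv γ u) τ := by
    intro u hu τ hτ
    have h1 : HasDerivAt (fun τ : ℝ => γ u + τ * e) e τ := by
      simpa using ((Complex.ofRealCLM.hasDerivAt (x := τ)).mul_const e).const_add (γ u)
    exact (((hg.differentiableAt (hO.mem_nhds (hmem u hu τ hτ))).hasDerivAt).comp τ h1).mul_const _
  refine (integral_eq_of_hasDerivAt_off_countable_of_le
    (fun τ : ℝ => ∫ u in α..β, g (γ u + τ * e) * deriv γ u) _ hτ countable_empty ?_ ?_ ?_).symm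
  · intro τ hτ
    refine intervalIntegral.continuousWithinAt_of_dominated_interval (bound := fun _ => M)
      ?_ ?_ (by simp) ?_
    · filter_upwards [self_mem_nhdsWithin] with x hx using hmeas _ (hslice x hx)
    · filter_upwards [self_mem_nhdsWithin] with x hx
      refine ae_of_all _ fun u hu => ?_
      rw [uIoc_of_le hαβ] at hu
      exact hM (u, x) ⟨Ioc_subset_Icc_self hu, hx⟩
    · refine ae_of_all _ fun u hu => ?_
      rw [uIoc_of_le hαβ] at hu
      exact ((hder u (Ioc_subset_Icc_self hu) τ hτ).continuousAt).continuousWithinAt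
  · rintro τ ⟨hτ', -⟩
    have hτI := Ioo_subset_Icc_self hτ'
    have key := (intervalIntegral.hasDerivAt_integral_of_dominated_loc_of_deriv_le (μ := volume)
      (a := α) (b := β) (F := fun (τ : ℝ) u => g (γ u + τ * e) * deriv γ u)
      (F' := fun (τ : ℝ) u => deriv g (γ u + τ * e) * e * deriv γ u) (x₀ := τ) (s := Ioo τ₁ τ₂)
      (bound := fun _ => M') (isOpen_Ioo.mem_nhds hτ') ?_ ?_ ?_ ?_ (by simp) ?_).2
    · convert! key using 1
      have h3 : (fun u => deriv g (γ u + τ * e) * e * deriv γ u)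
          = fun u => e * (deriv g (γ u + τ * e) * deriv γ u) := by ext u; ring
      have h4 : ∀ u ∈ uIcc α β, HasDerivAt (fun u => g (γ u + τ * e))
          (deriv g (γ u + τ * e) * deriv γ u) u := by
        intro u hu
        rw [uIcc_of_le hαβ] at hu
        exact ((hg.differentiableAt (hO.mem_nhds (hmem u hu τ hτI))).hasDerivAt).comp u
          ((hγ u hu).add_const _)
      rw [h3, intervalIntegral.integral_const_mul,
        intervalIntegral.integral_eq_sub_of_hasDerivAt h4]
      refine ContinuousOn.intervalIntegrable ?_
      rw [uIcc_of_le hαβ]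
      exact (((hg.deriv hO).continuousOn.comp hΦ hΦm).comp (f := fun u => (u, τ)) (by fun_prop)
        fun u hu => ⟨hu, hτI⟩).mul hγ'
    · filter_upwards [isOpen_Ioo.mem_nhds hτ'] with x hx
        using hmeas _ (hslice x (Ioo_subset_Icc_self hx))
    · refine ContinuousOn.intervalIntegrable ?_
      rw [uIcc_of_le hαβ]
      exact hslice τ hτI
    · exact hmeas _ (hslice' τ hτI)
    · refine ae_of_all _ fun u hu x hx => ?_
      rw [uIoc_of_le hαβ] at hu
      exact hM' (u, x) ⟨Ioc_subset_Icc_self hu, Ioo_subset_Icc_self hx⟩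
    · refine ae_of_all _ fun u hu x hx => ?_
      rw [uIoc_of_le hαβ] at hu
      exact hder u (Ioc_subset_Icc_self hu) x (Ioo_subset_Icc_self hx)
  · refine ContinuousOn.intervalIntegrable ?_
    rw [uIcc_of_le hτ]
    have hs : ∀ u ∈ Icc α β, ContinuousOn (fun τ : ℝ => g (γ u + τ * e)) (Icc τ₁ τ₂) :=
      fun u hu => (hg.continuousOn.comp hΦ hΦm).comp (f := fun τ => (u, τ)) (by fun_prop)
        fun τ hτ => ⟨hu, hτ⟩
    exact continuousOn_const.mul ((hs β (right_mem_Icc.2 hαβ)).sub (hs α (left_mem_Icc.2 hαβ)))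

/-- Cauchy's theorem for a curvilinear parallelogram one side of which lies on the curve, where
the function has boundary values. -/
theorem integral_boundary_parallelogram_of_tendsto {γ : ℝ → ℂ} {α β a : ℝ} (hαβ : α ≤ β)
    (ha : 0 < a) (e : ℂ) (hγ : ∀ u ∈ Icc α β, HasDerivAt γ (deriv γ u) u)
    (hγ' : ContinuousOn (deriv γ) (Icc α β)) {O : Set ℂ} (hO : IsOpen O) {g : ℂ → ℂ}
    (hg : DifferentiableOn ℂ g O)
    (hmem : ∀ u ∈ Icc α β, ∀ τ ∈ Ioc 0 a, γ u + τ * e ∈ O)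
    {g₀ : ℝ → ℂ} (hlim : ∀ u ∈ Icc α β, Tendsto (fun τ : ℝ => g (γ u + τ * e)) (𝓝[>] 0) (𝓝 (g₀ u)))
    {M : ℝ} (hM : ∀ᶠ τ : ℝ in 𝓝[>] 0, ∀ u ∈ Icc α β, ‖g (γ u + τ * e)‖ ≤ M)
    (hint : IntervalIntegrable (fun τ : ℝ => e * (g (γ β + τ * e) - g (γ α + τ * e))) volume 0 a) :
    (∫ u in α..β, g (γ u + a * e) * deriv γ u) - (∫ u in α..β, g₀ u * deriv γ u)
      = ∫ τ in (0 : ℝ)..a, e * (g (γ β + τ * e) - g (γ α + τ * e)) := by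
  obtain ⟨M', hM'⟩ := isCompact_Icc.exists_bound_of_continuousOn hγ'
  have hγc : ContinuousOn γ (Icc α β) := fun u hu => (hγ u hu).continuousAt.continuousWithinAt
  have hIoc : ∀ᶠ τ : ℝ in 𝓝[>] 0, τ ∈ Ioc 0 a := Ioc_mem_nhdsGT ha
  have h1 : Tendsto (fun τ : ℝ => ∫ u in α..β, g (γ u + τ * e) * deriv γ u) (𝓝[>] 0)
      (𝓝 (∫ u in α..β, g₀ u * deriv γ u)) := by
    refine intervalIntegral.tendsto_integral_filter_of_dominated_convergence
      (fun _ => M * M') ?_ ?_ (by simp) ?_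
    · filter_upwards [hIoc] with τ hτ
      rw [uIoc_of_le hαβ]
      refine (ContinuousOn.aestronglyMeasurable (s := Icc α β) ?_ measurableSet_Icc).mono_measure
        (Measure.restrict_mono Ioc_subset_Icc_self le_rfl)
      exact (hg.continuousOn.comp (hγc.add continuousOn_const) fun u hu => hmem u hu τ hτ).mul hγ'
    · filter_upwards [hM] with τ hτ
      refine ae_of_all _ fun u hu => ?_
      rw [uIoc_of_le hαβ] at hu
      have hu := Ioc_subset_Icc_self hu
      rw [norm_mul]
      exact mul_le_mul (hτ u hu) (hM' u hu) (norm_nonneg _) ((norm_nonneg _).trans (hτ u hu))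
    · refine ae_of_all _ fun u hu => ?_
      rw [uIoc_of_le hαβ] at hu
      exact (hlim u (Ioc_subset_Icc_self hu)).mul_const _
  have h2 : Tendsto (fun τ₁ : ℝ => ∫ τ in τ₁..a, e * (g (γ β + τ * e) - g (γ α + τ * e))) (𝓝[>] 0)
      (𝓝 (∫ τ in (0 : ℝ)..a, e * (g (γ β + τ * e) - g (γ α + τ * e)))) := by
    have h3 := (intervalIntegral.continuousOn_primitive_interval_left
      (by simpa using (intervalIntegrable_iff').1 hint)) 0 (by simp)
    refine h3.tendsto.mono_left (nhdsWithin_le_iff.2 ?_)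
    filter_upwards [hIoc] with τ hτ
    rw [uIcc_of_le ha.le]
    exact Ioc_subset_Icc_self hτ
  refine tendsto_nhds_unique ((tendsto_const_nhds.sub h1).congr' ?_) h2
  filter_upwards [hIoc] with τ hτ
  exact integral_boundary_parallelogram hαβ hτ.2 e hγ hγ' hO hg
    fun u hu x hx => hmem u hu x ⟨hτ.1.trans_le hx.1, hx.2⟩

/-- On `[t₀ - a, t₀ + a]` the curve is of class `C¹` and so close to the line with direction `d`
that the curvilinear box with sides parallel to `i d` built on it is embedded. -/
structure IsBox (γ : ℝ → ℂ) (t₀ a : ℝ) (d : ℂ) : Prop where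
  pos : 0 < a
  ne_zero : d ≠ 0
  hasDerivAt : ∀ u ∈ Icc (t₀ - a) (t₀ + a), HasDerivAt γ (deriv γ u) u
  continuousOn_deriv : ContinuousOn (deriv γ) (Icc (t₀ - a) (t₀ + a))
  near : ∀ u ∈ Icc (t₀ - a) (t₀ + a), ∀ v ∈ Icc (t₀ - a) (t₀ + a),
    ‖γ u - γ v - (u - v) * d‖ ≤ ‖d‖ / 4 * |u - v|

namespace IsBox
variable {γ : ℝ → ℂ} {t₀ a : ℝ} {d : ℂ}

theorem mono (h : IsBox γ t₀ a d) {b : ℝ} (hb : 0 < b) (hba : b ≤ a) : IsBox γ t₀ b d := by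
  have hs : Icc (t₀ - b) (t₀ + b) ⊆ Icc (t₀ - a) (t₀ + a) :=
    Icc_subset_Icc (by linarith) (by linarith)
  exact ⟨hb, h.ne_zero, fun u hu => h.hasDerivAt u (hs hu), h.continuousOn_deriv.mono hs,
    fun u hu v hv => h.near u (hs hu) v (hs hv)⟩

theorem center_mem (h : IsBox γ t₀ a d) : t₀ ∈ Icc (t₀ - a) (t₀ + a) :=
  ⟨by linarith [h.pos], by linarith [h.pos]⟩

theorem continuousOn (h : IsBox γ t₀ a d) : ContinuousOn γ (Icc (t₀ - a) (t₀ + a)) :=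
  fun u hu => (h.hasDerivAt u hu).continuousAt.continuousWithinAt

/-- In the coordinate `z / d` the chord of the arc is close to a real number. -/
theorem norm_chord_div (h : IsBox γ t₀ a d) {u v : ℝ} (hu : u ∈ Icc (t₀ - a) (t₀ + a))
    (hv : v ∈ Icc (t₀ - a) (t₀ + a)) : ‖(γ u - γ v) / d - (u - v : ℝ)‖ ≤ |u - v| / 4 := by
  have hd := norm_pos_iff.2 h.ne_zero
  have h1 : (γ u - γ v) / d - (u - v : ℝ) = (γ u - γ v - (u - v) * d) / d := by
    have := h.ne_zero
    push_cast; field_simp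
  rw [h1, norm_div, div_le_iff₀ hd]
  linarith [h.near u hu v hv]

/-- Transversal translates of points of the arc move away linearly from its other points. -/
theorem le_norm_sub_sub (h : IsBox γ t₀ a d) {u v : ℝ} (hu : u ∈ Icc (t₀ - a) (t₀ + a))
    (hv : v ∈ Icc (t₀ - a) (t₀ + a)) (τ : ℝ) :
    3 / 4 * ‖d‖ * |u - v| ≤ ‖γ u - (γ v + τ * (Complex.I * d))‖ := by
  have hd := norm_pos_iff.2 h.ne_zero
  have h1 := h.norm_chord_div hu hv
  have h2 : γ u - (γ v + τ * (Complex.I * d)) = d * ((γ u - γ v) / d - τ * Complex.I) := by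
    have := h.ne_zero
    field_simp; ring
  rw [h2, norm_mul]
  have h3 := Complex.abs_re_le_norm ((γ u - γ v) / d - τ * Complex.I)
  have h4 := Complex.abs_re_le_norm ((γ u - γ v) / d - (u - v : ℝ))
  have h5 : ((γ u - γ v) / d - τ * Complex.I).re = ((γ u - γ v) / d).re := by simp
  have h6 : ((γ u - γ v) / d - (u - v : ℝ)).re = ((γ u - γ v) / d).re - (u - v) := by
    rw [Complex.sub_re, Complex.ofReal_re]
  rw [h5] at h3
  rw [h6] at h4
  have h7 : |u - v| ≤ |((γ u - γ v) / d).re| + |((γ u - γ v) / d).re - (u - v)| := by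
    have := abs_sub_abs_le_abs_sub (u - v) ((γ u - γ v) / d).re
    rw [abs_sub_comm (u - v)] at this
    linarith
  nlinarith

theorem le_norm_sub (h : IsBox γ t₀ a d) {u v : ℝ} (hu : u ∈ Icc (t₀ - a) (t₀ + a))
    (hv : v ∈ Icc (t₀ - a) (t₀ + a)) : 3 / 4 * ‖d‖ * |u - v| ≤ ‖γ u - γ v‖ := by
  simpa using h.le_norm_sub_sub hu hv 0

end IsBox

theorem log_I_mul {x : ℂ} (hx : 0 < x.re) :
    Complex.log (Complex.I * x) = Complex.log x + Real.pi / 2 * Complex.I := by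
  have h := abs_lt.1 (Complex.abs_arg_lt_pi_div_two_iff.2 (Or.inl hx))
  have hx0 : x ≠ 0 := fun h0 => by simp [h0] at hx
  rw [Complex.log_mul_eq_add_log_iff Complex.I_ne_zero hx0 |>.2, Complex.log_I, add_comm]
  rw [Complex.arg_I]
  constructor <;> linarith [h.1, h.2, Real.pi_pos]

theorem log_neg_I_mul {x : ℂ} (hx : 0 < x.re) :
    Complex.log (-Complex.I * x) = Complex.log x - Real.pi / 2 * Complex.I := by
  have h := abs_lt.1 (Complex.abs_arg_lt_pi_div_two_iff.2 (Or.inl hx))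
  have hx0 : x ≠ 0 := fun h0 => by simp [h0] at hx
  rw [Complex.log_mul_eq_add_log_iff (neg_ne_zero.2 Complex.I_ne_zero) hx0 |>.2, Complex.log_neg_I]
  · ring
  rw [Complex.arg_neg_I]
  constructor <;> linarith [h.1, h.2, Real.pi_pos]

/-- The integral of `dw / w` along a path in the half plane `Re (κ w) > 0`. -/
theorem integral_div_eq_log_sub {p p' : ℝ → ℂ} {α β : ℝ} (hαβ : α ≤ β)
    (hp : ∀ u ∈ Icc α β, HasDerivAt p (p' u) u) (hp' : ContinuousOn p' (Icc α β)) {κ : ℂ}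
    (hκ : ∀ u ∈ Icc α β, 0 < (κ * p u).re) :
    ∫ u in α..β, p' u / p u = Complex.log (κ * p β) - Complex.log (κ * p α) := by
  have hne : ∀ u ∈ Icc α β, p u ≠ 0 := fun u hu h0 => by
    have := hκ u hu; rw [h0] at this; simp at this
  have hκ0 : κ ≠ 0 := fun h0 => by
    have := hκ α (left_mem_Icc.2 hαβ); rw [h0] at this; simp at this
  refine intervalIntegral.integral_eq_sub_of_hasDerivAt (f := fun u => Complex.log (κ * p u))
    (fun u hu => ?_) ?_
  · rw [uIcc_of_le hαβ] at hu
    have h1 := ((hp u hu).const_mul κ).clog_real (Or.inl (hκ u hu))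
    convert! h1 using 1
    have := hne u hu
    field_simp
  · refine ContinuousOn.intervalIntegrable ?_
    rw [uIcc_of_le hαβ]
    exact hp'.div (fun u hu => (hp u hu).continuousAt.continuousWithinAt) hne

/-- The combination of integrals over the four sides of the box `γ(u) + τ e`,
`|u - t₀| ≤ a`, `|τ| ≤ a`, that makes up the integral over its boundary. -/
def boxInt (γ : ℝ → ℂ) (t₀ a : ℝ) (e : ℂ) (F : ℂ → ℂ) : ℂ :=
  (∫ τ in (-a)..a, e * F (γ (t₀ + a) + τ * e)) - (∫ τ in (-a)..a, e * F (γ (t₀ - a) + τ * e))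
    - (∫ u in (t₀ - a)..(t₀ + a), deriv γ u * F (γ u + a * e))
    + (∫ u in (t₀ - a)..(t₀ + a), deriv γ u * F (γ u - a * e))

namespace IsBox
variable {γ : ℝ → ℂ} {t₀ a : ℝ} {d : ℂ}

theorem right_mem (h : IsBox γ t₀ a d) : t₀ + a ∈ Icc (t₀ - a) (t₀ + a) :=
  ⟨by linarith [h.pos], le_rfl⟩

theorem left_mem (h : IsBox γ t₀ a d) : t₀ - a ∈ Icc (t₀ - a) (t₀ + a) :=
  ⟨le_rfl, by linarith [h.pos]⟩

section Sides
variable {z : ℂ} (h : IsBox γ t₀ a d) (hz : z ∈ ball (γ t₀) (‖d‖ * a / 4))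
include h hz

theorem norm_div_sub {u : ℝ} (hu : u ∈ Icc (t₀ - a) (t₀ + a)) :
    ‖(γ u - z) / d - (u - t₀ : ℝ)‖ < |u - t₀| / 4 + a / 4 := by
  have hd := norm_pos_iff.2 h.ne_zero
  have h1 := h.norm_chord_div hu h.center_mem
  have h2 : (γ u - z) / d - (u - t₀ : ℝ) = ((γ u - γ t₀) / d - (u - t₀ : ℝ)) - (z - γ t₀) / d := by
    ring
  rw [h2]
  refine (norm_sub_le _ _).trans_lt (add_lt_add_of_le_of_lt h1 ?_)
  rw [mem_ball, dist_eq_norm] at hz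
  rw [norm_div, div_lt_iff₀ hd]
  linarith

theorem re_right_pos (τ : ℝ) : 0 < ((γ (t₀ + a) + τ * (Complex.I * d) - z) / d).re := by
  have h1 := h.norm_div_sub hz h.right_mem
  have h2 := (abs_le.1 (Complex.abs_re_le_norm
    ((γ (t₀ + a) - z) / d - (t₀ + a - t₀ : ℝ)))).1
  have h3 : (γ (t₀ + a) + τ * (Complex.I * d) - z) / d = (γ (t₀ + a) - z) / d + τ * Complex.I := by
    have := h.ne_zero
    field_simp; ring
  rw [Complex.sub_re, Complex.ofReal_re] at h2
  rw [add_sub_cancel_left, abs_of_pos h.pos] at h1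
  rw [h3]
  simp only [Complex.add_re, Complex.mul_re, Complex.ofReal_re, Complex.I_re, mul_zero,
    Complex.ofReal_im, Complex.I_im, zero_mul, sub_zero, add_zero]
  rw [add_sub_cancel_left] at h2
  linarith [h.pos]

theorem re_left_neg (τ : ℝ) : ((γ (t₀ - a) + τ * (Complex.I * d) - z) / d).re < 0 := by
  have h1 := h.norm_div_sub hz h.left_mem
  have h2 := (abs_le.1 (Complex.abs_re_le_norm
    ((γ (t₀ - a) - z) / d - (t₀ - a - t₀ : ℝ)))).2
  have h3 : (γ (t₀ - a) + τ * (Complex.I * d) - z) / d = (γ (t₀ - a) - z) / d + τ * Complex.I := by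
    have := h.ne_zero
    field_simp; ring
  have h4 : t₀ - a - t₀ = -a := by ring
  rw [Complex.sub_re, Complex.ofReal_re] at h2
  rw [h4, abs_neg, abs_of_pos h.pos] at h1
  rw [h3]
  simp only [Complex.add_re, Complex.mul_re, Complex.ofReal_re, Complex.I_re, mul_zero,
    Complex.ofReal_im, Complex.I_im, zero_mul, sub_zero, add_zero]
  rw [h4] at h2
  linarith [h.pos]

theorem abs_im_lt {u : ℝ} (hu : u ∈ Icc (t₀ - a) (t₀ + a)) : |((γ u - z) / d).im| < a := by
  have h1 := h.norm_div_sub hz hu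
  have h2 := (Complex.abs_im_le_norm ((γ u - z) / d - (u - t₀ : ℝ)))
  rw [Complex.sub_im, Complex.ofReal_im, sub_zero] at h2
  have h3 : |u - t₀| ≤ a := abs_le.2 ⟨by linarith [hu.1], by linarith [hu.2]⟩
  linarith [h.pos]

theorem im_top_pos {u : ℝ} (hu : u ∈ Icc (t₀ - a) (t₀ + a)) :
    0 < ((γ u + a * (Complex.I * d) - z) / d).im := by
  have h1 := (abs_lt.1 (h.abs_im_lt hz hu)).1
  have h3 : (γ u + a * (Complex.I * d) - z) / d = (γ u - z) / d + a * Complex.I := by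
    have := h.ne_zero
    field_simp; ring
  rw [h3]
  simp only [Complex.add_im, Complex.mul_im, Complex.ofReal_re, Complex.I_re, mul_zero,
    Complex.ofReal_im, Complex.I_im, mul_one, add_zero]
  linarith

theorem im_bottom_neg {u : ℝ} (hu : u ∈ Icc (t₀ - a) (t₀ + a)) :
    ((γ u - a * (Complex.I * d) - z) / d).im < 0 := by
  have h1 := (abs_lt.1 (h.abs_im_lt hz hu)).2
  have h3 : (γ u - a * (Complex.I * d) - z) / d = (γ u - z) / d - a * Complex.I := by
    have := h.ne_zero
    field_simp; ring
  rw [h3]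
  simp only [Complex.sub_im, Complex.mul_im, Complex.ofReal_re, Complex.I_re, mul_zero,
    Complex.ofReal_im, Complex.I_im, mul_one, add_zero]
  linarith

theorem right_ne (τ : ℝ) : γ (t₀ + a) + τ * (Complex.I * d) ≠ z := fun h0 => by
  have := h.re_right_pos hz τ
  rw [h0] at this; simp at this

theorem left_ne (τ : ℝ) : γ (t₀ - a) + τ * (Complex.I * d) ≠ z := fun h0 => by
  have := h.re_left_neg hz τ
  rw [h0] at this; simp at this

theorem top_ne {u : ℝ} (hu : u ∈ Icc (t₀ - a) (t₀ + a)) : γ u + a * (Complex.I * d) ≠ z :=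
  fun h0 => by
    have := h.im_top_pos hz hu
    rw [h0] at this; simp at this

theorem bottom_ne {u : ℝ} (hu : u ∈ Icc (t₀ - a) (t₀ + a)) : γ u - a * (Complex.I * d) ≠ z :=
  fun h0 => by
    have := h.im_bottom_neg hz hu
    rw [h0] at this; simp at this

/-- The boundary of the box winds once around the points near the centre. Each side lies in a
half plane in which a branch of the logarithm is available. -/
theorem boxInt_inv_sub : boxInt γ t₀ a (Complex.I * d) (fun w => (w - z)⁻¹)
    = 2 * Real.pi * Complex.I := by
  have hd := h.ne_zero
  have ha := h.pos
  have hvert : ∀ w : ℂ, ∀ τ : ℝ, HasDerivAt (fun τ : ℝ => (w + τ * (Complex.I * d) - z) / d)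
      Complex.I τ := by
    intro w τ
    have h1 := ((((Complex.ofRealCLM.hasDerivAt (x := τ)).mul_const (Complex.I * d)).const_add
      w).sub_const z).div_const d
    have h2 : Complex.ofRealCLM 1 * (Complex.I * d) / d = Complex.I := by
      simp only [Complex.ofRealCLM_apply, Complex.ofReal_one]; field_simp
    rw [h2] at h1
    exact h1
  have hhor : ∀ w : ℂ, ∀ u ∈ Icc (t₀ - a) (t₀ + a),
      HasDerivAt (fun u : ℝ => (γ u + w - z) / d) (deriv γ u / d) u :=
    fun w u hu => (((h.hasDerivAt u hu).add_const w).sub_const z).div_const d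
  have hc : ContinuousOn (fun u => deriv γ u / d) (Icc (t₀ - a) (t₀ + a)) :=
    h.continuousOn_deriv.div_const d
  have hR := integral_div_eq_log_sub (κ := 1) (by linarith : -a ≤ a)
    (fun τ _ => hvert (γ (t₀ + a)) τ) continuousOn_const
    (fun τ _ => by rw [one_mul]; exact h.re_right_pos hz τ)
  have hL := integral_div_eq_log_sub (κ := -1) (by linarith : -a ≤ a)
    (fun τ _ => hvert (γ (t₀ - a)) τ) continuousOn_const
    (fun τ _ => by rw [neg_one_mul, Complex.neg_re]; linarith [h.re_left_neg hz τ])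
  have hT := integral_div_eq_log_sub (κ := -Complex.I) (by linarith : t₀ - a ≤ t₀ + a)
    (fun u hu => hhor (a * (Complex.I * d)) u hu) hc
    (fun u hu => by simpa using h.im_top_pos hz hu)
  have hB := integral_div_eq_log_sub (κ := Complex.I) (by linarith : t₀ - a ≤ t₀ + a)
    (fun u hu => hhor (-(a * (Complex.I * d))) u hu) hc
    (fun u hu => by
      have := h.im_bottom_neg hz hu
      rw [sub_eq_add_neg (γ u)] at this
      simpa using this)
  have eV : ∀ w : ℂ, (∫ τ in (-a)..a, Complex.I * d * (w + τ * (Complex.I * d) - z)⁻¹)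
      = ∫ τ in (-a)..a, Complex.I / ((w + τ * (Complex.I * d) - z) / d) := by
    intro w
    congr 1; ext τ
    rw [div_div_eq_mul_div, div_eq_mul_inv]
  have eH : ∀ w : ℂ, (∫ u in (t₀ - a)..(t₀ + a), deriv γ u * (γ u + w - z)⁻¹)
      = ∫ u in (t₀ - a)..(t₀ + a), deriv γ u / d / ((γ u + w - z) / d) := by
    intro w
    congr 1; ext u
    rw [div_div_div_cancel_right₀ hd, div_eq_mul_inv]
  have hNE := log_neg_I_mul (by simpa using h.re_right_pos hz a)
  have hSE := log_I_mul (by simpa using h.re_right_pos hz (-a))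
  have hNW : 0 < (-((γ (t₀ - a) + a * (Complex.I * d) - z) / d)).re := by
    rw [Complex.neg_re]; linarith [h.re_left_neg hz a]
  have hSW : 0 < (-((γ (t₀ - a) + (-a : ℝ) * (Complex.I * d) - z) / d)).re := by
    rw [Complex.neg_re]; linarith [h.re_left_neg hz (-a)]
  have hNW' := log_I_mul hNW
  have hSW' := log_neg_I_mul hSW
  unfold boxInt
  simp only [sub_eq_add_neg (γ _)]
  rw [eV, eV, eH, eH, hR, hL, hT, hB]
  simp only [Complex.ofReal_neg, one_mul, neg_mul, mul_neg, neg_neg] at *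
  rw [hNE, hSE, hNW', hSW']
  ring

end Sides
end IsBox

theorem intervalIntegrable_of_continuousOn_diff_singleton {h : ℝ → ℂ} {p q x M : ℝ} (hpq : p ≤ q)
    (hc : ContinuousOn h (Icc p q \ {x})) (hM : ∀ t ∈ Icc p q \ {x}, ‖h t‖ ≤ M) :
    IntervalIntegrable h volume p q := by
  rw [intervalIntegrable_iff_integrableOn_Icc_of_le hpq,
    ← integrableOn_congr_set_ae (sdiff_null_ae_eq_self (measure_singleton x))]
  have hms : MeasurableSet (Icc p q \ {x}) := measurableSet_Icc.diff (measurableSet_singleton x)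
  have : IsFiniteMeasure (volume.restrict (Icc p q \ {x})) :=
    ⟨by rw [Measure.restrict_apply_univ]; exact (measure_mono sdiff_subset).trans_lt measure_Icc_lt_top⟩
  refine Integrable.of_bound (hc.aestronglyMeasurable hms) M ?_
  filter_upwards [ae_restrict_mem hms] with t ht using hM t ht

/-- Splitting of the integral of a divided difference `(F - k) / (c - z)` off the curve. -/
theorem integral_mul_sub_const_div {c ρ F : ℝ → ℂ} {p q : ℝ} (hpq : p ≤ q)
    (hc : ContinuousOn c (Icc p q)) (hρ : IntervalIntegrable ρ volume p q)
    (hF : IntervalIntegrable (fun u => ρ u * F u) volume p q) {z : ℂ} (hz : z ∉ c '' Icc p q)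
    (k : ℂ) :
    IntervalIntegrable (fun u => ρ u * ((F u - k) / (c u - z))) volume p q ∧
    ∫ u in p..q, ρ u * ((F u - k) / (c u - z))
      = (∫ u in p..q, ρ u * (F u / (c u - z))) - k * ∫ u in p..q, ρ u * (c u - z)⁻¹ := by
  have h1 := intervalIntegrable_div_sub hpq hc hF hz
  have h2 := (intervalIntegrable_div_sub hpq hc hρ hz).const_mul k
  have e : (fun u => ρ u * ((F u - k) / (c u - z)))
      = fun u => ρ u * F u / (c u - z) - k * (ρ u / (c u - z)) := by ext u; ring
  refine ⟨e ▸ h1.sub h2, ?_⟩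
  rw [e, intervalIntegral.integral_sub h1 h2, intervalIntegral.integral_const_mul]
  simp only [div_eq_mul_inv, mul_assoc]

namespace IsBox
variable {γ : ℝ → ℂ} {t₀ a : ℝ} {d : ℂ}

/-- Cauchy's theorem for the divided difference of `f` on one half of the box. -/
theorem half_boundary (h : IsBox γ t₀ a d) {Ω : Set ℂ} (hΩ : IsOpen Ω) {f : ℂ → ℂ}
    (hf : DifferentiableOn ℂ f Ω) {e : ℂ}
    (hmem : ∀ u ∈ Icc (t₀ - a) (t₀ + a), ∀ τ ∈ Ioc 0 a, γ u + τ * e ∈ Ω)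
    {M : ℝ} (hM : ∀ u ∈ Icc (t₀ - a) (t₀ + a), ∀ τ ∈ Ioc 0 a, ‖f (γ u + τ * e)‖ ≤ M)
    {f₀ : ℝ → ℂ} (hlim : ∀ u ∈ Icc (t₀ - a) (t₀ + a),
      Tendsto (fun τ : ℝ => f (γ u + τ * e)) (𝓝[>] 0) (𝓝 (f₀ u)))
    {z : ℂ} (hzΩ : z ∈ Ω) (hzγ : ∀ u ∈ Icc (t₀ - a) (t₀ + a), γ u ≠ z)
    (hR : ∀ τ : ℝ, γ (t₀ + a) + τ * e ≠ z) (hL : ∀ τ : ℝ, γ (t₀ - a) + τ * e ≠ z)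
    (hT : ∀ u ∈ Icc (t₀ - a) (t₀ + a), γ u + a * e ≠ z) :
    (∫ u in (t₀ - a)..(t₀ + a), (f (γ u + a * e) - f z) / (γ u + a * e - z) * deriv γ u)
      - (∫ u in (t₀ - a)..(t₀ + a), (f₀ u - f z) / (γ u - z) * deriv γ u)
      = ∫ τ in (0 : ℝ)..a, e * ((f (γ (t₀ + a) + τ * e) - f z) / (γ (t₀ + a) + τ * e - z)
          - (f (γ (t₀ - a) + τ * e) - f z) / (γ (t₀ - a) + τ * e - z)) := by
  have ha := h.pos
  have hle : t₀ - a ≤ t₀ + a := by linarith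
  have hds : ∀ w, w ≠ z → dslope f z w = (f w - f z) / (w - z) := fun w hw => by
    rw [dslope_of_ne _ hw, slope_def_field]
  have hcurve : ∀ u : ℝ, Tendsto (fun τ : ℝ => γ u + τ * e) (𝓝[>] 0) (𝓝 (γ u)) := by
    intro u
    have : Continuous (fun τ : ℝ => γ u + τ * e) := by fun_prop
    have h2 := this.tendsto 0
    simp only [Complex.ofReal_zero, zero_mul, add_zero] at h2
    exact h2.mono_left nhdsWithin_le_nhds
  have hKc : IsClosed (γ '' Icc (t₀ - a) (t₀ + a)) :=
    (isCompact_Icc.image_of_continuousOn h.continuousOn).isClosed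
  obtain ⟨δ, hδ, hball⟩ := Metric.isOpen_iff.1 hKc.isOpen_compl z
    (by rintro ⟨u, hu, h0⟩; exact hzγ u hu h0)
  have hfar : ∀ u ∈ Icc (t₀ - a) (t₀ + a), δ ≤ ‖γ u - z‖ := by
    intro u hu
    by_contra! h0
    exact hball (by rwa [mem_ball, dist_eq_norm]) ⟨u, hu, rfl⟩
  have hsmall : ∀ᶠ τ : ℝ in 𝓝[>] 0, ‖(τ : ℂ) * e‖ < δ / 2 := by
    have : Continuous (fun τ : ℝ => ‖(τ : ℂ) * e‖) := by fun_prop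
    refine nhdsWithin_le_nhds ((this.tendsto 0).eventually_lt_const ?_)
    simpa using half_pos hδ
  have hside : ∀ u ∈ Icc (t₀ - a) (t₀ + a), (∀ τ : ℝ, γ u + τ * e ≠ z) →
      IntervalIntegrable (fun τ : ℝ => (f (γ u + τ * e) - f z) / (γ u + τ * e - z)) volume 0 a := by
    intro u hu hne
    refine intervalIntegrable_div_sub (c := fun τ : ℝ => γ u + τ * e) ha.le (by fun_prop) ?_
      (by rintro ⟨τ, -, h0⟩; exact hne τ h0)
    refine intervalIntegrable_of_continuousOn_diff_singleton (x := 0) (M := M + ‖f z‖) ha.le ?_ ?_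
    · refine ContinuousOn.sub (hf.continuousOn.comp (by fun_prop) fun τ hτ => ?_) continuousOn_const
      exact hmem u hu τ ⟨lt_of_le_of_ne hτ.1.1 (Ne.symm hτ.2), hτ.1.2⟩
    · intro τ hτ
      exact (norm_sub_le _ _).trans (add_le_add_left
        (hM u hu τ ⟨lt_of_le_of_ne hτ.1.1 (Ne.symm hτ.2), hτ.1.2⟩) _)
  have key := integral_boundary_parallelogram_of_tendsto hle ha e h.hasDerivAt h.continuousOn_deriv
    hΩ ((Complex.differentiableOn_dslope (hΩ.mem_nhds hzΩ)).2 hf) hmem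
    (g₀ := fun u => (f₀ u - f z) / (γ u - z)) (fun u hu => ?_) (M := (M + ‖f z‖) / (δ / 2)) ?_ ?_
  · convert! key using 2
    · refine intervalIntegral.integral_congr fun u hu => ?_
      rw [uIcc_of_le hle] at hu
      rw [hds _ (hT u hu)]
    · ext τ
      rw [hds _ (hR τ), hds _ (hL τ)]
  · refine Tendsto.congr' ?_ (((hlim u hu).sub_const (f z)).div ((hcurve u).sub_const z)
      (sub_ne_zero.2 (hzγ u hu)))
    filter_upwards [(hcurve u).eventually_ne (hzγ u hu)] with τ hτ
    rw [hds _ hτ]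
    rfl
  · filter_upwards [hsmall, Ioc_mem_nhdsGT ha] with τ hτ hτa u hu
    have h1 : δ / 2 ≤ ‖γ u + τ * e - z‖ := by
      have h2 := norm_sub_le (γ u + τ * e - z) (τ * e)
      rw [show γ u + τ * e - z - τ * e = γ u - z by ring] at h2
      linarith [hfar u hu]
    have h3 : γ u + τ * e ≠ z := fun h0 => by
      rw [h0, sub_self, norm_zero] at h1; linarith
    rw [hds _ h3, norm_div]
    have := norm_sub_le (f (γ u + τ * e)) (f z)
    have := hM u hu τ hτa
    have h5 : ‖f (γ u + τ * e) - f z‖ ≤ M + ‖f z‖ := by linarith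
    have h6 : 0 ≤ M + ‖f z‖ := (norm_nonneg _).trans h5
    gcongr
  · refine IntervalIntegrable.const_mul ?_ _
    refine IntervalIntegrable.congr (f := fun τ : ℝ =>
      (f (γ (t₀ + a) + τ * e) - f z) / (γ (t₀ + a) + τ * e - z)
        - (f (γ (t₀ - a) + τ * e) - f z) / (γ (t₀ - a) + τ * e - z)) (fun τ _ => ?_)
      ((hside _ h.right_mem hR).sub (hside _ h.left_mem hL))
    simp only
    rw [hds _ (hR τ), hds _ (hL τ)]

/-- A function that is holomorphic off the arc and has boundary values on it from both sides is,
near the centre of the box, the sum of a holomorphic function and of the Cauchy integral of its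
jump. -/
theorem exists_eq_add_cauchyTransform (h : IsBox γ t₀ a d) {Ω : Set ℂ} (hΩ : IsOpen Ω) {f : ℂ → ℂ}
    (hf : DifferentiableOn ℂ f Ω)
    (hmem : ∀ u ∈ Icc (t₀ - a) (t₀ + a), ∀ τ ∈ Icc (-a) a, τ ≠ 0 →
      γ u + τ * (Complex.I * d) ∈ Ω)
    (hoff : ∀ u ∈ Icc (t₀ - a) (t₀ + a), γ u ∉ Ω)
    {M : ℝ} (hM : ∀ u ∈ Icc (t₀ - a) (t₀ + a), ∀ τ ∈ Icc (-a) a, τ ≠ 0 →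
      ‖f (γ u + τ * (Complex.I * d))‖ ≤ M)
    {fp fm : ℝ → ℂ} (hfp : ContinuousOn fp (Icc (t₀ - a) (t₀ + a)))
    (hfm : ContinuousOn fm (Icc (t₀ - a) (t₀ + a)))
    (hp : ∀ u ∈ Icc (t₀ - a) (t₀ + a),
      Tendsto (fun τ : ℝ => f (γ u + τ * (Complex.I * d))) (𝓝[>] 0) (𝓝 (fp u)))
    (hm : ∀ u ∈ Icc (t₀ - a) (t₀ + a),
      Tendsto (fun τ : ℝ => f (γ u + τ * (Complex.I * d))) (𝓝[<] 0) (𝓝 (fm u))) :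
    ∃ X : ℂ → ℂ, DifferentiableOn ℂ X (ball (γ t₀) (‖d‖ * a / 4)) ∧
      ∀ z ∈ ball (γ t₀) (‖d‖ * a / 4), z ∈ Ω → f z = X z + (2 * Real.pi * Complex.I)⁻¹ *
        cauchyTransform γ (fun u => (fp u - fm u) * deriv γ u) (t₀ - a) (t₀ + a) z := by
  have ha := h.pos
  have hle : t₀ - a ≤ t₀ + a := by linarith
  have hle' : -a ≤ a := by linarith
  set e := Complex.I * d with he
  -- integrability of the densities on the four sides
  have hside : ∀ u ∈ Icc (t₀ - a) (t₀ + a),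
      IntervalIntegrable (fun τ : ℝ => e * f (γ u + τ * e)) volume (-a) a := by
    intro u hu
    refine IntervalIntegrable.const_mul ?_ _
    refine intervalIntegrable_of_continuousOn_diff_singleton (x := 0) (M := M) hle' ?_ ?_
    · exact hf.continuousOn.comp (by fun_prop) fun τ hτ => hmem u hu τ hτ.1 hτ.2
    · exact fun τ hτ => hM u hu τ hτ.1 hτ.2
  have hedge : ∀ τ ∈ Icc (-a) a, τ ≠ 0 →
      IntervalIntegrable (fun u => deriv γ u * f (γ u + τ * e)) volume (t₀ - a) (t₀ + a) := by
    intro τ hτ hτ0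
    refine ContinuousOn.intervalIntegrable ?_
    rw [uIcc_of_le hle]
    exact h.continuousOn_deriv.mul (hf.continuousOn.comp (h.continuousOn.add continuousOn_const)
      fun u hu => hmem u hu τ hτ hτ0)
  have hT := hedge a ⟨hle', le_rfl⟩ ha.ne'
  have hB := hedge (-a) ⟨le_rfl, hle'⟩ (neg_ne_zero.2 ha.ne')
  have hnega : ∀ u : ℝ, γ u + ((-a : ℝ) : ℂ) * e = γ u - a * e := fun u => by push_cast; ring
  simp only [hnega] at hB
  have hvc : ∀ w : ℂ, ContinuousOn (fun τ : ℝ => w + τ * e) (Icc (-a) a) := fun w => by fun_prop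
  have hhc : ∀ w : ℂ, ContinuousOn (fun u : ℝ => γ u + w) (Icc (t₀ - a) (t₀ + a)) :=
    fun w => h.continuousOn.add continuousOn_const
  have hhc' : ∀ w : ℂ, ContinuousOn (fun u : ℝ => γ u - w) (Icc (t₀ - a) (t₀ + a)) :=
    fun w => h.continuousOn.sub continuousOn_const
  refine ⟨fun z => (2 * Real.pi * Complex.I)⁻¹ * boxInt γ t₀ a e (fun w => f w / (w - z)),
    (differentiableOn_const _).mul ?_, fun z hz hzΩ => ?_⟩
  · unfold boxInt
    simp only [← mul_div_assoc]
    refine DifferentiableOn.add (DifferentiableOn.sub (DifferentiableOn.sub ?_ ?_) ?_) ?_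
    · refine (differentiableOn_cauchyTransform hle' (hvc _) (hside _ h.right_mem)).mono ?_
      rintro z hz ⟨τ, -, h0⟩
      exact h.right_ne hz τ h0
    · refine (differentiableOn_cauchyTransform hle' (hvc _) (hside _ h.left_mem)).mono ?_
      rintro z hz ⟨τ, -, h0⟩
      exact h.left_ne hz τ h0
    · refine (differentiableOn_cauchyTransform hle (hhc _) hT).mono ?_
      rintro z hz ⟨u, hu, h0⟩
      exact h.top_ne hz hu h0
    · refine (differentiableOn_cauchyTransform hle (hhc' _) hB).mono ?_
      rintro z hz ⟨u, hu, h0⟩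
      exact h.bottom_ne hz hu h0
  · have hzγ : ∀ u ∈ Icc (t₀ - a) (t₀ + a), γ u ≠ z := fun u hu h0 => hoff u hu (h0 ▸ hzΩ)
    have hne1 : ∀ w : ℂ, ∀ τ : ℝ, w + τ * -e = w + (-τ : ℝ) * e := fun w τ => by push_cast; ring
    have Hp := h.half_boundary hΩ hf (e := e)
      (fun u hu τ hτ => hmem u hu τ ⟨by linarith [hτ.1], hτ.2⟩ hτ.1.ne')
      (fun u hu τ hτ => hM u hu τ ⟨by linarith [hτ.1], hτ.2⟩ hτ.1.ne') hp hzΩ hzγ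
      (h.right_ne hz) (h.left_ne hz) (fun u hu => h.top_ne hz hu)
    have Hm := h.half_boundary hΩ hf (e := -e) (f₀ := fm) (M := M)
      (fun u hu τ hτ => by
        rw [hne1]; exact hmem u hu (-τ) ⟨by linarith [hτ.2], by linarith [hτ.1]⟩ (by linarith [hτ.1]))
      (fun u hu τ hτ => by
        rw [hne1]; exact hM u hu (-τ) ⟨by linarith [hτ.2], by linarith [hτ.1]⟩ (by linarith [hτ.1]))
      (fun u hu => by
        simp only [hne1]
        refine (hm u hu).comp ?_
        simpa using tendsto_neg_nhdsGT (a := (0 : ℝ)))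
      hzΩ hzγ (fun τ => by rw [hne1]; exact h.right_ne hz _)
      (fun τ => by rw [hne1]; exact h.left_ne hz _)
      (fun u hu => by rw [mul_neg, ← sub_eq_add_neg]; exact h.bottom_ne hz hu)
    simp only [mul_neg, ← sub_eq_add_neg] at Hm
    -- the four sides
    have SR := integral_mul_sub_const_div (ρ := fun _ => e) hle' (hvc _)
      intervalIntegrable_const (hside _ h.right_mem)
      (by rintro ⟨τ, -, h0⟩; exact h.right_ne hz τ h0) (f z)
    have SL := integral_mul_sub_const_div (ρ := fun _ => e) hle' (hvc _)
      intervalIntegrable_const (hside _ h.left_mem)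
      (by rintro ⟨τ, -, h0⟩; exact h.left_ne hz τ h0) (f z)
    have hγ'i : IntervalIntegrable (deriv γ) volume (t₀ - a) (t₀ + a) := by
      refine ContinuousOn.intervalIntegrable ?_
      rw [uIcc_of_le hle]; exact h.continuousOn_deriv
    have ST := (integral_mul_sub_const_div hle (hhc (a * e)) hγ'i hT
      (by rintro ⟨u, hu, h0⟩; exact h.top_ne hz hu h0) (f z)).2
    have SB := (integral_mul_sub_const_div hle (hhc' (a * e)) hγ'i hB
      (by rintro ⟨u, hu, h0⟩; exact h.bottom_ne hz hu h0) (f z)).2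
    -- the two boundary integrals along the arc
    have hfpi : IntervalIntegrable (fun u => deriv γ u * fp u) volume (t₀ - a) (t₀ + a) := by
      refine ContinuousOn.intervalIntegrable ?_
      rw [uIcc_of_le hle]; exact h.continuousOn_deriv.mul hfp
    have hfmi : IntervalIntegrable (fun u => deriv γ u * fm u) volume (t₀ - a) (t₀ + a) := by
      refine ContinuousOn.intervalIntegrable ?_
      rw [uIcc_of_le hle]; exact h.continuousOn_deriv.mul hfm
    have hzγ' : z ∉ γ '' Icc (t₀ - a) (t₀ + a) := by
      rintro ⟨u, hu, h0⟩; exact hzγ u hu h0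
    have JP := integral_mul_sub_const_div hle h.continuousOn hγ'i hfpi hzγ' (f z)
    have JM := integral_mul_sub_const_div hle h.continuousOn hγ'i hfmi hzγ' (f z)
    have hjump : cauchyTransform γ (fun u => (fp u - fm u) * deriv γ u) (t₀ - a) (t₀ + a) z
        = (∫ u in (t₀ - a)..(t₀ + a), deriv γ u * (fp u / (γ u - z)))
          - ∫ u in (t₀ - a)..(t₀ + a), deriv γ u * (fm u / (γ u - z)) := by
      simp only [← mul_div_assoc]
      rw [cauchyTransform, ← intervalIntegral.integral_sub
        (intervalIntegrable_div_sub hle h.continuousOn hfpi hzγ')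
        (intervalIntegrable_div_sub hle h.continuousOn hfmi hzγ')]
      congr 1; ext u; ring
    set G : ℝ → ℂ := fun τ => e * ((f (γ (t₀ + a) + τ * e) - f z) / (γ (t₀ + a) + τ * e - z)
          - (f (γ (t₀ - a) + τ * e) - f z) / (γ (t₀ - a) + τ * e - z)) with hG
    have hGi : IntervalIntegrable G volume (-a) a := by
      simp only [hG, mul_sub]
      exact SR.1.sub SL.1
    have hGe : ∫ τ in (-a)..a, G τ
        = (∫ τ in (-a)..a, e * ((f (γ (t₀ + a) + τ * e) - f z) / (γ (t₀ + a) + τ * e - z)))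
        - ∫ τ in (-a)..a, e * ((f (γ (t₀ - a) + τ * e) - f z) / (γ (t₀ - a) + τ * e - z)) := by
      simp only [hG, mul_sub e]
      rw [intervalIntegral.integral_sub SR.1 SL.1]
    rw [SR.2, SL.2] at hGe
    have h0 : (0 : ℝ) ∈ uIcc (-a) a := by rw [uIcc_of_le hle']; exact ⟨by linarith, ha.le⟩
    have hGsum := intervalIntegral.integral_add_adjacent_intervals
      (hGi.mono_set (uIcc_subset_uIcc_left h0)) (hGi.mono_set (uIcc_subset_uIcc_right h0))
    have hneg : ∫ τ in (0 : ℝ)..a, -e * ((f (γ (t₀ + a) - τ * e) - f z)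
          / (γ (t₀ + a) - τ * e - z) - (f (γ (t₀ - a) - τ * e) - f z)
          / (γ (t₀ - a) - τ * e - z)) = -∫ τ in (-a)..0, G τ := by
      have := intervalIntegral.integral_comp_neg (a := 0) (b := a) (fun τ => G τ)
      rw [neg_zero] at this
      rw [← this, ← intervalIntegral.integral_neg]
      congr 1; ext τ
      simp only [hG, Complex.ofReal_neg, neg_mul, ← sub_eq_add_neg]
    rw [hneg] at Hm
    have hω := h.boxInt_inv_sub hz
    rw [← he] at hω
    have hcomm : ∀ A C : ℝ → ℂ, (∫ u in (t₀ - a)..(t₀ + a), A u * C u)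
        = ∫ u in (t₀ - a)..(t₀ + a), C u * A u := fun A C => by congr 1; ext u; ring
    simp only [hcomm _ (deriv γ)] at Hp Hm
    rw [hjump]
    have hpi : (2 * Real.pi * Complex.I : ℂ) ≠ 0 := Complex.two_pi_I_ne_zero
    rw [← mul_add, eq_inv_mul_iff_mul_eq₀ hpi]
    unfold boxInt at hω ⊢
    rw [← hω]
    rw [JP.2, ST] at Hp
    rw [JM.2, SB] at Hm
    rw [hGe] at hGsum
    linear_combination Hp - Hm + hGsum

end IsBox

/-! ### Neighbourhoods of a regular point of the curve -/

section Regular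
variable {γ : ℝ → ℂ} {B : Finset ℝ} {t₀ : ℝ}

theorem exists_Icc_subset_regular (ht₀ : t₀ ∈ Ioo (0 : ℝ) 1 \ B) :
    ∃ ε > 0, Icc (t₀ - ε) (t₀ + ε) ⊆ Ioo (0 : ℝ) 1 \ B := by
  have hO : IsOpen (Ioo (0 : ℝ) 1 \ B) := isOpen_Ioo.sdiff B.finite_toSet.isClosed
  obtain ⟨ε, hε, h⟩ := Metric.isOpen_iff.1 hO t₀ ht₀
  refine ⟨ε / 2, half_pos hε, fun x hx => h ?_⟩
  rw [Real.ball_eq_Ioo]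
  exact ⟨by linarith [hx.1], by linarith [hx.2]⟩

theorem IsPiecewiseSmoothCurve.deriv_ne_zero (hγ : IsPiecewiseSmoothCurve γ B)
    (ht₀ : t₀ ∈ Ioo (0 : ℝ) 1 \ B) : deriv γ t₀ ≠ 0 := by
  obtain ⟨ε, hε, h⟩ := exists_Icc_subset_regular ht₀
  have h1 := (h ⟨le_rfl, by linarith⟩ : t₀ - ε ∈ _)
  have h2 := (h ⟨by linarith, le_rfl⟩ : t₀ + ε ∈ _)
  have := hγ.regular (t₀ - ε) (t₀ + ε) h1.1.1.le (by linarith) h2.1.2.le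
    (fun u hu hu' => (h (Ioo_subset_Icc_self hu')).2 hu) t₀ ⟨by linarith, by linarith⟩
  rwa [derivWithin_of_mem_nhds (Icc_mem_nhds (by linarith) (by linarith))] at this

/-- Around each regular point there is a box, by strict differentiability of the curve. -/
theorem IsPiecewiseSmoothCurve.exists_isBox (hγ : IsPiecewiseSmoothCurve γ B)
    (ht₀ : t₀ ∈ Ioo (0 : ℝ) 1 \ B) :
    ∃ a, IsBox γ t₀ a (deriv γ t₀) ∧ Icc (t₀ - a) (t₀ + a) ⊆ Ioo (0 : ℝ) 1 \ B := by
  obtain ⟨ε, hε, h⟩ := exists_Icc_subset_regular ht₀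
  have hcd := hγ.smooth.contDiffAt ht₀
  have hd := hγ.deriv_ne_zero ht₀
  have hst : HasStrictDerivAt γ (deriv γ t₀) t₀ := hcd.hasStrictDerivAt (by simp)
  have h1 := hst.isLittleO.def (c := ‖deriv γ t₀‖ / 4) (by positivity)
  rw [Metric.eventually_nhds_iff] at h1
  obtain ⟨δ, hδ, h1⟩ := h1
  have hpos : 0 < min ε (δ / 2) := lt_min hε (half_pos hδ)
  have hsub : Icc (t₀ - min ε (δ / 2)) (t₀ + min ε (δ / 2)) ⊆ Icc (t₀ - ε) (t₀ + ε) :=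
    Icc_subset_Icc (by linarith [min_le_left ε (δ / 2)]) (by linarith [min_le_left ε (δ / 2)])
  refine ⟨min ε (δ / 2), ⟨hpos, hd, fun u hu => ?_, fun u hu => ?_, fun u hu v hv => ?_⟩,
    hsub.trans h⟩
  · exact hγ.smooth.hasDerivAt (by simp) (h (hsub hu))
  · have h2 := (hγ.smooth.contDiffAt (h (hsub hu))).continuousAt_fderiv (by simp)
    exact (h2.clm_apply continuousAt_const).continuousWithinAt
  · have hm := min_le_right ε (δ / 2)
    have h3 : dist (u, v) (t₀, t₀) < δ := by
      rw [Prod.dist_eq, max_lt_iff, Real.dist_eq, Real.dist_eq, abs_lt, abs_lt]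
      exact ⟨⟨by linarith [hu.1], by linarith [hu.2]⟩, by linarith [hv.1], by linarith [hv.2]⟩
    have h4 := h1 h3
    simpa [ContinuousLinearMap.toSpanSingleton_apply] using h4

/-- Arbitrarily small boxes around a regular point meet the curve only in the arc they are built
on. -/
theorem IsPiecewiseSmoothCurve.exists_isBox_subset (hγ : IsPiecewiseSmoothCurve γ B)
    (ht₀ : t₀ ∈ Ioo (0 : ℝ) 1 \ B) {W : Set ℂ} (hW : W ∈ 𝓝 (γ t₀)) {I : Set ℝ} (hI : I ∈ 𝓝 t₀) :
    ∃ a, IsBox γ t₀ a (deriv γ t₀) ∧ Icc (t₀ - a) (t₀ + a) ⊆ Ioo (0 : ℝ) 1 \ B ∧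
      Icc (t₀ - a) (t₀ + a) ⊆ I ∧
      (∀ u ∈ Icc (t₀ - a) (t₀ + a), ∀ τ ∈ Icc (-a) a,
        γ u + τ * (Complex.I * deriv γ t₀) ∈ W) ∧
      (∀ u ∈ Icc (t₀ - a) (t₀ + a), ∀ τ ∈ Icc (-a) a, τ ≠ 0 →
        γ u + τ * (Complex.I * deriv γ t₀) ∉ support γ) ∧
      (∀ b, 0 < b → b ≤ a → ∀ u ∈ Icc (0 : ℝ) 1, u ∉ Ioo (t₀ - b) (t₀ + b) →
        γ u ∉ ball (γ t₀) (‖deriv γ t₀‖ * b / 4)) := by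
  set d := deriv γ t₀ with hd
  obtain ⟨b, hb, hbs⟩ := hγ.exists_isBox ht₀
  have hdpos : 0 < ‖d‖ := norm_pos_iff.2 hb.ne_zero
  have hbpos := hb.pos
  -- the rest of the curve stays away from `γ t₀`
  have hrest : IsClosed (γ '' (Icc 0 1 \ Ioo (t₀ - b) (t₀ + b))) := by
    refine IsCompact.isClosed (IsCompact.image_of_continuousOn ?_ (hγ.smooth.1.mono sdiff_subset))
    exact isCompact_Icc.diff isOpen_Ioo
  have hnot : γ t₀ ∉ γ '' (Icc 0 1 \ Ioo (t₀ - b) (t₀ + b)) := by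
    rintro ⟨u, ⟨hu, hu'⟩, h0⟩
    rcases hγ.simple u hu t₀ (Ioo_subset_Icc_self ht₀.1) h0 with rfl | ⟨-, h1⟩ | ⟨-, h1⟩
    · exact hu' ⟨by linarith, by linarith⟩
    · exact ht₀.1.2.ne h1
    · exact ht₀.1.1.ne' h1
  obtain ⟨r, hr, hball⟩ := Metric.mem_nhds_iff.1
    (inter_mem hW (hrest.isOpen_compl.mem_nhds hnot))
  obtain ⟨δ, hδ, hIδ⟩ := Metric.mem_nhds_iff.1 hI
  set a := min b (min (δ / 2) (r / (4 * ‖d‖))) with ha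
  have hapos : 0 < a := by positivity
  have hab : a ≤ b := min_le_left _ _
  have haδ : a ≤ δ / 2 := (min_le_right _ _).trans (min_le_left _ _)
  have har : a * ‖d‖ ≤ r / 4 := by
    have : a ≤ r / (4 * ‖d‖) := (min_le_right _ _).trans (min_le_right _ _)
    rw [le_div_iff₀ (by positivity)] at this
    linarith
  have hbox := hb.mono hapos hab
  have hsub : Icc (t₀ - a) (t₀ + a) ⊆ Icc (t₀ - b) (t₀ + b) :=
    Icc_subset_Icc (by linarith) (by linarith)
  have hin : ∀ u ∈ Icc (t₀ - a) (t₀ + a), ∀ τ ∈ Icc (-a) a,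
      γ u + τ * (Complex.I * d) ∈ ball (γ t₀) r := by
    intro u hu τ hτ
    have h1 := hbox.near u hu t₀ hbox.center_mem
    have hu' : |u - t₀| ≤ a := abs_le.2 ⟨by linarith [hu.1], by linarith [hu.2]⟩
    have hτ' : |τ| ≤ a := abs_le.2 hτ
    rw [mem_ball, dist_eq_norm]
    have e1 : γ u + τ * (Complex.I * d) - γ t₀
        = (γ u - γ t₀ - (u - t₀) * d) + (u - t₀ : ℝ) * d + τ * (Complex.I * d) := by
      push_cast; ring
    have h2 : ‖((u - t₀ : ℝ) : ℂ) * d‖ = |u - t₀| * ‖d‖ := by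
      rw [norm_mul, Complex.norm_real, Real.norm_eq_abs]
    have h3 : ‖(τ : ℂ) * (Complex.I * d)‖ = |τ| * ‖d‖ := by
      rw [norm_mul, norm_mul, Complex.norm_I, one_mul, Complex.norm_real, Real.norm_eq_abs]
    rw [e1]
    have h4 := norm_add_le ((γ u - γ t₀ - (u - t₀) * d) + (u - t₀ : ℝ) * d) (τ * (Complex.I * d))
    have h5 := norm_add_le (γ u - γ t₀ - (u - t₀) * d) ((u - t₀ : ℝ) * d)
    rw [h3] at h4
    rw [h2] at h5
    nlinarith
  refine ⟨a, hbox, (hsub.trans hbs), fun x hx => hIδ ?_, fun u hu τ hτ => (hball (hin u hu τ hτ)).1,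
    fun u hu τ hτ hτ0 => ?_, fun a' ha' haa' u hu hu' h0 => ?_⟩
  · rw [mem_ball, Real.dist_eq, abs_lt]
    exact ⟨by linarith [hx.1], by linarith [hx.2]⟩
  · rintro ⟨v, hv, h0⟩
    have hvb : v ∈ Ioo (t₀ - b) (t₀ + b) := by
      by_contra h1
      exact (hball (hin u hu τ hτ)).2 ⟨v, ⟨hv, h1⟩, h0⟩
    have h1 := hb.le_norm_sub_sub (Ioo_subset_Icc_self hvb) (hsub hu) τ
    rw [h0, sub_self, norm_zero] at h1
    have h2 : |v - u| = 0 := by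
      have := abs_nonneg (v - u)
      by_contra h3
      have : 0 < |v - u| := lt_of_le_of_ne this (Ne.symm h3)
      have : 0 < 3 / 4 * ‖d‖ * |v - u| := by positivity
      linarith
    rw [sub_eq_zero.1 (abs_eq_zero.1 h2), left_eq_add, mul_eq_zero, Complex.ofReal_eq_zero] at h0
    exact h0.elim hτ0 (mul_ne_zero Complex.I_ne_zero hb.ne_zero)
  · by_cases hub : u ∈ Ioo (t₀ - b) (t₀ + b)
    · have h1 := hb.le_norm_sub (Ioo_subset_Icc_self hub) hb.center_mem
      have h2 : a' ≤ |u - t₀| := by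
        by_contra! h3
        rw [abs_lt] at h3
        exact hu' ⟨by linarith, by linarith⟩
      rw [mem_ball, dist_eq_norm] at h0
      nlinarith
    · refine (hball (ball_subset_ball ?_ h0)).2 ⟨u, ⟨hu, hub⟩, rfl⟩
      nlinarith

/-- The upper half of a small box lies on the left of the curve, the lower half on the right. -/
theorem AreSides.box_subset {L R : Set ℂ} (hLR : AreSides γ B L R) {a : ℝ}
    (ht₀ : t₀ ∈ Ioo (0 : ℝ) 1 \ B) (h : IsBox γ t₀ a (deriv γ t₀))
    (hmem : ∀ u ∈ Icc (t₀ - a) (t₀ + a), ∀ τ ∈ Icc (-a) a, τ ≠ 0 →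
        γ u + τ * (Complex.I * deriv γ t₀) ∈ L ∪ R) :
    (∀ u ∈ Icc (t₀ - a) (t₀ + a), ∀ τ ∈ Ioc 0 a, γ u + τ * (Complex.I * deriv γ t₀) ∈ L) ∧
    (∀ u ∈ Icc (t₀ - a) (t₀ + a), ∀ τ ∈ Ico (-a) 0,
      γ u + τ * (Complex.I * deriv γ t₀) ∈ R) := by
  set d := deriv γ t₀ with hd
  have ha := h.pos
  have hΦ : ∀ s : Set ℝ, ContinuousOn (fun p : ℝ × ℝ => γ p.1 + p.2 * (Complex.I * d))
      (Icc (t₀ - a) (t₀ + a) ×ˢ s) := by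
    intro s
    refine ContinuousOn.add (h.continuousOn.comp continuousOn_fst fun p hp => hp.1) ?_
    fun_prop
  constructor
  · have hpre := ((isPreconnected_Icc (a := t₀ - a) (b := t₀ + a)).prod
      (isPreconnected_Ioc (a := 0) (b := a))).image _ (hΦ _)
    have hsub := hpre.subset_left_of_subset_union hLR.isOpen_left hLR.isOpen_right hLR.disjoint ?_ ?_
    · intro u hu τ hτ
      exact hsub ⟨(u, τ), ⟨hu, hτ⟩, rfl⟩
    · rintro _ ⟨⟨u, τ⟩, ⟨hu, hτ⟩, rfl⟩
      exact hmem u hu τ ⟨by linarith [hτ.1], hτ.2⟩ hτ.1.ne'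
    · obtain ⟨ε, hε, hεa⟩ := ((hLR.left t₀ ht₀.1 ht₀.2).and (Ioc_mem_nhdsGT ha)).exists
      exact ⟨_, ⟨(t₀, ε), ⟨h.center_mem, hεa⟩, rfl⟩, hε⟩
  · have hpre := ((isPreconnected_Icc (a := t₀ - a) (b := t₀ + a)).prod
      (isPreconnected_Ico (a := -a) (b := 0))).image _ (hΦ _)
    have hsub := hpre.subset_right_of_subset_union hLR.isOpen_left hLR.isOpen_right
      hLR.disjoint ?_ ?_
    · intro u hu τ hτ
      exact hsub ⟨(u, τ), ⟨hu, hτ⟩, rfl⟩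
    · rintro _ ⟨⟨u, τ⟩, ⟨hu, hτ⟩, rfl⟩
      exact hmem u hu τ ⟨hτ.1, by linarith [hτ.2]⟩ hτ.2.ne
    · obtain ⟨ε, hε, hεa⟩ := ((hLR.right t₀ ht₀.1 ht₀.2).and (Ioc_mem_nhdsGT ha)).exists
      refine ⟨_, ⟨(t₀, -ε), ⟨h.center_mem, by linarith [hεa.2], by linarith [hεa.1]⟩, rfl⟩, ?_⟩
      simpa [← sub_eq_add_neg] using hε

end Regular

/-! ### Products of Cauchy integrals -/

/-- `F` and `G` agree on `D ∩ Ω` up to a function that is holomorphic on `D`. -/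
def EqModHolomorphic (D Ω : Set ℂ) (F G : ℂ → ℂ) : Prop :=
  ∃ A : ℂ → ℂ, DifferentiableOn ℂ A D ∧ ∀ z ∈ D, z ∈ Ω → F z = G z + A z

namespace EqModHolomorphic
variable {D Ω : Set ℂ} {F G F' G' K : ℂ → ℂ}

theorem of_differentiableOn (hF : DifferentiableOn ℂ F D) : EqModHolomorphic D Ω F 0 :=
  ⟨F, hF, fun z _ _ => by simp⟩

theorem refl (F : ℂ → ℂ) : EqModHolomorphic D Ω F F :=
  ⟨0, differentiableOn_const 0, fun z _ _ => by simp⟩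

theorem add (h : EqModHolomorphic D Ω F G) (h' : EqModHolomorphic D Ω F' G') :
    EqModHolomorphic D Ω (F + F') (G + G') := by
  obtain ⟨A, hA, hFA⟩ := h
  obtain ⟨A', hA', hFA'⟩ := h'
  refine ⟨A + A', hA.add hA', fun z hz hz' => ?_⟩
  simp only [Pi.add_apply, hFA z hz hz', hFA' z hz hz']
  ring

theorem neg (h : EqModHolomorphic D Ω F G) : EqModHolomorphic D Ω (-F) (-G) := by
  obtain ⟨A, hA, hFA⟩ := h
  refine ⟨-A, hA.neg, fun z hz hz' => ?_⟩
  simp only [Pi.neg_apply, hFA z hz hz']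
  ring

theorem sub (h : EqModHolomorphic D Ω F G) (h' : EqModHolomorphic D Ω F' G') :
    EqModHolomorphic D Ω (F - F') (G - G') := by
  simpa only [sub_eq_add_neg] using h.add h'.neg

theorem trans (h : EqModHolomorphic D Ω F G) (h' : EqModHolomorphic D Ω G K) :
    EqModHolomorphic D Ω F K := by
  obtain ⟨A, hA, hFA⟩ := h
  obtain ⟨A', hA', hFA'⟩ := h'
  refine ⟨A + A', hA.add hA', fun z hz hz' => ?_⟩
  simp only [Pi.add_apply, hFA z hz hz', hFA' z hz hz']
  ring

theorem sum {ι : Type*} (s : Finset ι) {F G : ι → ℂ → ℂ}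
    (h : ∀ j ∈ s, EqModHolomorphic D Ω (F j) (G j)) :
    EqModHolomorphic D Ω (fun z => ∑ j ∈ s, F j z) (fun z => ∑ j ∈ s, G j z) := by
  choose! A hA hFA using h
  refine ⟨fun z => ∑ j ∈ s, A j z, DifferentiableOn.fun_sum hA, fun z hz hz' => ?_⟩
  rw [← Finset.sum_add_distrib]
  exact Finset.sum_congr rfl fun j hj => hFA j hj z hz hz'

theorem congr (h : EqModHolomorphic D Ω F G) (hF : ∀ z ∈ D, z ∈ Ω → F' z = F z)
    (hG : ∀ z ∈ D, z ∈ Ω → G' z = G z) : EqModHolomorphic D Ω F' G' := by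
  obtain ⟨A, hA, hFA⟩ := h
  exact ⟨A, hA, fun z hz hz' => by rw [hF z hz hz', hG z hz hz', hFA z hz hz']⟩

end EqModHolomorphic

section CauchyTransform
variable {c ρ : ℝ → ℂ} {a b : ℝ}

theorem cauchyTransform_congr (hab : a ≤ b) {ρ' : ℝ → ℂ} (h : ∀ u ∈ Icc a b, ρ u = ρ' u) (z : ℂ) :
    cauchyTransform c ρ a b z = cauchyTransform c ρ' a b z := by
  refine intervalIntegral.integral_congr fun u hu => ?_
  rw [uIcc_of_le hab] at hu
  simp only [h u hu]

/-- Shortening the arc of integration away from `D` changes a Cauchy integral by a function that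
is holomorphic on `D`. -/
theorem cauchyTransform_eqMod_shorten {a' b' : ℝ} (h1 : a ≤ a') (h2 : a' ≤ b') (h3 : b' ≤ b)
    (hc : ContinuousOn c (Icc a b)) (hρ : IntervalIntegrable ρ volume a b) {D Ω : Set ℂ}
    (hD : ∀ u ∈ Icc a b, u ∉ Ioo a' b' → c u ∉ D) (hΩ : ∀ u ∈ Icc a b, c u ∉ Ω) :
    EqModHolomorphic D Ω (cauchyTransform c ρ a b) (cauchyTransform c ρ a' b') := by
  have hab : a ≤ b := h1.trans (h2.trans h3)
  have ha' : a' ∈ uIcc a b := by rw [uIcc_of_le hab]; exact ⟨h1, h2.trans h3⟩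
  have hb' : b' ∈ uIcc a b := by rw [uIcc_of_le hab]; exact ⟨h1.trans h2, h3⟩
  have hs1 : Icc a a' ⊆ Icc a b := Icc_subset_Icc le_rfl (h2.trans h3)
  have hs2 : Icc b' b ⊆ Icc a b := Icc_subset_Icc (h1.trans h2) le_rfl
  have i1 : IntervalIntegrable ρ volume a a' := hρ.mono_set (uIcc_subset_uIcc_left ha')
  have i2 : IntervalIntegrable ρ volume b' b := hρ.mono_set (uIcc_subset_uIcc_right hb')
  refine ⟨fun z => cauchyTransform c ρ a a' z + cauchyTransform c ρ b' b z,
    ((differentiableOn_cauchyTransform h1 (hc.mono hs1) i1).mono ?_).add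
    ((differentiableOn_cauchyTransform h3 (hc.mono hs2) i2).mono ?_), fun z _ hz => ?_⟩
  · rintro z hz ⟨u, hu, rfl⟩
    exact hD u (hs1 hu) (fun h => absurd h.1 (not_lt.2 hu.2)) hz
  · rintro z hz ⟨u, hu, rfl⟩
    exact hD u (hs2 hu) (fun h => absurd h.2 (not_lt.2 hu.1)) hz
  · have hi := intervalIntegrable_div_sub hab hc hρ (z := z)
      (by rintro ⟨u, hu, rfl⟩; exact hΩ u hu hz)
    have e1 := intervalIntegral.integral_add_adjacent_intervals
      (hi.mono_set (uIcc_subset_uIcc_left ha')) (hi.mono_set (uIcc_subset_uIcc ha' hb'))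
    have e2 := intervalIntegral.integral_add_adjacent_intervals
      (hi.mono_set (uIcc_subset_uIcc_left hb')) (hi.mono_set (uIcc_subset_uIcc_right hb'))
    unfold cauchyTransform
    rw [← e2, ← e1]
    ring

/-- Multiplying a Cauchy integral by a holomorphic function amounts, up to a holomorphic function,
to multiplying its density. -/
theorem mul_cauchyTransform_eqMod (hab : a ≤ b) (hc : ContinuousOn c (Icc a b))
    (hρ : IntervalIntegrable ρ volume a b) {D U Ω : Set ℂ} (hU : IsOpen U) (hDU : D ⊆ U)
    {X : ℂ → ℂ} (hX : DifferentiableOn ℂ X U) (hcU : MapsTo c (Icc a b) U)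
    (hΩ : ∀ u ∈ Icc a b, c u ∉ Ω) :
    EqModHolomorphic D Ω (fun z => X z * cauchyTransform c ρ a b z)
      (cauchyTransform c (fun u => X (c u) * ρ u) a b) := by
  refine ⟨fun z => -∫ u in a..b, ρ u * dslope X (c u) z,
    ((differentiableOn_integral_dslope hab hc hρ hU hX hcU).mono hDU).neg, fun z _ hz => ?_⟩
  have hzc : z ∉ c '' Icc a b := by rintro ⟨u, hu, rfl⟩; exact hΩ u hu hz
  have hρX : IntervalIntegrable (fun u => X (c u) * ρ u) volume a b := by
    refine hρ.continuousOn_mul ?_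
    rw [uIcc_of_le hab]
    exact hX.continuousOn.comp hc hcU
  have i1 := intervalIntegrable_div_sub hab hc hρX hzc
  have i2 := (intervalIntegrable_div_sub hab hc hρ hzc).const_mul (X z)
  have e : ∫ u in a..b, ρ u * dslope X (c u) z
      = ∫ u in a..b, (X (c u) * ρ u / (c u - z) - X z * (ρ u / (c u - z))) := by
    refine intervalIntegral.integral_congr fun u hu => ?_
    rw [uIcc_of_le hab] at hu
    have hne : z ≠ c u := fun h => hzc ⟨u, hu, h.symm⟩
    have h1 : z - c u ≠ 0 := sub_ne_zero.2 hne
    have h2 : c u - z ≠ 0 := sub_ne_zero.2 hne.symm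
    simp only [dslope_of_ne _ hne, slope_def_field]
    field_simp
    ring
  simp only [cauchyTransform]
  rw [e, intervalIntegral.integral_sub i1 i2, intervalIntegral.integral_const_mul]
  ring

end CauchyTransform

/-- The product of two Cauchy integrals, summed over an index. The partial fraction decomposition
`(x - y) / ((x - z) (y - z)) = 1 / (y - z) - 1 / (x - z)` turns it into a difference of two Cauchy
integrals as soon as the contracted density is divisible by `x - y`. -/
theorem sum_cauchyTransform_mul {ι : Type*} [Fintype ι] {c P Q : ℝ → ℂ} {e f : ι → ℝ → ℂ}
    {V : ℝ → ℝ → ℂ} {p₁ q₁ p₂ q₂ : ℝ} (h1 : p₁ ≤ q₁) (h2 : p₂ ≤ q₂)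
    (hc1 : ContinuousOn c (Icc p₁ q₁)) (hc2 : ContinuousOn c (Icc p₂ q₂))
    (he : ∀ j, IntervalIntegrable (fun u => P u * e j u) volume p₁ q₁)
    (hf : ∀ j, IntervalIntegrable (fun v => Q v * f j v) volume p₂ q₂)
    (hV : ∀ u ∈ Icc p₁ q₁, ∀ v ∈ Icc p₂ q₂, ∑ j, e j u * f j v = V u v * (c u - c v))
    (hK : Integrable (fun x : ℝ × ℝ => P x.1 * Q x.2 * V x.1 x.2)
      ((volume.restrict (Ioc p₁ q₁)).prod (volume.restrict (Ioc p₂ q₂))))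
    {z : ℂ} (hz1 : z ∉ c '' Icc p₁ q₁) (hz2 : z ∉ c '' Icc p₂ q₂) :
    ∑ j, cauchyTransform c (fun u => P u * e j u) p₁ q₁ z *
        cauchyTransform c (fun v => Q v * f j v) p₂ q₂ z
      = cauchyTransform c (fun v => Q v * ∫ u in p₁..q₁, P u * V u v) p₂ q₂ z
        - cauchyTransform c (fun u => P u * ∫ v in p₂..q₂, V u v * Q v) p₁ q₁ z := by
  set μ₁ := volume.restrict (Ioc p₁ q₁)
  set μ₂ := volume.restrict (Ioc p₂ q₂)
  have hmem1 : ∀ᵐ u ∂μ₁, u ∈ Ioc p₁ q₁ := ae_restrict_mem measurableSet_Ioc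
  have hmem2 : ∀ᵐ u ∂μ₂, u ∈ Ioc p₂ q₂ := ae_restrict_mem measurableSet_Ioc
  have hinv : ∀ {p q : ℝ}, ContinuousOn c (Icc p q) → z ∉ c '' Icc p q →
      ∃ M, (∀ u ∈ Icc p q, ‖(c u - z)⁻¹‖ ≤ M) ∧
        AEStronglyMeasurable (fun u => (c u - z)⁻¹) (volume.restrict (Ioc p q)) := by
    intro p q hc hz
    have hcont : ContinuousOn (fun u => (c u - z)⁻¹) (Icc p q) :=
      (hc.sub continuousOn_const).inv₀ fun u hu h => hz ⟨u, hu, sub_eq_zero.1 h⟩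
    obtain ⟨M, hM⟩ := isCompact_Icc.exists_bound_of_continuousOn hcont
    exact ⟨M, hM, (hcont.aestronglyMeasurable measurableSet_Icc).mono_measure
      (Measure.restrict_mono Ioc_subset_Icc_self le_rfl)⟩
  obtain ⟨M₁, hM1, hm1⟩ := hinv hc1 hz1
  obtain ⟨M₂, hM2, hm2⟩ := hinv hc2 hz2
  have hmem : ∀ᵐ x : ℝ × ℝ ∂(μ₁.prod μ₂), x.1 ∈ Ioc p₁ q₁ ∧ x.2 ∈ Ioc p₂ q₂ := by
    have a1 := Measure.quasiMeasurePreserving_fst (μ := μ₁) (ν := μ₂) |>.ae hmem1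
    have a2 := Measure.quasiMeasurePreserving_snd (μ := μ₁) (ν := μ₂) |>.ae hmem2
    filter_upwards [a1, a2] with x hx1 hx2 using ⟨hx1, hx2⟩
  have hK2 : Integrable (fun x : ℝ × ℝ => (c x.2 - z)⁻¹ * (P x.1 * Q x.2 * V x.1 x.2))
      (μ₁.prod μ₂) := by
    refine hK.bdd_mul (c := M₂) hm2.comp_snd ?_
    filter_upwards [hmem] with x hx using hM2 _ (Ioc_subset_Icc_self hx.2)
  have hK1 : Integrable (fun x : ℝ × ℝ => (c x.1 - z)⁻¹ * (P x.1 * Q x.2 * V x.1 x.2))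
      (μ₁.prod μ₂) := by
    refine hK.bdd_mul (c := M₁) hm1.comp_fst ?_
    filter_upwards [hmem] with x hx using hM1 _ (Ioc_subset_Icc_self hx.1)
  have hprod : ∀ j, Integrable (fun x : ℝ × ℝ => P x.1 * e j x.1 / (c x.1 - z) *
      (Q x.2 * f j x.2 / (c x.2 - z))) (μ₁.prod μ₂) := fun j =>
    ((intervalIntegrable_iff_integrableOn_Ioc_of_le h1).1
      (intervalIntegrable_div_sub h1 hc1 (he j) hz1)).mul_prod
    ((intervalIntegrable_iff_integrableOn_Ioc_of_le h2).1
      (intervalIntegrable_div_sub h2 hc2 (hf j) hz2))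
  unfold cauchyTransform
  simp only [intervalIntegral.integral_of_le h1, intervalIntegral.integral_of_le h2]
  calc _ = ∫ x : ℝ × ℝ, ∑ j, P x.1 * e j x.1 / (c x.1 - z) *
        (Q x.2 * f j x.2 / (c x.2 - z)) ∂(μ₁.prod μ₂) := by
        rw [integral_finsetSum _ fun j _ => hprod j]
        refine Finset.sum_congr rfl fun j _ => ?_
        rw [← integral_prod_mul]
    _ = ∫ x : ℝ × ℝ, ((c x.2 - z)⁻¹ * (P x.1 * Q x.2 * V x.1 x.2)
        - (c x.1 - z)⁻¹ * (P x.1 * Q x.2 * V x.1 x.2)) ∂(μ₁.prod μ₂) := by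
        refine integral_congr_ae ?_
        filter_upwards [hmem] with x hx
        have hx1 := Ioc_subset_Icc_self hx.1
        have hx2 := Ioc_subset_Icc_self hx.2
        have n1 : c x.1 - z ≠ 0 := fun h => hz1 ⟨_, hx1, sub_eq_zero.1 h⟩
        have n2 : c x.2 - z ≠ 0 := fun h => hz2 ⟨_, hx2, sub_eq_zero.1 h⟩
        have e1 : ∑ j, P x.1 * e j x.1 / (c x.1 - z) * (Q x.2 * f j x.2 / (c x.2 - z))
            = P x.1 * Q x.2 / ((c x.1 - z) * (c x.2 - z)) * ∑ j, e j x.1 * f j x.2 := by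
          rw [Finset.mul_sum]
          refine Finset.sum_congr rfl fun j _ => ?_
          field_simp
        rw [e1, hV _ hx1 _ hx2]
        field_simp
        ring
    _ = _ := by
        rw [integral_sub hK2 hK1, integral_prod_symm _ hK2, integral_prod _ hK1]
        congr 1
        · refine integral_congr_ae (ae_of_all _ fun v => ?_)
          have e2 : ∫ u, P u * Q v * V u v ∂μ₁ = Q v * ∫ u, P u * V u v ∂μ₁ := by
            rw [← integral_const_mul]
            congr 1; ext u; ring
          simp only
          rw [integral_const_mul, e2, div_eq_inv_mul]
        · refine integral_congr_ae (ae_of_all _ fun u => ?_)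
          have e2 : ∫ v, P u * Q v * V u v ∂μ₂ = P u * ∫ v, V u v * Q v ∂μ₂ := by
            rw [← integral_const_mul]
            congr 1; ext v; ring
          simp only
          rw [integral_const_mul, e2, div_eq_inv_mul]

theorem norm_div_chord_le {x y : ℂ} {C κ r : ℝ} (hC : 0 ≤ C) (hκ : 0 < κ) (hr : 0 ≤ r)
    (hx : ‖x‖ ≤ C * r) (hy : κ * r ≤ ‖y‖) : ‖x / y‖ ≤ C / κ := by
  rcases hr.eq_or_lt with rfl | hr
  · rw [mul_zero] at hx
    rw [norm_le_zero_iff.1 hx, zero_div, norm_zero]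
    positivity
  · rw [norm_div, div_le_div_iff₀ (lt_of_lt_of_le (by positivity) hy) hκ]
    nlinarith

/-- A kernel whose numerator vanishes to first order on the diagonal is bounded, hence integrable,
on the square of an embedded arc. -/
theorem integrableOn_chord_quotient {γ : ℝ → ℂ} {a b : ℝ} {E : ℝ → ℝ → ℂ} {P Q : ℝ → ℂ}
    {C κ : ℝ} (hC : 0 ≤ C) (hκ : 0 < κ) (hγ : ContinuousOn γ (Icc a b))
    (hchord : ∀ u ∈ Icc a b, ∀ v ∈ Icc a b, κ * |u - v| ≤ ‖γ u - γ v‖)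
    (hE : ContinuousOn (fun x : ℝ × ℝ => E x.1 x.2) (Icc a b ×ˢ Icc a b))
    (hEC : ∀ u ∈ Icc a b, ∀ v ∈ Icc a b, ‖E u v‖ ≤ C * |u - v|)
    (hP : ContinuousOn P (Icc a b)) (hQ : ContinuousOn Q (Icc a b)) :
    IntegrableOn (fun x : ℝ × ℝ => P x.1 * Q x.2 * (E x.1 x.2 / (γ x.1 - γ x.2)))
      (Icc a b ×ˢ Icc a b) (volume.prod volume) := by
  have hms : MeasurableSet (Icc a b ×ˢ Icc a b) := measurableSet_Icc.prod measurableSet_Icc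
  have hPQ : ContinuousOn (fun x : ℝ × ℝ => P x.1 * Q x.2) (Icc a b ×ˢ Icc a b) :=
    (hP.comp continuousOn_fst fun x hx => hx.1).mul (hQ.comp continuousOn_snd fun x hx => hx.2)
  have hch : ContinuousOn (fun x : ℝ × ℝ => γ x.1 - γ x.2) (Icc a b ×ˢ Icc a b) :=
    (hγ.comp continuousOn_fst fun x hx => hx.1).sub (hγ.comp continuousOn_snd fun x hx => hx.2)
  have hint := hPQ.integrableOn_compact (μ := volume.prod volume) (isCompact_Icc.prod isCompact_Icc)
  refine hint.mul_bdd (c := C / κ) ?_ ?_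
  · exact ((hE.aestronglyMeasurable hms).aemeasurable.div
      (hch.aestronglyMeasurable hms).aemeasurable).aestronglyMeasurable
  · filter_upwards [ae_restrict_mem hms] with x hx
    exact norm_div_chord_le hC hκ (abs_nonneg _) (hEC _ hx.1 _ hx.2) (hchord _ hx.1 _ hx.2)

/-- The cancellation behind `χ Ψ = 1` near a regular point of the curve. One factor is
holomorphic up to the Cauchy integral of `-p e_j` over an arc, the other one up to the Cauchy
integral of `q f_j` over a shorter arc. If `p` and `q` solve the integral equations of the
integrable kernel `(e(u), f(v)) / (γ(u) - γ(v))`, the singular parts of the product cancel. -/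
theorem sum_mul_eqMod_zero {ι : Type*} [Fintype ι] {γ : ℝ → ℂ} {t₀ a a₂ a₃ : ℝ} {d : ℂ}
    (h : IsBox γ t₀ a d) (ha3 : 0 < a₃) (ha32 : a₃ ≤ a₂) (ha2 : a₂ ≤ a) {D U₂ U₃ Ω : Set ℂ}
    (hD : ∀ u ∈ Icc (t₀ - a) (t₀ + a), u ∉ Ioo (t₀ - a₃) (t₀ + a₃) → γ u ∉ D)
    (hΩ : ∀ u ∈ Icc (t₀ - a) (t₀ + a), γ u ∉ Ω)
    (hU₂ : IsOpen U₂) (hDU₂ : D ⊆ U₂) (hγU₂ : MapsTo γ (Icc (t₀ - a₂) (t₀ + a₂)) U₂)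
    (hU₃ : IsOpen U₃) (hDU₃ : D ⊆ U₃) (hγU₃ : MapsTo γ (Icc (t₀ - a₃) (t₀ + a₃)) U₃)
    {X Y : ι → ℂ → ℂ} (hXd : ∀ j, DifferentiableOn ℂ (X j) U₂)
    (hYd : ∀ j, DifferentiableOn ℂ (Y j) U₃)
    {e f : ι → ℝ → ℂ} {p q : ℝ → ℂ} (he : ∀ j, ContinuousOn (e j) (Icc (t₀ - a) (t₀ + a)))
    (hf : ∀ j, ContinuousOn (f j) (Icc (t₀ - a) (t₀ + a)))
    (hp : ContinuousOn p (Icc (t₀ - a) (t₀ + a))) (hq : ContinuousOn q (Icc (t₀ - a) (t₀ + a)))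
    {C : ℝ} (hC : 0 ≤ C) (hef : ∀ u ∈ Icc (t₀ - a) (t₀ + a), ∀ v ∈ Icc (t₀ - a) (t₀ + a),
      ‖∑ j, e j u * f j v‖ ≤ C * |u - v|)
    (hX : ∀ v ∈ Icc (t₀ - a₂) (t₀ + a₂), p v = ∑ j, X j (γ v) * f j v
      - ∫ u in (t₀ - a)..(t₀ + a), p u * deriv γ u * ((∑ j, e j u * f j v) / (γ u - γ v)))
    (hY : ∀ u ∈ Icc (t₀ - a₃) (t₀ + a₃), q u = ∑ j, Y j (γ u) * e j u
      - ∫ v in (t₀ - a₂)..(t₀ + a₂), (∑ j, e j u * f j v) / (γ u - γ v) * (q v * deriv γ v)) :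
    EqModHolomorphic D Ω (fun z => ∑ j,
      (X j z - cauchyTransform γ (fun u => p u * deriv γ u * e j u) (t₀ - a) (t₀ + a) z) *
      (Y j z + cauchyTransform γ (fun v => q v * deriv γ v * f j v) (t₀ - a₂) (t₀ + a₂) z)) 0 := by
  have hd := norm_pos_iff.2 h.ne_zero
  have ha := h.pos
  have hle1 : t₀ - a ≤ t₀ + a := by linarith
  have hle2 : t₀ - a₂ ≤ t₀ + a₂ := by linarith
  have hle3 : t₀ - a₃ ≤ t₀ + a₃ := by linarith
  have hs2 : Icc (t₀ - a₂) (t₀ + a₂) ⊆ Icc (t₀ - a) (t₀ + a) :=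
    Icc_subset_Icc (by linarith) (by linarith)
  have hs32 : Icc (t₀ - a₃) (t₀ + a₃) ⊆ Icc (t₀ - a₂) (t₀ + a₂) :=
    Icc_subset_Icc (by linarith) (by linarith)
  have hs3 := hs32.trans hs2
  have hκ : 0 < 3 / 4 * ‖d‖ := by positivity
  set w := deriv γ with hw
  have hint : ∀ {p q : ℝ} {g : ℝ → ℂ}, p ≤ q → Icc p q ⊆ Icc (t₀ - a) (t₀ + a) →
      ContinuousOn g (Icc (t₀ - a) (t₀ + a)) → IntervalIntegrable g volume p q := by
    intro p q g hpq hs hg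
    refine ContinuousOn.intervalIntegrable ?_
    rw [uIcc_of_le hpq]
    exact hg.mono hs
  have hP : ContinuousOn (fun u => p u * w u) (Icc (t₀ - a) (t₀ + a)) :=
    hp.mul h.continuousOn_deriv
  have hQ : ContinuousOn (fun u => q u * w u) (Icc (t₀ - a) (t₀ + a)) :=
    hq.mul h.continuousOn_deriv
  have hPe : ∀ j, ContinuousOn (fun u => p u * w u * e j u) (Icc (t₀ - a) (t₀ + a)) :=
    fun j => hP.mul (he j)
  have hQf : ∀ j, ContinuousOn (fun u => q u * w u * f j u) (Icc (t₀ - a) (t₀ + a)) :=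
    fun j => hQ.mul (hf j)
  have hEc : ContinuousOn (fun x : ℝ × ℝ => ∑ j, e j x.1 * f j x.2)
      (Icc (t₀ - a) (t₀ + a) ×ˢ Icc (t₀ - a) (t₀ + a)) :=
    continuousOn_finsetSum _ fun j _ => ((he j).comp continuousOn_fst fun x hx => hx.1).mul
      ((hf j).comp continuousOn_snd fun x hx => hx.2)
  set V : ℝ → ℝ → ℂ := fun u v => (∑ j, e j u * f j v) / (γ u - γ v) with hVdef
  have hK : Integrable (fun x : ℝ × ℝ => (p x.1 * w x.1) * (q x.2 * w x.2) * V x.1 x.2)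
      ((volume.restrict (Ioc (t₀ - a) (t₀ + a))).prod
        (volume.restrict (Ioc (t₀ - a₂) (t₀ + a₂)))) := by
    rw [Measure.prod_restrict]
    exact (integrableOn_chord_quotient hC hκ h.continuousOn
      (fun u hu v hv => h.le_norm_sub hu hv) hEc hef hP hQ).mono_set
      (prod_mono Ioc_subset_Icc_self (Ioc_subset_Icc_self.trans hs2))
  have hVmul : ∀ u ∈ Icc (t₀ - a) (t₀ + a), ∀ v ∈ Icc (t₀ - a₂) (t₀ + a₂),
      ∑ j, e j u * f j v = V u v * (γ u - γ v) := by
    intro u hu v hv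
    rcases eq_or_ne u v with rfl | huv
    · have := hef u hu u hu
      rw [sub_self, abs_zero, mul_zero] at this
      rw [norm_le_zero_iff.1 this, sub_self, mul_zero]
    · have h1 := h.le_norm_sub hu (hs2 hv)
      have h2 : 0 < |u - v| := abs_pos.2 (sub_ne_zero.2 huv)
      have h3 : γ u - γ v ≠ 0 := norm_pos_iff.1 (lt_of_lt_of_le (by positivity) h1)
      rw [hVdef]
      field_simp
  -- the densities produced by the double integral
  set ρA : ℝ → ℂ := fun v => q v * w v * ∫ u in (t₀ - a)..(t₀ + a), p u * w u * V u v with hρA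
  set ρB : ℝ → ℂ := fun u => p u * w u * ∫ v in (t₀ - a₂)..(t₀ + a₂), V u v * (q v * w v) with hρB
  have hρBi : IntervalIntegrable ρB volume (t₀ - a) (t₀ + a) := by
    rw [intervalIntegrable_iff_integrableOn_Ioc_of_le hle1]
    refine hK.integral_prod_left.congr (ae_of_all _ fun u => ?_)
    simp only [hρB]
    rw [intervalIntegral.integral_of_le hle2, ← integral_const_mul]
    congr 1; ext v; ring
  have hρAi : IntervalIntegrable ρA volume (t₀ - a₂) (t₀ + a₂) := by
    rw [intervalIntegrable_iff_integrableOn_Ioc_of_le hle2]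
    refine hK.integral_prod_right.congr (ae_of_all _ fun u => ?_)
    simp only [hρA]
    rw [intervalIntegral.integral_of_le hle1, ← integral_const_mul]
    congr 1; ext v; ring
  have hXc : ∀ j, ContinuousOn (fun u => X j (γ u)) (Icc (t₀ - a₂) (t₀ + a₂)) :=
    fun j => (hXd j).continuousOn.comp (h.continuousOn.mono hs2) hγU₂
  have hYc : ∀ j, ContinuousOn (fun u => Y j (γ u)) (Icc (t₀ - a₃) (t₀ + a₃)) :=
    fun j => (hYd j).continuousOn.comp (h.continuousOn.mono hs3) hγU₃
  have hXi : ∀ j, IntervalIntegrable (fun u => X j (γ u) * (q u * w u * f j u)) volume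
      (t₀ - a₂) (t₀ + a₂) := fun j => by
    refine ContinuousOn.intervalIntegrable ?_
    rw [uIcc_of_le hle2]
    exact (hXc j).mul ((hQf j).mono hs2)
  have hYi : ∀ j, IntervalIntegrable (fun u => Y j (γ u) * (p u * w u * e j u)) volume
      (t₀ - a₃) (t₀ + a₃) := fun j => by
    refine ContinuousOn.intervalIntegrable ?_
    rw [uIcc_of_le hle3]
    exact (hYc j).mul ((hPe j).mono hs3)
  have hD' : ∀ u ∈ Icc (t₀ - a₂) (t₀ + a₂), u ∉ Ioo (t₀ - a₃) (t₀ + a₃) → γ u ∉ D :=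
    fun u hu => hD u (hs2 hu)
  have hΩ' : ∀ u ∈ Icc (t₀ - a₂) (t₀ + a₂), γ u ∉ Ω := fun u hu => hΩ u (hs2 hu)
  have hΩ3 : ∀ u ∈ Icc (t₀ - a₃) (t₀ + a₃), γ u ∉ Ω := fun u hu => hΩ u (hs3 hu)
  have hρBi3 : IntervalIntegrable ρB volume (t₀ - a₃) (t₀ + a₃) := hρBi.mono_set (by
    rw [uIcc_of_le hle1, uIcc_of_le hle3]; exact hs3)
  have hpqi : IntervalIntegrable (fun u => p u * q u * w u) volume (t₀ - a₂) (t₀ + a₂) :=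
    hint hle2 hs2 ((hp.mul hq).mul h.continuousOn_deriv)
  -- the four parts of the product
  have T1 : EqModHolomorphic D Ω (fun z => ∑ j, X j z * Y j z) 0 :=
    .of_differentiableOn (DifferentiableOn.fun_sum fun j _ =>
      ((hXd j).mono hDU₂).mul ((hYd j).mono hDU₃))
  have T2 : EqModHolomorphic D Ω
      (fun z => ∑ j, Y j z * cauchyTransform γ (fun u => p u * w u * e j u) (t₀ - a) (t₀ + a) z)
      (fun z => ∑ j, cauchyTransform γ (fun u => Y j (γ u) * (p u * w u * e j u))
        (t₀ - a₃) (t₀ + a₃) z) := by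
    refine .sum _ fun j _ => ?_
    refine EqModHolomorphic.trans (G := fun z => Y j z *
      cauchyTransform γ (fun u => p u * w u * e j u) (t₀ - a₃) (t₀ + a₃) z) ?_
      (mul_cauchyTransform_eqMod hle3 (h.continuousOn.mono hs3) (hint hle3 hs3 (hPe j)) hU₃ hDU₃
        (hYd j) hγU₃ hΩ3)
    obtain ⟨A, hA, hA'⟩ := cauchyTransform_eqMod_shorten (by linarith) hle3 (by linarith)
      h.continuousOn (hint hle1 Subset.rfl (hPe j)) hD hΩ
    refine ⟨fun z => Y j z * A z, ((hYd j).mono hDU₃).mul hA, fun z hz hz' => ?_⟩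
    simp only [hA' z hz hz']
    ring
  have T3 : EqModHolomorphic D Ω
      (fun z => ∑ j, X j z * cauchyTransform γ (fun u => q u * w u * f j u) (t₀ - a₂) (t₀ + a₂) z)
      (fun z => ∑ j, cauchyTransform γ (fun u => X j (γ u) * (q u * w u * f j u))
        (t₀ - a₂) (t₀ + a₂) z) :=
    .sum _ fun j _ => mul_cauchyTransform_eqMod hle2 (h.continuousOn.mono hs2)
      (hint hle2 hs2 (hQf j)) hU₂ hDU₂ (hXd j) hγU₂ hΩ'
  have T4 : EqModHolomorphic D Ω (cauchyTransform γ ρB (t₀ - a) (t₀ + a))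
      (cauchyTransform γ ρB (t₀ - a₃) (t₀ + a₃)) :=
    cauchyTransform_eqMod_shorten (by linarith) hle3 (by linarith) h.continuousOn hρBi hD hΩ
  have T5 : EqModHolomorphic D Ω (cauchyTransform γ (fun u => p u * q u * w u) (t₀ - a₂) (t₀ + a₂))
      (cauchyTransform γ (fun u => p u * q u * w u) (t₀ - a₃) (t₀ + a₃)) :=
    cauchyTransform_eqMod_shorten (by linarith) hle3 (by linarith) (h.continuousOn.mono hs2) hpqi
      hD' hΩ'
  have hsum_cT : ∀ {α β : ℝ} {ρ : ι → ℝ → ℂ} {z : ℂ}, α ≤ β → Icc α β ⊆ Icc (t₀ - a) (t₀ + a) →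
      (∀ j, IntervalIntegrable (ρ j) volume α β) → z ∈ Ω →
      ∑ j, cauchyTransform γ (ρ j) α β z = cauchyTransform γ (fun u => ∑ j, ρ j u) α β z := by
    intro α β ρ z hαβ hs hρ hz
    unfold cauchyTransform
    rw [← intervalIntegral.integral_finsetSum fun j _ => intervalIntegrable_div_sub hαβ
      (h.continuousOn.mono hs) (hρ j) (by rintro ⟨u, hu, rfl⟩; exact hΩ u (hs hu) hz)]
    simp only [Finset.sum_div]
  have hsub_cT : ∀ {α β : ℝ} {ρ ρ' : ℝ → ℂ} {z : ℂ}, α ≤ β → Icc α β ⊆ Icc (t₀ - a) (t₀ + a) →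
      IntervalIntegrable ρ volume α β → IntervalIntegrable ρ' volume α β → z ∈ Ω →
      cauchyTransform γ ρ α β z - cauchyTransform γ ρ' α β z
        = cauchyTransform γ (fun u => ρ u - ρ' u) α β z := by
    intro α β ρ ρ' z hαβ hs hρ hρ' hz
    have hz' : z ∉ γ '' Icc α β := by rintro ⟨u, hu, rfl⟩; exact hΩ u (hs hu) hz
    unfold cauchyTransform
    rw [← intervalIntegral.integral_sub
      (intervalIntegrable_div_sub hαβ (h.continuousOn.mono hs) hρ hz')
      (intervalIntegrable_div_sub hαβ (h.continuousOn.mono hs) hρ' hz')]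
    simp only [sub_div]
  have hsum_int : ∀ {α β : ℝ} {ρ : ι → ℝ → ℂ}, (∀ j, IntervalIntegrable (ρ j) volume α β) →
      IntervalIntegrable (fun u => ∑ j, ρ j u) volume α β := by
    intro α β ρ hρ
    have := IntervalIntegrable.sum Finset.univ fun j _ => hρ j
    rwa [show (∑ j, ρ j) = fun u => ∑ j, ρ j u by ext u; simp] at this
  -- the two integral equations identify the remaining densities
  have hA : ∀ z ∈ Ω, (∑ j, cauchyTransform γ (fun u => X j (γ u) * (q u * w u * f j u))
      (t₀ - a₂) (t₀ + a₂) z) - cauchyTransform γ ρA (t₀ - a₂) (t₀ + a₂) z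
      = cauchyTransform γ (fun u => p u * q u * w u) (t₀ - a₂) (t₀ + a₂) z := by
    intro z hz
    rw [hsum_cT hle2 hs2 hXi hz, hsub_cT hle2 hs2 (hsum_int hXi) hρAi hz]
    refine cauchyTransform_congr hle2 (fun v hv => ?_) z
    have e1 : ∑ j, X j (γ v) * (q v * w v * f j v) = q v * w v * ∑ j, X j (γ v) * f j v := by
      rw [Finset.mul_sum]; exact Finset.sum_congr rfl fun j _ => by ring
    rw [e1, hρA]
    have := hX v hv
    linear_combination (-(q v * w v)) * this
  have hB : ∀ z ∈ Ω, (∑ j, cauchyTransform γ (fun u => Y j (γ u) * (p u * w u * e j u))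
      (t₀ - a₃) (t₀ + a₃) z) - cauchyTransform γ ρB (t₀ - a₃) (t₀ + a₃) z
      = cauchyTransform γ (fun u => p u * q u * w u) (t₀ - a₃) (t₀ + a₃) z := by
    intro z hz
    rw [hsum_cT hle3 hs3 hYi hz, hsub_cT hle3 hs3 (hsum_int hYi) hρBi3 hz]
    refine cauchyTransform_congr hle3 (fun v hv => ?_) z
    have e1 : ∑ j, Y j (γ v) * (p v * w v * e j v) = p v * w v * ∑ j, Y j (γ v) * e j v := by
      rw [Finset.mul_sum]; exact Finset.sum_congr rfl fun j _ => by ring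
    rw [e1, hρB]
    have := hY v hv
    linear_combination (-(p v * w v)) * this
  have key := (((T1.sub T2).add (T3.add T4)).sub
    (.refl (cauchyTransform γ ρA (t₀ - a₂) (t₀ + a₂))))
  refine (key.congr (G' := cauchyTransform γ (fun u => p u * q u * w u) (t₀ - a₂) (t₀ + a₂) -
    cauchyTransform γ (fun u => p u * q u * w u) (t₀ - a₃) (t₀ + a₃)) (fun z _ hz => ?_)
    (fun z _ hz => ?_)).trans ((T5.sub (.refl _)).congr (fun _ _ _ => rfl) fun z _ _ => by simp)
  · have hprod := sum_cauchyTransform_mul (V := V) hle1 hle2 h.continuousOn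
      (h.continuousOn.mono hs2) (fun j => hint hle1 Subset.rfl (hPe j))
      (fun j => hint hle2 hs2 (hQf j)) hVmul hK (z := z)
      (by rintro ⟨u, hu, rfl⟩; exact hΩ u hu hz) (by rintro ⟨u, hu, rfl⟩; exact hΩ' u hu hz)
    simp only [Pi.add_apply, Pi.sub_apply, sub_mul, mul_add, Finset.sum_sub_distrib,
      Finset.sum_add_distrib]
    rw [hprod]
    have e2 : ∑ j, cauchyTransform γ (fun u => p u * w u * e j u) (t₀ - a) (t₀ + a) z * Y j z
        = ∑ j, Y j z * cauchyTransform γ (fun u => p u * w u * e j u) (t₀ - a) (t₀ + a) z :=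
      Finset.sum_congr rfl fun j _ => mul_comm _ _
    rw [e2]
    ring
  · simp only [Pi.add_apply, Pi.sub_apply, Pi.zero_apply]
    linear_combination hB z hz - hA z hz

/-- The box is embedded: its points off the arc are not on the arc. -/
theorem IsBox.ne_sub {γ : ℝ → ℂ} {t₀ a : ℝ} {d : ℂ} (h : IsBox γ t₀ a d) {u v : ℝ}
    (hu : u ∈ Icc (t₀ - a) (t₀ + a)) (hv : v ∈ Icc (t₀ - a) (t₀ + a)) {τ : ℝ} (hτ : τ ≠ 0) :
    γ u ≠ γ v + τ * (Complex.I * d) := by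
  intro h0
  have h1 := h.le_norm_sub_sub hu hv τ
  rw [h0, sub_self, norm_zero] at h1
  have hd := norm_pos_iff.2 h.ne_zero
  have h2 : |u - v| = 0 := by
    by_contra h3
    have : 0 < |u - v| := lt_of_le_of_ne (abs_nonneg _) (Ne.symm h3)
    have : 0 < 3 / 4 * ‖d‖ * |u - v| := by positivity
    linarith
  rw [sub_eq_zero.1 (abs_eq_zero.1 h2), left_eq_add, mul_eq_zero, Complex.ofReal_eq_zero] at h0
  exact h0.elim hτ (mul_ne_zero Complex.I_ne_zero h.ne_zero)

/-- Contracting the representation `X_j - ∫ P e_j / (γ - z)` with a vector that is orthogonal to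
`e` at the point `γ(v)` removes the singularity of the integrand, so that the boundary value can
be computed under the integral sign. -/
theorem IsBox.sum_boundary_value {ι : Type*} [Fintype ι] {γ : ℝ → ℂ} {t₀ a : ℝ} {d : ℂ}
    (h : IsBox γ t₀ a d) {v : ℝ} (hv : v ∈ Icc (t₀ - a) (t₀ + a)) {P : ℝ → ℂ} {e : ι → ℝ → ℂ}
    (hP : ContinuousOn P (Icc (t₀ - a) (t₀ + a)))
    (he : ∀ j, ContinuousOn (e j) (Icc (t₀ - a) (t₀ + a))) {f φ : ι → ℂ} {C : ℝ} (hC : 0 ≤ C)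
    (hef : ∀ u ∈ Icc (t₀ - a) (t₀ + a), ‖∑ j, e j u * f j‖ ≤ C * |u - v|) {X : ι → ℂ → ℂ}
    (hX : ∀ j, ContinuousAt (X j) (γ v))
    (hlim : ∀ j, Tendsto (fun τ : ℝ => X j (γ v + τ * (Complex.I * d)) -
      cauchyTransform γ (fun u => P u * e j u) (t₀ - a) (t₀ + a) (γ v + τ * (Complex.I * d)))
      (𝓝[>] 0) (𝓝 (φ j))) :
    ∑ j, φ j * f j = ∑ j, X j (γ v) * f j
      - ∫ u in (t₀ - a)..(t₀ + a), P u * ((∑ j, e j u * f j) / (γ u - γ v)) := by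
  have ha := h.pos
  have hd := norm_pos_iff.2 h.ne_zero
  have hle : t₀ - a ≤ t₀ + a := by linarith
  obtain ⟨M, hM⟩ := isCompact_Icc.exists_bound_of_continuousOn hP
  have hz : Tendsto (fun τ : ℝ => γ v + τ * (Complex.I * d)) (𝓝[>] 0) (𝓝 (γ v)) := by
    have : Continuous (fun τ : ℝ => γ v + τ * (Complex.I * d)) := by fun_prop
    have h2 := this.tendsto 0
    simp only [Complex.ofReal_zero, zero_mul, add_zero] at h2
    exact h2.mono_left nhdsWithin_le_nhds
  have hE : ContinuousOn (fun u => ∑ j, e j u * f j) (Icc (t₀ - a) (t₀ + a)) :=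
    continuousOn_finsetSum _ fun j _ => (he j).mul continuousOn_const
  have hL := tendsto_finsetSum Finset.univ fun j (_ : j ∈ Finset.univ) => (hlim j).mul_const (f j)
  have hpos : ∀ᶠ τ : ℝ in 𝓝[>] 0, τ ≠ 0 := by
    filter_upwards [self_mem_nhdsWithin] with τ hτ using (ne_of_gt hτ)
  have hR : Tendsto (fun τ : ℝ => ∑ j, X j (γ v + τ * (Complex.I * d)) * f j
      - ∫ u in (t₀ - a)..(t₀ + a),
        P u * ((∑ j, e j u * f j) / (γ u - (γ v + τ * (Complex.I * d))))) (𝓝[>] 0)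
      (𝓝 (∑ j, X j (γ v) * f j
      - ∫ u in (t₀ - a)..(t₀ + a), P u * ((∑ j, e j u * f j) / (γ u - γ v)))) := by
    refine Tendsto.sub (tendsto_finsetSum _ fun j _ => ((hX j).tendsto.comp hz).mul_const _) ?_
    refine intervalIntegral.tendsto_integral_filter_of_dominated_convergence
      (fun _ => M * (C / (3 / 4 * ‖d‖))) ?_ ?_ (by simp) ?_
    · filter_upwards [hpos] with τ hτ
      rw [uIoc_of_le hle]
      refine (ContinuousOn.aestronglyMeasurable (s := Icc (t₀ - a) (t₀ + a)) ?_
        measurableSet_Icc).mono_measure (Measure.restrict_mono Ioc_subset_Icc_self le_rfl)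
      exact hP.mul (hE.div (h.continuousOn.sub continuousOn_const)
        fun u hu => sub_ne_zero.2 (h.ne_sub hu hv hτ))
    · refine Eventually.of_forall fun τ => ae_of_all _ fun u hu => ?_
      rw [uIoc_of_le hle] at hu
      have hu := Ioc_subset_Icc_self hu
      rw [norm_mul]
      exact mul_le_mul (hM u hu) (norm_div_chord_le hC (by positivity) (abs_nonneg _) (hef u hu)
        (h.le_norm_sub_sub hu hv τ)) (norm_nonneg _) ((norm_nonneg _).trans (hM u hu))
    · have hne : ∀ᵐ u : ℝ, u ≠ v := by simp [ae_iff]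
      filter_upwards [hne] with u huv hu
      rw [uIoc_of_le hle] at hu
      have h1 := h.le_norm_sub (Ioc_subset_Icc_self hu) hv
      have h2 : 0 < |u - v| := abs_pos.2 (sub_ne_zero.2 huv)
      exact tendsto_const_nhds.mul (tendsto_const_nhds.div (tendsto_const_nhds.sub hz)
        (norm_pos_iff.1 (lt_of_lt_of_le (by positivity) h1)))
  refine tendsto_nhds_unique (hL.congr' ?_) hR
  filter_upwards [hpos] with τ hτ
  have hz' : γ v + τ * (Complex.I * d) ∉ γ '' Icc (t₀ - a) (t₀ + a) := by
    rintro ⟨u, hu, h0⟩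
    exact h.ne_sub hu hv hτ h0
  simp only [sub_mul, Finset.sum_sub_distrib]
  congr 1
  have hi : ∀ j, IntervalIntegrable (fun u => P u * e j u) volume (t₀ - a) (t₀ + a) := fun j => by
    refine ContinuousOn.intervalIntegrable ?_
    rw [uIcc_of_le hle]; exact hP.mul (he j)
  unfold cauchyTransform
  simp only [← intervalIntegral.integral_mul_const]
  rw [← intervalIntegral.integral_finsetSum fun j _ =>
    (intervalIntegrable_div_sub hle h.continuousOn (hi j) hz').mul_const (f j)]
  congr 1; ext u
  rw [Finset.sum_div, Finset.mul_sum]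
  exact Finset.sum_congr rfl fun j _ => by ring

/-! ### The product near a regular point of the curve -/

/-- The candidate `1 + ∫ E_R(s) F_L(s)ᵀ / (s - z) ds` for the inverse of the solution of the
Riemann--Hilbert problem. -/
def cauchyInverse {N : ℕ} (γ : ℝ → ℂ) (ER FL : ℂ → Fin N → ℂ) (z : ℂ) :
    Matrix (Fin N) (Fin N) ℂ :=
  Matrix.of fun j k => (1 : Matrix (Fin N) (Fin N) ℂ) j k +
    cauchyTransform γ (fun u => FL (γ u) k * deriv γ u * ER (γ u) j) 0 1 z

section Solution
variable {N : ℕ} {γ : ℝ → ℂ} {B : Finset ℝ} {EL ER FL : ℂ → Fin N → ℂ}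
  {χ : ℂ → Matrix (Fin N) (Fin N) ℂ} {t₀ : ℝ}

theorem IsPiecewiseSmoothCurve.isClosed_support (hγ : IsPiecewiseSmoothCurve γ B) :
    IsClosed (support γ) :=
  (isCompact_Icc.image_of_continuousOn hγ.smooth.1).isClosed

theorem IsPiecewiseSmoothCurve.intervalIntegrable_deriv (hγ : IsPiecewiseSmoothCurve γ B) :
    IntervalIntegrable (deriv γ) volume 0 1 :=
  hγ.smooth.intervalIntegrable_deriv (by exact_mod_cast le_top)

theorem IsPiecewiseSmoothCurve.mem_openArc (hγ : IsPiecewiseSmoothCurve γ B) {t : ℝ}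
    (ht : t ∈ Ioo (0 : ℝ) 1) : γ t ∈ openArc γ := by
  have ht' := Ioo_subset_Icc_self ht
  refine ⟨⟨t, ht', rfl⟩, fun h => ?_⟩
  rcases h.2 with h | h
  · rcases hγ.simple t ht' 0 (left_mem_Icc.2 zero_le_one) h with h | ⟨h, -⟩ | ⟨h, -⟩
    · exact ht.1.ne' h
    · exact ht.1.ne' h
    · exact ht.2.ne h
  · rcases hγ.simple t ht' 1 (right_mem_Icc.2 zero_le_one) h with h | ⟨h, -⟩ | ⟨h, -⟩
    · exact ht.2.ne h
    · exact ht.1.ne' h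
    · exact ht.2.ne h

theorem intervalIntegrable_density (hγ : IsPiecewiseSmoothCurve γ B) {p q : ℝ → ℂ}
    (hp : ContinuousOn p (Icc 0 1)) (hq : ContinuousOn q (Icc 0 1)) :
    IntervalIntegrable (fun u => p u * deriv γ u * q u) volume 0 1 := by
  rw [← uIcc_of_le zero_le_one] at hp hq
  exact (hγ.intervalIntegrable_deriv.continuousOn_mul hp).mul_continuousOn hq

/-- The integral equation for `F_L`, with the part of the integral over the far arcs moved into
the values on the curve of the Cauchy integrals over these arcs. -/
theorem IsLeftSolution.local_equation (hγ : IsPiecewiseSmoothCurve γ B)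
    (hER : ContinuousOn (fun t => ER (γ t)) (Icc 0 1)) (hFL : IsLeftSolution γ EL ER FL)
    {α β : ℝ} (hα : 0 ≤ α) (hαβ : α ≤ β) (hβ : β ≤ 1) {u : ℝ} (hu : u ∈ Icc (0 : ℝ) 1)
    (h1 : ∀ v ∈ Icc 0 α, γ u ≠ γ v) (h2 : ∀ v ∈ Icc β 1, γ u ≠ γ v) {k : Fin N}
    (hint : IntervalIntegrable (fun v => (∑ j, EL (γ u) j * ER (γ v) j) / (γ u - γ v) *
      (FL (γ v) k * deriv γ v)) volume α β) :
    FL (γ u) k = ∑ j, ((1 : Matrix (Fin N) (Fin N) ℂ) j k +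
        cauchyTransform γ (fun v => FL (γ v) k * deriv γ v * ER (γ v) j) 0 α (γ u) +
        cauchyTransform γ (fun v => FL (γ v) k * deriv γ v * ER (γ v) j) β 1 (γ u)) * EL (γ u) j
      - ∫ v in α..β, (∑ j, EL (γ u) j * ER (γ v) j) / (γ u - γ v) * (FL (γ v) k * deriv γ v) := by
  have hmaps : MapsTo γ (Icc 0 1) (support γ) := fun u hu => ⟨u, hu, rfl⟩
  have hFLc : ContinuousOn (fun v => FL (γ v) k) (Icc 0 1) :=
    (continuous_apply k).comp_continuousOn (hFL.continuousOn.comp hγ.smooth.1 hmaps)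
  have hERc : ∀ j, ContinuousOn (fun v => ER (γ v) j) (Icc 0 1) := fun j =>
    (continuous_apply j).comp_continuousOn hER
  set ρ : Fin N → ℝ → ℂ := fun j v => FL (γ v) k * deriv γ v * ER (γ v) j with hρ
  have hρi : ∀ j, IntervalIntegrable (ρ j) volume 0 1 := fun j =>
    intervalIntegrable_density hγ hFLc (hERc j)
  set g : ℝ → ℂ := fun v => (∑ j, EL (γ u) j * ER (γ v) j) / (γ u - γ v) *
      (FL (γ v) k * deriv γ v) with hg
  have hα1 : α ∈ uIcc (0 : ℝ) 1 := by rw [uIcc_of_le zero_le_one]; exact ⟨hα, hαβ.trans hβ⟩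
  have hβ1 : β ∈ uIcc (0 : ℝ) 1 := by rw [uIcc_of_le zero_le_one]; exact ⟨hα.trans hαβ, hβ⟩
  -- on an arc that avoids `γ u` the integral is a combination of Cauchy integrals
  have hfar : ∀ {p q : ℝ}, p ≤ q → Icc p q ⊆ Icc 0 1 → (∀ v ∈ Icc p q, γ u ≠ γ v) →
      IntervalIntegrable g volume p q ∧
      ∫ v in p..q, g v = -∑ j, cauchyTransform γ (ρ j) p q (γ u) * EL (γ u) j := by
    intro p q hpq hs hne
    have hi : ∀ j, IntervalIntegrable (fun v => ρ j v / (γ v - γ u) * EL (γ u) j) volume p q :=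
      fun j => (intervalIntegrable_div_sub hpq (hγ.smooth.1.mono hs) ((hρi j).mono_set (by
        rwa [uIcc_of_le hpq, uIcc_of_le zero_le_one])) (by
        rintro ⟨v, hv, h0⟩; exact hne v hv h0.symm)).mul_const _
    have e1 : g = fun v => -∑ j, ρ j v / (γ v - γ u) * EL (γ u) j := by
      ext v
      rw [hg, hρ]
      simp only
      rw [Finset.sum_div, Finset.sum_mul, ← Finset.sum_neg_distrib]
      refine Finset.sum_congr rfl fun j _ => ?_
      rw [← neg_sub (γ v) (γ u), div_neg]
      ring
    have hsum : IntervalIntegrable (fun v => ∑ j, ρ j v / (γ v - γ u) * EL (γ u) j) volume p q := by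
      have := IntervalIntegrable.sum Finset.univ fun j _ => hi j
      rwa [show (∑ j, fun v => ρ j v / (γ v - γ u) * EL (γ u) j)
        = fun v => ∑ j, ρ j v / (γ v - γ u) * EL (γ u) j by ext v; simp] at this
    rw [e1]
    refine ⟨hsum.neg, ?_⟩
    rw [intervalIntegral.integral_neg, intervalIntegral.integral_finsetSum fun j _ => hi j]
    simp only [intervalIntegral.integral_mul_const]
    rfl
  obtain ⟨iL, eL⟩ := hfar hα (Icc_subset_Icc le_rfl (hαβ.trans hβ)) h1
  obtain ⟨iR, eR⟩ := hfar hβ (Icc_subset_Icc (hα.trans hαβ) le_rfl) h2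
  have heq := hFL.equation (γ u) (hmaps hu) k
  have e2 : curveInt γ (fun y => integrableKernel EL ER (γ u) y * FL y k) = ∫ v in (0 : ℝ)..1, g v := by
    unfold curveInt
    congr 1; ext v
    simp only [hg, integrableKernel, dotProduct]
    ring
  have e3 := intervalIntegral.integral_add_adjacent_intervals iL hint
  have e4 := intervalIntegral.integral_add_adjacent_intervals (iL.trans hint) iR
  have e5 : ∑ j, (1 : Matrix (Fin N) (Fin N) ℂ) j k * EL (γ u) j = EL (γ u) k := by
    simp [Matrix.one_apply]
  simp only [add_mul, Finset.sum_add_distrib, e5]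
  rw [e2] at heq
  linear_combination heq + e3 + e4 - eL - eR

end Solution

section Regular
variable {N : ℕ} {γ : ℝ → ℂ} {B : Finset ℝ} {EL ER FL : ℂ → Fin N → ℂ}
  {χ : ℂ → Matrix (Fin N) (Fin N) ℂ} {t₀ : ℝ}

/-- Near a regular point the two vectors `E_L` and `E_R` are orthogonal to first order. -/
theorem exists_norm_dotProduct_le
    (hEL : PiecewiseContDiff ((⊤ : ℕ∞) : WithTop ℕ∞) (fun t => EL (γ t)) B)
    (hER : PiecewiseContDiff ((⊤ : ℕ∞) : WithTop ℕ∞) (fun t => ER (γ t)) B)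
    (horth : ∀ x ∈ support γ, dotProduct (EL x) (ER x) = 0) (ht₀ : t₀ ∈ Ioo (0 : ℝ) 1 \ B) :
    ∃ C, 0 ≤ C ∧ ∃ I ∈ 𝓝 t₀, ∀ u ∈ I, ∀ v ∈ I, v ∈ Icc (0 : ℝ) 1 →
      ‖∑ j, EL (γ u) j * ER (γ v) j‖ ≤ C * |u - v| := by
  obtain ⟨K, I, hI, hK⟩ := ((hEL.contDiffAt ht₀).of_le (m := 1)
    (by exact_mod_cast le_top)).exists_lipschitzOnWith
  obtain ⟨M, hM⟩ := isCompact_Icc.exists_bound_of_continuousOn hER.1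
  have hM0 : 0 ≤ M := (norm_nonneg _).trans (hM 0 (left_mem_Icc.2 zero_le_one))
  refine ⟨N * (K * M), by positivity, I, hI, fun u hu v hv hv01 => ?_⟩
  have h0 : ∑ j, EL (γ v) j * ER (γ v) j = 0 := horth _ ⟨v, hv01, rfl⟩
  have e1 : ∑ j, EL (γ u) j * ER (γ v) j = ∑ j, (EL (γ u) j - EL (γ v) j) * ER (γ v) j := by
    simp only [sub_mul, Finset.sum_sub_distrib, h0, sub_zero]
  rw [e1]
  refine (norm_sum_le _ _).trans ?_
  have h1 : ∀ j, ‖(EL (γ u) j - EL (γ v) j) * ER (γ v) j‖ ≤ K * |u - v| * M := by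
    intro j
    rw [norm_mul]
    have h2 := hK.dist_le_mul u hu v hv
    rw [dist_eq_norm, Real.dist_eq] at h2
    exact mul_le_mul ((norm_le_pi_norm (EL (γ u) - EL (γ v)) j).trans h2)
      ((norm_le_pi_norm _ j).trans (hM v hv01)) (norm_nonneg _) (by positivity)
  refine (Finset.sum_le_sum fun j _ => h1 j).trans_eq ?_
  simp only [Finset.sum_const, Finset.card_univ, Fintype.card_fin, nsmul_eq_mul]
  ring

/-- Across a regular point of the curve the product of the solution of the Riemann--Hilbert
problem and of the candidate for its inverse extends holomorphically. -/
theorem exists_extension_of_regular (hγ : IsPiecewiseSmoothCurve γ B)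
    (hEL : PiecewiseContDiff ((⊤ : ℕ∞) : WithTop ℕ∞) (fun t => EL (γ t)) B)
    (hER : PiecewiseContDiff ((⊤ : ℕ∞) : WithTop ℕ∞) (fun t => ER (γ t)) B)
    (horth : ∀ x ∈ support γ, dotProduct (EL x) (ER x) = 0)
    (hχ : SolvesRHP γ B EL ER χ) (hFL : IsLeftSolution γ EL ER FL)
    (ht₀ : t₀ ∈ Ioo (0 : ℝ) 1 \ B) (i k : Fin N) :
    ∃ r > 0, ∃ A : ℂ → ℂ, DifferentiableOn ℂ A (ball (γ t₀) r) ∧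
      ∀ z ∈ ball (γ t₀) r, z ∉ support γ → (χ z * cauchyInverse γ ER FL z) i k = A z := by
  obtain ⟨χp, χm, ⟨hcp, hcm, L, R, hLR, hlim⟩, hjump⟩ := hχ.jump
  set d := deriv γ t₀ with hd
  have hs₀ := hγ.mem_openArc ht₀.1
  have hmaps : MapsTo γ (Icc 0 1) (support γ) := fun u hu => ⟨u, hu, rfl⟩
  have hentry : ∀ s ∈ openArc γ, ∀ j, Tendsto (fun z => χ z i j) (𝓝[L] s) (𝓝 (χp s i j)) ∧
      Tendsto (fun z => χ z i j) (𝓝[R] s) (𝓝 (χm s i j)) := fun s hs j =>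
    ⟨tendsto_pi_nhds.1 (tendsto_pi_nhds.1 (hlim s hs).1 i) j,
      tendsto_pi_nhds.1 (tendsto_pi_nhds.1 (hlim s hs).2 i) j⟩
  -- a neighbourhood on which the entries of `χ` are bounded
  obtain ⟨M, hM⟩ : ∃ M, ∀ᶠ z in 𝓝 (γ t₀), z ∈ L ∪ R → ∀ j, ‖χ z i j‖ ≤ M := by
    refine ⟨∑ j, ((‖χp (γ t₀) i j‖ + 1) + (‖χm (γ t₀) i j‖ + 1)), ?_⟩
    have h1 : ∀ᶠ z in 𝓝 (γ t₀), z ∈ L → ∀ j, ‖χ z i j‖ ≤ ‖χp (γ t₀) i j‖ + 1 := by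
      rw [← eventually_nhdsWithin_iff, eventually_all]
      intro j
      exact ((hentry _ hs₀ j).1.norm.eventually_lt_const (lt_add_one _)).mono fun _ h => h.le
    have h2 : ∀ᶠ z in 𝓝 (γ t₀), z ∈ R → ∀ j, ‖χ z i j‖ ≤ ‖χm (γ t₀) i j‖ + 1 := by
      rw [← eventually_nhdsWithin_iff, eventually_all]
      intro j
      exact ((hentry _ hs₀ j).2.norm.eventually_lt_const (lt_add_one _)).mono fun _ h => h.le
    filter_upwards [h1, h2] with z hz1 hz2 hz j
    have h3 := Finset.single_le_sum
      (f := fun j => ((‖χp (γ t₀) i j‖ + 1) + (‖χm (γ t₀) i j‖ + 1)))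
      (fun j _ => by positivity) (Finset.mem_univ j)
    refine le_trans ?_ h3
    rcases hz with hz | hz
    · linarith [hz1 hz j, norm_nonneg (χm (γ t₀) i j)]
    · linarith [hz2 hz j, norm_nonneg (χp (γ t₀) i j)]
  obtain ⟨C, hC, I, hI, hCI⟩ := exists_norm_dotProduct_le hEL hER horth ht₀
  obtain ⟨a, hbox, hreg, haI, hW, hoff, hrest⟩ := hγ.exists_isBox_subset ht₀
    (inter_mem (hLR.cover _ hs₀) hM) hI
  have ha := hbox.pos
  have hdpos := norm_pos_iff.2 hbox.ne_zero
  have hLR' : ∀ u ∈ Icc (t₀ - a) (t₀ + a), ∀ τ ∈ Icc (-a) a, τ ≠ 0 →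
      γ u + τ * (Complex.I * d) ∈ L ∪ R := fun u hu τ hτ hτ0 =>
    (hW u hu τ hτ).1.resolve_right (hoff u hu τ hτ hτ0)
  obtain ⟨hupper, hlower⟩ := hLR.box_subset ht₀ hbox hLR'
  have h01 : Icc (t₀ - a) (t₀ + a) ⊆ Icc 0 1 := fun u hu => Ioo_subset_Icc_self (hreg hu).1
  have hoa : ∀ u ∈ Icc (t₀ - a) (t₀ + a), γ u ∈ openArc γ := fun u hu =>
    hγ.mem_openArc (hreg hu).1
  have hcurve : ∀ u : ℝ, Tendsto (fun τ : ℝ => γ u + τ * (Complex.I * d)) (𝓝 0) (𝓝 (γ u)) := by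
    intro u
    have : Continuous (fun τ : ℝ => γ u + τ * (Complex.I * d)) := by fun_prop
    simpa using this.tendsto 0
  have htp : ∀ u ∈ Icc (t₀ - a) (t₀ + a), ∀ j,
      Tendsto (fun τ : ℝ => χ (γ u + τ * (Complex.I * d)) i j) (𝓝[>] 0) (𝓝 (χp (γ u) i j)) := by
    intro u hu j
    refine (hentry _ (hoa u hu) j).1.comp (tendsto_nhdsWithin_iff.2
      ⟨(hcurve u).mono_left nhdsWithin_le_nhds, ?_⟩)
    filter_upwards [Ioc_mem_nhdsGT ha] with τ hτ using hupper u hu τ hτ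
  have htm : ∀ u ∈ Icc (t₀ - a) (t₀ + a), ∀ j,
      Tendsto (fun τ : ℝ => χ (γ u + τ * (Complex.I * d)) i j) (𝓝[<] 0) (𝓝 (χm (γ u) i j)) := by
    intro u hu j
    refine (hentry _ (hoa u hu) j).2.comp (tendsto_nhdsWithin_iff.2
      ⟨(hcurve u).mono_left nhdsWithin_le_nhds, ?_⟩)
    filter_upwards [Ico_mem_nhdsLT (neg_lt_zero.2 ha)] with τ hτ using hlower u hu τ hτ
  have hχpc : ∀ j, ContinuousOn (fun u => χp (γ u) i j) (Icc (t₀ - a) (t₀ + a)) := fun j =>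
    (continuous_apply j).comp_continuousOn ((continuous_apply i).comp_continuousOn
      (hcp.comp hbox.continuousOn hoa))
  have hχmc : ∀ j, ContinuousOn (fun u => χm (γ u) i j) (Icc (t₀ - a) (t₀ + a)) := fun j =>
    (continuous_apply j).comp_continuousOn ((continuous_apply i).comp_continuousOn
      (hcm.comp hbox.continuousOn hoa))
  have hELc : ∀ j, ContinuousOn (fun u => EL (γ u) j) (Icc 0 1) := fun j =>
    (continuous_apply j).comp_continuousOn hEL.1
  have hERc : ∀ j, ContinuousOn (fun u => ER (γ u) j) (Icc 0 1) := fun j =>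
    (continuous_apply j).comp_continuousOn hER.1
  have hFLc : ContinuousOn (fun u => FL (γ u) k) (Icc 0 1) :=
    (continuous_apply k).comp_continuousOn (hFL.continuousOn.comp hγ.smooth.1 hmaps)
  -- the local representation of `χ`
  set p : ℝ → ℂ := fun u => ∑ l, χp (γ u) i l * ER (γ u) l with hp
  have hpc : ContinuousOn p (Icc (t₀ - a) (t₀ + a)) :=
    continuousOn_finsetSum _ fun l _ => (hχpc l).mul ((hERc l).mono h01)
  have hjump' : ∀ u ∈ Icc (t₀ - a) (t₀ + a), ∀ j, χp (γ u) i j - χm (γ u) i j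
      = -(2 * Real.pi * Complex.I) * (p u * EL (γ u) j) := by
    intro u hu j
    rw [hjump _ (hoa u hu), Matrix.mul_add, Matrix.mul_one, Matrix.mul_smul, Matrix.add_apply,
      Matrix.smul_apply, Matrix.mul_apply, smul_eq_mul, sub_add_cancel_left, neg_mul]
    simp only [Matrix.vecMulVec_apply, hp, Finset.sum_mul]
    congr 2
    exact Finset.sum_congr rfl fun l _ => by ring
  have hclosed := hγ.isClosed_support
  have hrep : ∀ j, ∃ X : ℂ → ℂ, DifferentiableOn ℂ X (ball (γ t₀) (‖d‖ * a / 4)) ∧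
      ∀ z ∈ ball (γ t₀) (‖d‖ * a / 4), z ∈ (support γ)ᶜ → χ z i j = X z -
        cauchyTransform γ (fun u => p u * deriv γ u * EL (γ u) j) (t₀ - a) (t₀ + a) z := by
    intro j
    obtain ⟨X, hX, hX'⟩ := hbox.exists_eq_add_cauchyTransform hclosed.isOpen_compl
      (hχ.holomorphic i j) (fun u hu τ hτ hτ0 => hoff u hu τ hτ hτ0)
      (fun u hu h0 => h0 (hmaps (h01 hu)))
      (fun u hu τ hτ hτ0 => (hW u hu τ hτ).2 (hLR' u hu τ hτ hτ0) j) (hχpc j) (hχmc j)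
      (fun u hu => htp u hu j) (fun u hu => htm u hu j)
    refine ⟨X, hX, fun z hz hz' => ?_⟩
    rw [hX' z hz hz', ← sub_neg_eq_add]
    congr 1
    unfold cauchyTransform
    rw [← intervalIntegral.integral_const_mul, ← intervalIntegral.integral_neg]
    refine intervalIntegral.integral_congr fun u hu => ?_
    rw [uIcc_of_le (by linarith)] at hu
    have hpi : (2 * Real.pi * Complex.I : ℂ) ≠ 0 := Complex.two_pi_I_ne_zero
    simp only [hjump' u hu j]
    field_simp
  choose X hXd hXeq using hrep
  -- Three nested arcs, each a sixth of the preceding one. The chord estimate puts the arc of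
  -- half-length `b` into the disc of radius `|d| (6 b) / 4`, that is, into the disc on which the
  -- function that accompanies the Cauchy integral over the preceding arc is holomorphic.
  have hball : ∀ b, 0 < b → b ≤ a / 6 → MapsTo γ (Icc (t₀ - b) (t₀ + b))
      (ball (γ t₀) (‖d‖ * (6 * b) / 4)) := by
    intro b hb hba u hu
    have hu' : u ∈ Icc (t₀ - a) (t₀ + a) := ⟨by linarith [hu.1], by linarith [hu.2]⟩
    have h1 := hbox.near u hu' t₀ hbox.center_mem
    have h2 : |u - t₀| ≤ b := abs_le.2 ⟨by linarith [hu.1], by linarith [hu.2]⟩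
    rw [mem_ball, dist_eq_norm]
    have h3 : ‖((u : ℂ) - t₀) * d‖ = |u - t₀| * ‖d‖ := by
      rw [norm_mul, ← Complex.ofReal_sub, Complex.norm_real, Real.norm_eq_abs]
    have h4 := norm_add_le (γ u - γ t₀ - (u - t₀) * d) ((u - t₀) * d)
    rw [sub_add_cancel, h3] at h4
    nlinarith
  set a₂ := a / 6 with ha₂
  set a₃ := a₂ / 6 with ha₃
  have ha2pos : 0 < a₂ := by positivity
  have ha3pos : 0 < a₃ := by positivity
  have hs2 : Icc (t₀ - a₂) (t₀ + a₂) ⊆ Icc (t₀ - a) (t₀ + a) :=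
    Icc_subset_Icc (by linarith) (by linarith)
  have hs3 : Icc (t₀ - a₃) (t₀ + a₃) ⊆ Icc (t₀ - a₂) (t₀ + a₂) :=
    Icc_subset_Icc (by linarith) (by linarith)
  have hα : 0 ≤ t₀ - a₂ := (h01 (hs2 (left_mem_Icc.2 (by linarith)))).1
  have hβ : t₀ + a₂ ≤ 1 := (h01 (hs2 (right_mem_Icc.2 (by linarith)))).2
  have hle2 : t₀ - a₂ ≤ t₀ + a₂ := by linarith
  have hm2 := hball a₂ ha2pos le_rfl
  have hm3 := hball a₃ ha3pos (by linarith)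
  rw [show 6 * a₂ = a by rw [ha₂]; ring] at hm2
  rw [show 6 * a₃ = a₂ by rw [ha₃]; ring] at hm3
  have hDa : ball (γ t₀) (‖d‖ * a₃ / 4) ⊆ ball (γ t₀) (‖d‖ * a / 4) :=
    ball_subset_ball (by nlinarith)
  have hDa2 : ball (γ t₀) (‖d‖ * a₃ / 4) ⊆ ball (γ t₀) (‖d‖ * a₂ / 4) :=
    ball_subset_ball (by nlinarith)
  have hρi : ∀ j, IntervalIntegrable (fun u => FL (γ u) k * deriv γ u * ER (γ u) j) volume 0 1 :=
    fun j => intervalIntegrable_density hγ hFLc (hERc j)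
  have hmem1 : t₀ - a₂ ∈ uIcc (0 : ℝ) 1 := by
    rw [uIcc_of_le zero_le_one]; exact ⟨hα, hle2.trans hβ⟩
  have hmem2 : t₀ + a₂ ∈ uIcc (0 : ℝ) 1 := by
    rw [uIcc_of_le zero_le_one]; exact ⟨hα.trans hle2, hβ⟩
  -- the part of `cauchyInverse` that stems from the curve outside the second arc
  set Y : Fin N → ℂ → ℂ := fun j z => (1 : Matrix (Fin N) (Fin N) ℂ) j k +
      cauchyTransform γ (fun u => FL (γ u) k * deriv γ u * ER (γ u) j) 0 (t₀ - a₂) z +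
      cauchyTransform γ (fun u => FL (γ u) k * deriv γ u * ER (γ u) j) (t₀ + a₂) 1 z with hY
  have hYd : ∀ j, DifferentiableOn ℂ (Y j) (ball (γ t₀) (‖d‖ * a₂ / 4)) := by
    intro j
    refine DifferentiableOn.add ((differentiableOn_const _).add ?_) ?_
    · refine (differentiableOn_cauchyTransform hα (hγ.smooth.1.mono
        (Icc_subset_Icc le_rfl (hle2.trans hβ)))
        ((hρi j).mono_set (uIcc_subset_uIcc_left hmem1))).mono ?_
      rintro z hz ⟨u, hu, rfl⟩
      exact hrest a₂ ha2pos (by linarith) u ⟨hu.1, hu.2.trans (hle2.trans hβ)⟩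
        (fun h => absurd h.1 (not_lt.2 hu.2)) hz
    · refine (differentiableOn_cauchyTransform hβ (hγ.smooth.1.mono
        (Icc_subset_Icc (hα.trans hle2) le_rfl))
        ((hρi j).mono_set (uIcc_subset_uIcc_right hmem2))).mono ?_
      rintro z hz ⟨u, hu, rfl⟩
      exact hrest a₂ ha2pos (by linarith) u ⟨(hα.trans hle2).trans hu.1, hu.2⟩
        (fun h => absurd h.2 (not_lt.2 hu.1)) hz
  have hΨ : ∀ j, ∀ z, z ∉ support γ → cauchyInverse γ ER FL z j k = Y j z +
      cauchyTransform γ (fun u => FL (γ u) k * deriv γ u * ER (γ u) j) (t₀ - a₂) (t₀ + a₂) z := by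
    intro j z hz
    have hi := intervalIntegrable_div_sub zero_le_one hγ.smooth.1 (hρi j) hz
    have e1 := intervalIntegral.integral_add_adjacent_intervals
      (hi.mono_set (uIcc_subset_uIcc_left hmem1)) (hi.mono_set (uIcc_subset_uIcc hmem1 hmem2))
    have e2 := intervalIntegral.integral_add_adjacent_intervals
      (hi.mono_set (uIcc_subset_uIcc_left hmem2)) (hi.mono_set (uIcc_subset_uIcc_right hmem2))
    simp only [cauchyInverse, Matrix.of_apply, hY, cauchyTransform]
    rw [← e2, ← e1]
    ring
  have hef : ∀ u ∈ Icc (t₀ - a) (t₀ + a), ∀ v ∈ Icc (t₀ - a) (t₀ + a),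
      ‖∑ j, EL (γ u) j * ER (γ v) j‖ ≤ C * |u - v| := fun u hu v hv =>
    hCI u (haI hu) v (haI hv) (h01 hv)
  have hPc : ContinuousOn (fun u => p u * deriv γ u) (Icc (t₀ - a) (t₀ + a)) :=
    hpc.mul hbox.continuousOn_deriv
  have key := sum_mul_eqMod_zero (D := ball (γ t₀) (‖d‖ * a₃ / 4)) (Ω := (support γ)ᶜ)
    (X := X) (Y := Y) (e := fun j u => EL (γ u) j) (f := fun j u => ER (γ u) j) (p := p)
    (q := fun u => FL (γ u) k) hbox ha3pos (by linarith) (by linarith)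
    (fun u hu hu' => hrest a₃ ha3pos (by linarith) u (h01 hu) hu')
    (fun u hu h0 => h0 (hmaps (h01 hu))) isOpen_ball hDa hm2 isOpen_ball hDa2 hm3 hXd hYd
    (fun j => (hELc j).mono h01) (fun j => (hERc j).mono h01) hpc (hFLc.mono h01) hC hef ?_ ?_
  · obtain ⟨A, hA, hA'⟩ := key
    refine ⟨‖d‖ * a₃ / 4, by positivity, A, hA, fun z hz hz' => ?_⟩
    have := hA' z hz hz'
    rw [Pi.zero_apply, zero_add] at this
    rw [← this, Matrix.mul_apply]
    exact Finset.sum_congr rfl fun j _ => by rw [hXeq j z (hDa hz) hz', hΨ j z hz']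
  · intro v hv
    refine hbox.sum_boundary_value (hs2 hv) hPc (fun j => (hELc j).mono h01) hC
      (fun u hu => hef u hu v (hs2 hv))
      (fun j => (hXd j).continuousOn.continuousAt (isOpen_ball.mem_nhds (hm2 hv))) fun j => ?_
    refine (htp v (hs2 hv) j).congr' ?_
    filter_upwards [Ioc_mem_nhdsGT ha, nhdsWithin_le_nhds
      ((hcurve v).eventually (isOpen_ball.mem_nhds (hm2 hv)))] with τ hτ hτ'
    exact hXeq j _ hτ' (hoff v (hs2 hv) τ ⟨by linarith [hτ.1], hτ.2⟩ hτ.1.ne')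
  · intro u hu
    have hu2 := hs3 hu
    have hne : ∀ v ∈ Icc (0 : ℝ) 1, v ∉ Ioo (t₀ - a₂) (t₀ + a₂) → γ u ≠ γ v := fun v hv hv' h0 =>
      hrest a₂ ha2pos (by linarith) v hv hv' (h0 ▸ hm3 hu)
    refine hFL.local_equation hγ hER.1 hα hle2 hβ (h01 (hs2 hu2)) (fun v hv => ?_)
      (fun v hv => ?_) ?_
    · exact hne v ⟨hv.1, hv.2.trans (hle2.trans hβ)⟩ fun h => absurd h.1 (not_lt.2 hv.2)
    · exact hne v ⟨(hα.trans hle2).trans hv.1, hv.2⟩ fun h => absurd h.2 (not_lt.2 hv.1)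
    · have hQ : ContinuousOn (fun v => FL (γ v) k * deriv γ v) (Icc (t₀ - a₂) (t₀ + a₂)) :=
        ((hFLc.mono h01).mul hbox.continuousOn_deriv).mono hs2
      rw [intervalIntegrable_iff_integrableOn_Icc_of_le hle2]
      refine (hQ.integrableOn_compact isCompact_Icc).bdd_mul (c := C / (3 / 4 * ‖d‖)) ?_ ?_
      · have h1 : ContinuousOn (fun v => ∑ j, EL (γ u) j * ER (γ v) j)
            (Icc (t₀ - a₂) (t₀ + a₂)) :=
          continuousOn_finsetSum _ fun j _ =>
            continuousOn_const.mul ((hERc j).mono (hs2.trans h01))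
        have h2 : ContinuousOn (fun v => γ u - γ v) (Icc (t₀ - a₂) (t₀ + a₂)) :=
          continuousOn_const.sub (hbox.continuousOn.mono hs2)
        exact ((h1.aestronglyMeasurable measurableSet_Icc).aemeasurable.div
          (h2.aestronglyMeasurable measurableSet_Icc).aemeasurable).aestronglyMeasurable
      · filter_upwards [ae_restrict_mem measurableSet_Icc] with v hv
        exact norm_div_chord_le hC (by positivity) (abs_nonneg _) (hef u (hs2 hu2) v (hs2 hv))
          (hbox.le_norm_sub (hs2 hu2) (hs2 hv))

end Regular

/-! ### Removing singularities across the curve -/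

/-- The nodes of the curve: the images of the end points of the parameter interval (for a closed
curve as well) and of the break points. -/
def nodes (γ : ℝ → ℂ) (B : Finset ℝ) : Set ℂ := γ '' (Icc 0 1 \ (Ioo 0 1 \ B))

theorem nodes_finite (γ : ℝ → ℂ) (B : Finset ℝ) : (nodes γ B).Finite := by
  refine Set.Finite.image _ ((((B.finite_toSet).insert 1).insert 0).subset ?_)
  rintro u ⟨⟨h0, h1⟩, hu⟩
  rcases h0.eq_or_lt with rfl | h0
  · exact mem_insert _ _
  rcases h1.eq_or_lt with rfl | h1
  · exact mem_insert_of_mem _ (mem_insert _ _)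
  refine mem_insert_of_mem _ (mem_insert_of_mem _ ?_)
  by_contra h
  exact hu ⟨⟨h0, h1⟩, h⟩

/-- The support of a piecewise smooth curve is a null set of the plane. -/
theorem PiecewiseContDiff.volume_support {γ : ℝ → ℂ} {B : Finset ℝ} {n : WithTop ℕ∞}
    (hγ : PiecewiseContDiff n γ B) (hn : n ≠ 0) : volume (support γ) = 0 := by
  have h1 : support γ ⊆ nodes γ B ∪ γ '' (Ioo 0 1 \ B) := by
    rintro _ ⟨u, hu, rfl⟩
    by_cases h : u ∈ Ioo (0 : ℝ) 1 \ B
    · exact Or.inr ⟨u, h, rfl⟩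
    · exact Or.inl ⟨u, ⟨hu, h⟩, rfl⟩
  refine measure_mono_null h1 (measure_union_null ((nodes_finite γ B).measure_zero _) ?_)
  -- the arc is the image of a subset of the real line under the map `z ↦ γ (re z)` of the plane
  have h2 : γ '' (Ioo 0 1 \ B) =
      (fun z : ℂ => γ z.re) '' {z : ℂ | z.im = 0 ∧ z.re ∈ Ioo (0 : ℝ) 1 \ B} := by
    ext w
    constructor
    · rintro ⟨u, hu, rfl⟩
      exact ⟨(u : ℂ), ⟨by simp, by simpa using hu⟩, by simp⟩
    · rintro ⟨z, ⟨-, hz⟩, rfl⟩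
      exact ⟨z.re, hz, rfl⟩
  rw [h2]
  refine addHaar_image_eq_zero_of_differentiableOn_of_addHaar_eq_zero volume ?_ ?_
  · rintro z ⟨-, hz⟩
    exact ((hγ.hasDerivAt hn hz).differentiableAt.comp z
      Complex.reCLM.differentiableAt).differentiableWithinAt
  · refine measure_mono_null (t := ((LinearMap.ker Complex.imLm : Submodule ℝ ℂ) : Set ℂ))
      (fun z hz => hz.1) (Measure.addHaar_submodule volume _ fun h => ?_)
    have : Complex.I ∈ LinearMap.ker Complex.imLm := h ▸ Submodule.mem_top
    simp at this

/-- A function that extends holomorphically across a thin set near each point of an open set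
extends holomorphically to all of it. -/
theorem exists_differentiableOn_of_local {J U : Set ℂ} (hJ : Dense Jᶜ) {H : ℂ → ℂ}
    (h : ∀ z ∈ U, ∃ r > 0, ∃ A : ℂ → ℂ, DifferentiableOn ℂ A (ball z r) ∧
      ∀ w ∈ ball z r, w ∉ J → H w = A w) :
    ∃ G : ℂ → ℂ, DifferentiableOn ℂ G U ∧ ∀ z ∈ U, z ∉ J → G z = H z := by
  have key : ∀ {z r} {A : ℂ → ℂ}, 0 < r → DifferentiableOn ℂ A (ball z r) →
      (∀ w ∈ ball z r, w ∉ J → H w = A w) →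
      ∀ w ∈ ball z r, limUnder (𝓝[Jᶜ] w) H = A w := by
    intro z r A hr hA hHA w hw
    have hball := isOpen_ball.mem_nhds hw
    have : (𝓝[Jᶜ] w).NeBot := mem_closure_iff_nhdsWithin_neBot.1 (hJ w)
    refine Tendsto.limUnder_eq ?_
    refine ((hA.differentiableAt hball).continuousAt.continuousWithinAt (s := Jᶜ)).tendsto.congr' ?_
    filter_upwards [nhdsWithin_le_nhds hball, self_mem_nhdsWithin] with x hx hx'
      using (hHA x hx hx').symm
  refine ⟨fun z => limUnder (𝓝[Jᶜ] z) H, fun z hz => ?_, fun z hz hzJ => ?_⟩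
  · obtain ⟨r, hr, A, hA, hHA⟩ := h z hz
    have hball := isOpen_ball.mem_nhds (mem_ball_self hr : z ∈ ball z r)
    refine ((hA.differentiableAt hball).congr_of_eventuallyEq ?_).differentiableWithinAt
    filter_upwards [hball] with w hw using key hr hA hHA w hw
  · obtain ⟨r, hr, A, hA, hHA⟩ := h z hz
    exact (key hr hA hHA z (mem_ball_self hr)).trans (hHA z (mem_ball_self hr) hzJ).symm

/-- The mean value inequality for the circle, in terms of lower integrals. -/
theorem enorm_le_lintegral_circle {G : ℂ → ℂ} {z : ℂ} {R r : ℝ} (hr : 0 < r) (hrR : r < R)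
    (hG : DifferentiableOn ℂ G (ball z R)) :
    ENNReal.ofReal (2 * Real.pi) * ‖G z‖ₑ ≤
      ∫⁻ θ in Ioo (-Real.pi) Real.pi, ‖G (circleMap z r θ)‖ₑ := by
  have hsub : closedBall z r ⊆ ball z R := closedBall_subset_ball hrR
  have h1 : Real.circleAverage G z r = G z := by
    refine circleAverage_of_differentiable_on_off_countable countable_empty ?_ ?_
    · rw [abs_of_pos hr]
      exact hG.continuousOn.mono hsub
    · rw [abs_of_pos hr]
      exact fun w hw => hG.differentiableAt
        (isOpen_ball.mem_nhds (hsub (ball_subset_closedBall hw.1)))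
  have hper : Function.Periodic (fun θ => G (circleMap z r θ)) (2 * Real.pi) := fun θ => by
    simp only [periodic_circleMap z r θ]
  have h2 := hper.intervalIntegral_add_eq 0 (-Real.pi)
  rw [zero_add, show -Real.pi + 2 * Real.pi = Real.pi by ring] at h2
  rw [Real.circleAverage, h2] at h1
  rw [← h1, enorm_smul, ← mul_assoc]
  have h3 : ENNReal.ofReal (2 * Real.pi) * ‖(2 * Real.pi)⁻¹‖ₑ = 1 := by
    rw [Real.enorm_of_nonneg (by positivity), ← ENNReal.ofReal_mul (by positivity),
      mul_inv_cancel₀ (by positivity), ENNReal.ofReal_one]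
  rw [h3, one_mul, intervalIntegral.integral_of_le (by linarith [Real.pi_pos]),
    integral_Ioc_eq_integral_Ioo]
  exact enorm_integral_le_lintegral_enorm _

/-- The mean value inequality for the disc; the constant is not optimal. -/
theorem enorm_mul_sq_le_lintegral_ball {G : ℂ → ℂ} {z : ℂ} {R : ℝ} (hR : 0 < R)
    (hG : DifferentiableOn ℂ G (ball z R)) :
    ENNReal.ofReal (R ^ 2) * ‖G z‖ₑ ≤ ∫⁻ w in ball z R, ‖G w‖ₑ := by
  classical
  set F : ℂ → ℂ := (ball z R).piecewise G 0 with hF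
  have hFm : Measurable F :=
    hG.continuousOn.measurable_piecewise continuousOn_const measurableSet_ball
  have e1 : ∫⁻ w in ball z R, ‖G w‖ₑ = ∫⁻ w, ‖F (z + w)‖ₑ := by
    rw [lintegral_add_left_eq_self (fun w => ‖F w‖ₑ) z, ← lintegral_indicator measurableSet_ball]
    congr 1; ext w
    by_cases hw : w ∈ ball z R <;> simp [hF, hw]
  have hm : Measurable fun p : ℝ × ℝ =>
      ENNReal.ofReal p.1 • ‖F (z + Complex.polarCoord.symm p)‖ₑ := by
    simp only [Complex.polarCoord_symm_apply, smul_eq_mul]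
    refine (by fun_prop : Measurable fun p : ℝ × ℝ => ENNReal.ofReal p.1).mul
      (hFm.comp ?_).enorm
    fun_prop
  rw [e1, ← Complex.lintegral_comp_polarCoord_symm, polarCoord_target,
    Measure.volume_eq_prod, ← Measure.prod_restrict, lintegral_prod _ hm.aemeasurable]
  calc ENNReal.ofReal (R ^ 2) * ‖G z‖ₑ
      ≤ ∫⁻ r in Ioo (R / 2) R, ENNReal.ofReal (R / 2) * (ENNReal.ofReal (2 * Real.pi) * ‖G z‖ₑ) := by
        rw [setLIntegral_const, Real.volume_Ioo, sub_half, mul_right_comm, ← mul_assoc,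
          ← ENNReal.ofReal_mul (by positivity), ← ENNReal.ofReal_mul (by positivity)]
        refine mul_le_mul' (ENNReal.ofReal_le_ofReal ?_) le_rfl
        nlinarith [Real.pi_gt_three, sq_nonneg R, mul_le_mul_of_nonneg_right
          Real.pi_gt_three.le (sq_nonneg R)]
    _ ≤ ∫⁻ r in Ioo (R / 2) R, ∫⁻ θ in Ioo (-Real.pi) Real.pi,
          ENNReal.ofReal r • ‖F (z + Complex.polarCoord.symm (r, θ))‖ₑ := by
        refine setLIntegral_mono' measurableSet_Ioo fun r hr => ?_
        have hr0 : 0 < r := by linarith [hr.1]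
        simp only [smul_eq_mul]
        rw [lintegral_const_mul' _ _ ENNReal.ofReal_ne_top]
        refine mul_le_mul' (ENNReal.ofReal_le_ofReal hr.1.le)
          ((enorm_le_lintegral_circle hr0 hr.2 hG).trans_eq ?_)
        refine lintegral_congr fun θ => ?_
        have e2 : z + Complex.polarCoord.symm (r, θ) = circleMap z r θ := by
          rw [Complex.polarCoord_symm_apply, circleMap, Complex.exp_mul_I, Complex.ofReal_cos,
            Complex.ofReal_sin]
        have e3 : circleMap z r θ ∈ ball z R := by
          rw [mem_ball, dist_eq_norm]
          simpa [circleMap, abs_of_pos hr0] using hr.2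
        rw [e2, hF, piecewise_eq_of_mem _ _ _ e3]
    _ ≤ _ := lintegral_mono_set fun r hr => by
        rw [mem_Ioi]; linarith [hr.1]

/-! ### Integrability of Cauchy potentials at the nodes -/

/-- A weak singularity in the plane is integrable on discs of fixed radius, uniformly with respect
to its position. -/
theorem exists_lintegral_ball_rpow_le {α : ℝ} (hα0 : 0 ≤ α) (hα : α < 2) :
    ∃ C : ENNReal, C ≠ ⊤ ∧ ∀ a p : ℂ, ∫⁻ w in ball a 1, ENNReal.ofReal (‖w - p‖ ^ (-α)) ≤ C := by
  have hint : IntegrableOn (fun w : ℂ => ‖w‖ ^ (-α)) (ball 0 1) :=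
    integrableOn_ball_of_norm_le_rpow (C := 1) (α := α) (by simp [Complex.finrank_real_complex])
      (by simpa [Complex.finrank_real_complex] using hα)
      (ae_of_all _ fun w => by
        rw [Real.norm_of_nonneg (Real.rpow_nonneg (norm_nonneg _) _), one_mul])
      (by fun_prop : Measurable fun w : ℂ => ‖w‖ ^ (-α)).aestronglyMeasurable
  set f : ℂ → ENNReal := fun w => ENNReal.ofReal (‖w‖ ^ (-α)) with hf
  have hfm : Measurable f := by fun_prop
  refine ⟨(∫⁻ w in ball (0 : ℂ) 1, f w) + volume (ball (0 : ℂ) 1),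
    ENNReal.add_ne_top.2 ⟨hint.lintegral_lt_top.ne, measure_ball_lt_top.ne⟩, fun a p => ?_⟩
  have hle : ∀ w, f (w - p) ≤ (ball (0 : ℂ) 1).indicator f (w - p) + 1 := by
    intro w
    by_cases hw : w - p ∈ ball (0 : ℂ) 1
    · rw [indicator_of_mem hw]; exact le_self_add
    · rw [mem_ball_zero_iff, not_lt] at hw
      refine le_add_left (ENNReal.ofReal_le_one.2 ?_)
      exact Real.rpow_le_one_of_one_le_of_nonpos hw (neg_nonpos.2 hα0)
  calc ∫⁻ w in ball a 1, f (w - p)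
      ≤ ∫⁻ w in ball a 1, ((ball (0 : ℂ) 1).indicator f (w - p) + 1) := lintegral_mono hle
    _ = (∫⁻ w in ball a 1, (ball (0 : ℂ) 1).indicator f (w - p)) + volume (ball a 1) := by
        rw [lintegral_add_right _ measurable_const, setLIntegral_one]
    _ ≤ _ := by
        refine add_le_add ?_ (Complex.volume_ball a 1 ▸ Complex.volume_ball (0 : ℂ) 1 ▸ le_rfl)
        refine (setLIntegral_le_lintegral _ _).trans_eq ?_
        rw [lintegral_sub_right_eq_self (fun w => (ball (0 : ℂ) 1).indicator f w) p,
          lintegral_indicator measurableSet_ball]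

/-- The splitting of the product of two weak singularities at different points. The exponent
`5/4 + 1` is not integrable in the plane; the power `1/2` of the distance `b` of the points is
traded for the exponent `7/4 < 2`. -/
theorem rpow_mul_inv_le {x y b : ℝ} (hx : 0 < x) (hy : 0 < y) (hb : 0 < b) (h : b ≤ x + y) :
    x ^ (-(5 / 4) : ℝ) * y⁻¹ ≤
      2 * b ^ (-(1 / 2) : ℝ) * (x ^ (-(7 / 4) : ℝ) + y ^ (-(7 / 4) : ℝ)) := by
  have key : ∀ {p q : ℝ}, p ≤ 0 → q ≤ 0 → p + q = -(7 / 4) →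
      x ^ p * y ^ q ≤ x ^ (-(7 / 4) : ℝ) + y ^ (-(7 / 4) : ℝ) := by
    intro p q hp hq hpq
    have hx0 := Real.rpow_nonneg hx.le (-(7 / 4))
    have hy0 := Real.rpow_nonneg hy.le (-(7 / 4))
    rcases le_total x y with hxy | hxy
    · have h1 := mul_le_mul_of_nonneg_left (Real.rpow_le_rpow_of_nonpos hx hxy hq)
        (Real.rpow_nonneg hx.le p)
      rw [← Real.rpow_add hx, hpq] at h1
      linarith
    · have h1 := mul_le_mul_of_nonneg_right (Real.rpow_le_rpow_of_nonpos hy hxy hp)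
        (Real.rpow_nonneg hy.le q)
      rw [← Real.rpow_add hy, hpq] at h1
      linarith
  have h1 : b ^ (1 / 2 : ℝ) ≤ x ^ (1 / 2 : ℝ) + y ^ (1 / 2 : ℝ) :=
    (Real.rpow_le_rpow hb.le h (by norm_num)).trans
      (Real.rpow_add_le_add_rpow hx.le hy.le (by norm_num) (by norm_num))
  have k1 := key (p := -(3 / 4)) (q := -1) (by norm_num) (by norm_num) (by norm_num)
  have k2 := key (p := -(5 / 4)) (q := -(1 / 2)) (by norm_num) (by norm_num) (by norm_num)
  have e1 : x ^ (1 / 2 : ℝ) * x ^ (-(5 / 4) : ℝ) = x ^ (-(3 / 4) : ℝ) := by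
    rw [← Real.rpow_add hx]; norm_num
  have e2 : y ^ (1 / 2 : ℝ) * y⁻¹ = y ^ (-(1 / 2) : ℝ) := by
    rw [← Real.rpow_neg_one, ← Real.rpow_add hy]; norm_num
  have e3 : b ^ (-(1 / 2) : ℝ) * b ^ (1 / 2 : ℝ) = 1 := by
    rw [← Real.rpow_add hb]; norm_num
  rw [Real.rpow_neg_one] at k1
  set S := x ^ (-(7 / 4) : ℝ) + y ^ (-(7 / 4) : ℝ)
  have h2 : b ^ (1 / 2 : ℝ) * (x ^ (-(5 / 4) : ℝ) * y⁻¹) ≤ 2 * S := by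
    calc b ^ (1 / 2 : ℝ) * (x ^ (-(5 / 4) : ℝ) * y⁻¹)
        ≤ (x ^ (1 / 2 : ℝ) + y ^ (1 / 2 : ℝ)) * (x ^ (-(5 / 4) : ℝ) * y⁻¹) :=
          mul_le_mul_of_nonneg_right h1 (by positivity)
      _ = x ^ (-(3 / 4) : ℝ) * y⁻¹ + x ^ (-(5 / 4) : ℝ) * y ^ (-(1 / 2) : ℝ) := by
          rw [← e1, ← e2]; ring
      _ ≤ 2 * S := by linarith
  calc x ^ (-(5 / 4) : ℝ) * y⁻¹
      = b ^ (-(1 / 2) : ℝ) * (b ^ (1 / 2 : ℝ) * (x ^ (-(5 / 4) : ℝ) * y⁻¹)) := by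
        rw [← mul_assoc, e3, one_mul]
    _ ≤ b ^ (-(1 / 2) : ℝ) * (2 * S) := mul_le_mul_of_nonneg_left h2 (by positivity)
    _ = _ := by ring

section Nodes
variable {γ : ℝ → ℂ} {B : Finset ℝ}

/-- A regular curve leaves each point at a linear rate: one-sided version. -/
theorem exists_mul_abs_le_of_derivWithin_ne_zero {s t u₁ : ℝ} {f : ℝ → ℂ}
    {n : WithTop ℕ∞} (hn : n ≠ 0) (hf : ContDiffOn ℝ n f (Icc s t)) (hu₁ : u₁ ∈ Icc s t)
    (h0 : derivWithin f (Icc s t) u₁ ≠ 0) :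
    ∃ c > 0, ∀ᶠ u in 𝓝[Icc s t] u₁, c * |u - u₁| ≤ ‖f u - f u₁‖ := by
  have hd := ((hf.differentiableOn hn) u₁ hu₁).hasDerivWithinAt
  set d := derivWithin f (Icc s t) u₁
  have hd0 := norm_pos_iff.2 h0
  refine ⟨‖d‖ / 2, by positivity, ?_⟩
  have h1 := (hasDerivWithinAt_iff_isLittleO.1 hd).bound (half_pos hd0)
  filter_upwards [h1] with u hu
  rw [Real.norm_eq_abs] at hu
  have h2 : ‖(u - u₁) • d‖ = |u - u₁| * ‖d‖ := by rw [norm_smul, Real.norm_eq_abs]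
  have h3 := norm_sub_norm_le ((u - u₁) • d) (f u - f u₁)
  rw [h2, norm_sub_rev ((u - u₁) • d)] at h3
  linarith

/-- A regular curve leaves each point at a linear rate, also at a break point, where the one-sided
derivatives may point in any directions. -/
theorem IsPiecewiseSmoothCurve.exists_mul_abs_le (hγ : IsPiecewiseSmoothCurve γ B) (a : ℂ)
    {u₁ : ℝ} (hu₁ : u₁ ∈ Icc (0 : ℝ) 1) :
    ∃ c > 0, ∀ᶠ u in 𝓝[Icc 0 1] u₁, c * |u - u₁| ≤ ‖γ u - a‖ := by
  by_cases ha : γ u₁ = a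
  · subst ha
    obtain ⟨ε, hε, hB⟩ := exists_pos_forall_notMem_Ioo B u₁
    have hL : ∃ c > 0, ∀ᶠ u in 𝓝[Icc 0 u₁] u₁, c * |u - u₁| ≤ ‖γ u - γ u₁‖ := by
      rcases hu₁.1.eq_or_lt with rfl | h0
      · refine ⟨1, one_pos, ?_⟩
        filter_upwards [self_mem_nhdsWithin] with u hu
        rw [Icc_self, mem_singleton_iff] at hu
        simp [hu]
      have hs : max 0 (u₁ - ε) < u₁ := max_lt h0 (by linarith)
      have hnb : ∀ x ∈ B, x ∉ Ioo (max 0 (u₁ - ε)) u₁ := fun x hx hx' => by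
        have h2 := hB x hx hx'.2.ne
        have h3 := (le_max_right 0 (u₁ - ε)).trans_lt hx'.1
        have : |x - u₁| < ε := abs_lt.2 ⟨by linarith, by linarith [hx'.2]⟩
        linarith
      obtain ⟨c, hc, h⟩ := exists_mul_abs_le_of_derivWithin_ne_zero (by simp)
        (hγ.smooth.2 _ _ (le_max_left _ _) hs hu₁.2 hnb) (right_mem_Icc.2 hs.le)
        (hγ.regular _ _ (le_max_left _ _) hs hu₁.2 hnb _ (right_mem_Icc.2 hs.le))
      refine ⟨c, hc, ?_⟩
      rw [nhdsWithin_Icc_eq_nhdsLE hs] at h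
      rwa [nhdsWithin_Icc_eq_nhdsLE h0]
    have hR : ∃ c > 0, ∀ᶠ u in 𝓝[Icc u₁ 1] u₁, c * |u - u₁| ≤ ‖γ u - γ u₁‖ := by
      rcases hu₁.2.eq_or_lt with rfl | h0
      · refine ⟨1, one_pos, ?_⟩
        filter_upwards [self_mem_nhdsWithin] with u hu
        rw [Icc_self, mem_singleton_iff] at hu
        simp [hu]
      have hs : u₁ < min 1 (u₁ + ε) := lt_min h0 (by linarith)
      have hnb : ∀ x ∈ B, x ∉ Ioo u₁ (min 1 (u₁ + ε)) := fun x hx hx' => by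
        have h2 := hB x hx hx'.1.ne'
        have h3 := hx'.2.trans_le (min_le_right 1 (u₁ + ε))
        have : |x - u₁| < ε := abs_lt.2 ⟨by linarith [hx'.1], by linarith⟩
        linarith
      obtain ⟨c, hc, h⟩ := exists_mul_abs_le_of_derivWithin_ne_zero (by simp)
        (hγ.smooth.2 _ _ hu₁.1 hs (min_le_left _ _) hnb) (left_mem_Icc.2 hs.le)
        (hγ.regular _ _ hu₁.1 hs (min_le_left _ _) hnb _ (left_mem_Icc.2 hs.le))
      refine ⟨c, hc, ?_⟩
      rw [nhdsWithin_Icc_eq_nhdsGE hs] at h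
      rwa [nhdsWithin_Icc_eq_nhdsGE h0]
    obtain ⟨c, hc, h⟩ := hL
    obtain ⟨c', hc', h'⟩ := hR
    refine ⟨min c c', lt_min hc hc', ?_⟩
    rw [← Icc_union_Icc_eq_Icc hu₁.1 hu₁.2, nhdsWithin_union, eventually_sup]
    exact ⟨h.mono fun u hu => (mul_le_mul_of_nonneg_right (min_le_left _ _) (abs_nonneg _)).trans hu,
      h'.mono fun u hu => (mul_le_mul_of_nonneg_right (min_le_right _ _) (abs_nonneg _)).trans hu⟩
  · have h1 : 0 < ‖γ u₁ - a‖ := norm_pos_iff.2 (sub_ne_zero.2 ha)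
    refine ⟨‖γ u₁ - a‖ / 2, by positivity, ?_⟩
    have h2 : Tendsto (fun u => ‖γ u - a‖) (𝓝[Icc 0 1] u₁) (𝓝 ‖γ u₁ - a‖) :=
      ((hγ.smooth.1 u₁ hu₁).sub continuousWithinAt_const).norm
    have h3 : Tendsto (fun u => |u - u₁|) (𝓝[Icc 0 1] u₁) (𝓝 0) := by
      have : Continuous fun u : ℝ => |u - u₁| := by fun_prop
      simpa using (this.tendsto u₁).mono_left nhdsWithin_le_nhds
    filter_upwards [h2.eventually_const_lt (half_lt_self h1), h3.eventually_lt_const one_pos]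
      with u hu hu'
    nlinarith

/-- The inverse square root of the distance from a point is integrable along a regular curve. -/
theorem IsPiecewiseSmoothCurve.integrableOn_rpow (hγ : IsPiecewiseSmoothCurve γ B) (a : ℂ) :
    IntegrableOn (fun u => ‖γ u - a‖ ^ (-(1 / 2) : ℝ)) (Icc 0 1) := by
  have hm : AEStronglyMeasurable (fun u => ‖γ u - a‖ ^ (-(1 / 2) : ℝ))
      (volume.restrict (Icc 0 1)) :=
    (((hγ.smooth.1.sub continuousOn_const).norm.aestronglyMeasurable
      measurableSet_Icc).aemeasurable.pow_const _).aestronglyMeasurable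
  refine LocallyIntegrableOn.integrableOn_isCompact (fun u₁ hu₁ => ?_) isCompact_Icc
  obtain ⟨c, hc, h⟩ := hγ.exists_mul_abs_le a hu₁
  obtain ⟨U, hU, hUc⟩ := mem_nhdsWithin_iff_exists_mem_nhds_inter.1 h
  obtain ⟨δ, hδ, hδU⟩ := Metric.mem_nhds_iff.1 hU
  refine ⟨ball u₁ δ ∩ Icc 0 1, by
    rw [inter_comm]; exact inter_mem_nhdsWithin _ (ball_mem_nhds _ hδ), ?_⟩
  have hint : IntegrableOn (fun u : ℝ => c ^ (-(1 / 2) : ℝ) * |u - u₁| ^ (-(1 / 2) : ℝ))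
      (ball u₁ δ) := by
    refine Integrable.const_mul ?_ _
    have h1 : IntegrableOn (fun u : ℝ => |u| ^ (-(1 / 2) : ℝ)) (ball 0 δ) :=
      integrableOn_ball_of_norm_le_rpow (C := 1) (α := 1 / 2) (by simp) (by norm_num)
        (ae_of_all _ fun w => by
          rw [Real.norm_of_nonneg (Real.rpow_nonneg (abs_nonneg _) _), one_mul, Real.norm_eq_abs])
        (by fun_prop : Measurable fun w : ℝ => |w| ^ (-(1 / 2) : ℝ)).aestronglyMeasurable
    have h2 := (measurePreserving_sub_right volume u₁).integrableOn_comp_preimage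
      (MeasurableEquiv.subRight u₁).measurableEmbedding (f := fun u : ℝ => |u| ^ (-(1 / 2) : ℝ))
      (s := ball 0 δ)
    rw [show (fun u : ℝ => u - u₁) ⁻¹' ball 0 δ = ball u₁ δ by
      ext u; simp [Real.dist_eq]] at h2
    exact h2.2 h1
  refine (hint.mono_set inter_subset_left).mono'
    (hm.mono_measure (Measure.restrict_mono inter_subset_right le_rfl)) ?_
  have hne : ∀ᵐ u : ℝ ∂(volume.restrict (ball u₁ δ ∩ Icc 0 1)), u ≠ u₁ :=
    ae_restrict_of_ae (by simp [ae_iff])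
  filter_upwards [ae_restrict_mem (measurableSet_ball.inter measurableSet_Icc), hne] with u hu hu'
  have h3 : 0 < |u - u₁| := abs_pos.2 (sub_ne_zero.2 hu')
  rw [Real.norm_of_nonneg (Real.rpow_nonneg (norm_nonneg _) _), ← Real.mul_rpow hc.le h3.le]
  exact Real.rpow_le_rpow_of_nonpos (by positivity) (hUc ⟨hδU hu.1, hu.2⟩) (by norm_num)

theorem IsPiecewiseSmoothCurve.ae_ne (hγ : IsPiecewiseSmoothCurve γ B) (a : ℂ) :
    ∀ᵐ u ∂(volume.restrict (Icc (0 : ℝ) 1)), γ u ≠ a := by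
  have hfin : {u | u ∈ Icc (0 : ℝ) 1 ∧ γ u = a}.Finite := by
    rcases eq_empty_or_nonempty {u | u ∈ Icc (0 : ℝ) 1 ∧ γ u = a} with h | ⟨u₁, hu₁, h1⟩
    · rw [h]; exact finite_empty
    refine (toFinite {u₁, 0, 1}).subset fun u hu => ?_
    rcases hγ.simple u hu.1 u₁ hu₁ (hu.2.trans h1.symm) with h | h | h
    · exact Or.inl h
    · exact Or.inr (Or.inl h.1)
    · exact Or.inr (Or.inr h.1)
  filter_upwards [ae_restrict_mem measurableSet_Icc,
    ae_restrict_of_ae (measure_eq_zero_iff_ae_notMem.1 (hfin.measure_zero volume))] with u hu hu' h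
    using hu' ⟨hu, h⟩

/-- The potential of the curve is integrable against a singularity of order `5/4` at any point. The
order `5/4 = 1 + 1/4` leaves room for a weak singularity of order `1/4` after division by the
distance. -/
theorem IsPiecewiseSmoothCurve.lintegral_potential_ne_top (hγ : IsPiecewiseSmoothCurve γ B)
    (a : ℂ) : ∫⁻ w in ball a 1, ∫⁻ u in Icc (0 : ℝ) 1,
      ENNReal.ofReal (‖w - a‖ ^ (-(5 / 4) : ℝ) * ‖γ u - w‖⁻¹) ≠ ⊤ := by
  obtain ⟨C, hC, hCb⟩ := exists_lintegral_ball_rpow_le (α := 7 / 4) (by norm_num) (by norm_num)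
  have hγm : AEMeasurable γ (volume.restrict (Icc 0 1)) :=
    (hγ.smooth.1.aestronglyMeasurable measurableSet_Icc).aemeasurable
  rw [lintegral_lintegral_swap]
  · have hle : ∫⁻ u in Icc (0 : ℝ) 1, ∫⁻ w in ball a 1,
        ENNReal.ofReal (‖w - a‖ ^ (-(5 / 4) : ℝ) * ‖γ u - w‖⁻¹) ≤
        ∫⁻ u in Icc (0 : ℝ) 1, ENNReal.ofReal (‖γ u - a‖ ^ (-(1 / 2) : ℝ)) * (2 * (C + C)) := by
      refine lintegral_mono_ae ?_
      filter_upwards [hγ.ae_ne a] with u hu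
      calc ∫⁻ w in ball a 1, ENNReal.ofReal (‖w - a‖ ^ (-(5 / 4) : ℝ) * ‖γ u - w‖⁻¹)
          ≤ ∫⁻ w in ball a 1, ENNReal.ofReal (‖γ u - a‖ ^ (-(1 / 2) : ℝ)) * (2 *
              (ENNReal.ofReal (‖w - a‖ ^ (-(7 / 4) : ℝ)) +
                ENNReal.ofReal (‖w - γ u‖ ^ (-(7 / 4) : ℝ)))) := by
            refine lintegral_mono_ae ?_
            have hne : ∀ᵐ w : ℂ ∂(volume.restrict (ball a 1)), w ∉ ({a, γ u} : Set ℂ) :=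
              ae_restrict_of_ae (measure_eq_zero_iff_ae_notMem.1
                ((toFinite ({a, γ u} : Set ℂ)).measure_zero volume))
            filter_upwards [hne] with w hw
            rw [mem_insert_iff, mem_singleton_iff, not_or] at hw
            have h1 := rpow_mul_inv_le (norm_pos_iff.2 (sub_ne_zero.2 hw.1))
              (norm_pos_iff.2 (sub_ne_zero.2 hw.2)) (norm_pos_iff.2 (sub_ne_zero.2 hu)) (by
                rw [add_comm, norm_sub_rev w (γ u)]
                exact norm_sub_le_norm_sub_add_norm_sub _ _ _)
            rw [norm_sub_rev (γ u) w]
            refine (ENNReal.ofReal_le_ofReal h1).trans_eq ?_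
            rw [← ENNReal.ofReal_add (by positivity) (by positivity),
              show (2 : ENNReal) = ENNReal.ofReal 2 by simp,
              ← ENNReal.ofReal_mul (by positivity), ← ENNReal.ofReal_mul (by positivity)]
            congr 1; ring
        _ ≤ _ := by
            rw [lintegral_const_mul' _ _ ENNReal.ofReal_ne_top,
              lintegral_const_mul' _ _ (by simp), lintegral_add_left (by fun_prop)]
            gcongr
            · exact hCb a a
            · exact hCb a (γ u)
    refine ne_top_of_le_ne_top ?_ hle
    rw [lintegral_mul_const' _ _ (by finiteness)]
    exact ENNReal.mul_ne_top (hγ.integrableOn_rpow a).lintegral_lt_top.ne (by finiteness)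
  · refine AEMeasurable.ennreal_ofReal (AEMeasurable.mul ?_ ?_)
    · exact (by fun_prop : Measurable fun p : ℂ × ℝ => ‖p.1 - a‖ ^ (-(5 / 4) : ℝ)).aemeasurable
    · exact (((hγm.comp_snd (μ := volume.restrict (ball a 1))).sub
        measurable_fst.aemeasurable).norm).inv

end Nodes

/-- A holomorphic function that is bounded near `a`, off a null set, by `|w - a|` times an
integrable function has at most a removable singularity there; here its growth is bounded by means of the
mean value inequality on the disc of radius `|z - a| / 2` around `z`. -/
theorem isLittleO_of_enorm_le {G : ℂ → ℂ} {J : Set ℂ} (hJ : volume J = 0) {a : ℂ} {δ : ℝ}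
    (hδ : 0 < δ) (hG : DifferentiableOn ℂ G (ball a δ \ {a})) {Θ : ℂ → ENNReal}
    (hΘ : ∫⁻ w in ball a 1, Θ w ≠ ⊤)
    (hb : ∀ w ∈ ball a δ, w ∉ J → ‖G w‖ₑ ≤ ENNReal.ofReal ‖w - a‖ * Θ w) :
    G =o[𝓝[≠] a] fun z => (z - a)⁻¹ := by
  refine Asymptotics.isLittleO_iff.2 fun ε hε => ?_
  have hvol : Tendsto (fun ρ : ℝ => volume.restrict (ball a 1) (ball a ρ)) (𝓝 0) (𝓝 0) := by
    refine tendsto_of_tendsto_of_tendsto_of_le_of_le tendsto_const_nhds (h := fun ρ =>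
      ENNReal.ofReal ρ ^ 2 * NNReal.pi) ?_ (fun _ => zero_le)
      (fun ρ => (Measure.restrict_apply_le _ _).trans_eq (Complex.volume_ball a ρ))
    have : Continuous fun ρ : ℝ => ENNReal.ofReal ρ ^ 2 * (NNReal.pi : ENNReal) := by
      refine (ENNReal.continuous_mul_const ENNReal.coe_ne_top).comp ?_
      exact (ENNReal.continuous_pow 2).comp ENNReal.continuous_ofReal
    simpa using this.tendsto 0
  -- the integral of `Θ` over small discs is small
  have h1 := tendsto_setLIntegral_zero hΘ hvol
  have h2 : Tendsto (fun z : ℂ => 3 * (‖z - a‖ / 2)) (𝓝[≠] a) (𝓝 0) := by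
    have : Continuous fun z : ℂ => 3 * (‖z - a‖ / 2) := by fun_prop
    simpa using (this.tendsto a).mono_left nhdsWithin_le_nhds
  have hε' : (0 : ENNReal) < ENNReal.ofReal (ε / 6) := by
    rw [ENNReal.ofReal_pos]; positivity
  filter_upwards [h2.eventually (h1.eventually_lt_const hε'), self_mem_nhdsWithin,
    h2.eventually_lt_const hδ, h2.eventually_lt_const one_pos] with z hz hza hzδ hz1
  have hza' : 0 < ‖z - a‖ := norm_pos_iff.2 (sub_ne_zero.2 hza)
  set r := ‖z - a‖ / 2 with hr
  have hr0 : 0 < r := by positivity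
  have hsub : ball z r ⊆ ball a (3 * r) := by
    refine ball_subset_ball' ?_
    rw [dist_eq_norm, show ‖z - a‖ = 2 * r by rw [hr]; ring]
    linarith
  have hna : a ∉ ball z r := by
    rw [mem_ball, dist_comm, dist_eq_norm]
    linarith
  have h3 := enorm_mul_sq_le_lintegral_ball hr0 (hG.mono fun w hw =>
    ⟨ball_subset_ball hzδ.le (hsub hw), fun h => hna (mem_singleton_iff.1 h ▸ hw)⟩)
  have h4 : ∫⁻ w in ball z r, ‖G w‖ₑ ≤ ENNReal.ofReal (3 * r) * ENNReal.ofReal (ε / 6) := by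
    calc ∫⁻ w in ball z r, ‖G w‖ₑ ≤ ∫⁻ w in ball z r, ENNReal.ofReal (3 * r) * Θ w := by
          refine lintegral_mono_ae ?_
          filter_upwards [ae_restrict_mem measurableSet_ball,
            ae_restrict_of_ae (measure_eq_zero_iff_ae_notMem.1 hJ)] with w hw hwJ
          have hw' := hsub hw
          refine (hb w (ball_subset_ball hzδ.le hw') hwJ).trans (mul_le_mul' ?_ le_rfl)
          rw [mem_ball, dist_eq_norm] at hw'
          exact ENNReal.ofReal_le_ofReal hw'.le
      _ = ENNReal.ofReal (3 * r) * ∫⁻ w in ball z r, Θ w :=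
          lintegral_const_mul' _ _ ENNReal.ofReal_ne_top
      _ ≤ _ := by
          refine mul_le_mul' le_rfl (le_trans ?_ hz.le)
          rw [Measure.restrict_restrict measurableSet_ball,
            inter_eq_left.2 (ball_subset_ball hz1.le)]
          exact lintegral_mono_set hsub
  have h5 := h3.trans h4
  rw [← ofReal_norm, ← ENNReal.ofReal_mul (by positivity),
    ← ENNReal.ofReal_mul (by positivity), ENNReal.ofReal_le_ofReal_iff (by positivity)] at h5
  rw [norm_inv, ← div_eq_mul_inv, le_div_iff₀ hza', show ‖z - a‖ = 2 * r by rw [hr]; ring]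
  have h6 : r * (‖G z‖ * (2 * r)) ≤ r * ε := by nlinarith
  exact le_of_mul_le_mul_left h6 hr0

/-! ### The inverse of the solution of the Riemann--Hilbert problem -/

section Inverse
variable {N : ℕ} {γ : ℝ → ℂ} {B : Finset ℝ} {EL ER FL : ℂ → Fin N → ℂ}
  {χ : ℂ → Matrix (Fin N) (Fin N) ℂ}

theorem tendsto_norm_sub_nhdsGT {J : Set ℂ} {a : ℂ} (ha : a ∈ J) :
    Tendsto (fun w => ‖w - a‖) (𝓝[Jᶜ] a) (𝓝[>] 0) := by
  refine tendsto_nhdsWithin_iff.2 ⟨?_, ?_⟩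
  · have : Continuous fun w : ℂ => ‖w - a‖ := by fun_prop
    simpa using (this.tendsto a).mono_left nhdsWithin_le_nhds
  · filter_upwards [self_mem_nhdsWithin] with w hw
    exact norm_pos_iff.2 (sub_ne_zero.2 fun h => hw (h ▸ ha))

/-- The entries of the solution have at most weak singularities on the curve. -/
theorem SolvesRHP.isBigO_rpow (hχ : SolvesRHP γ B EL ER χ) {a : ℂ} (ha : a ∈ support γ)
    (i j : Fin N) :
    (fun w => χ w i j) =O[𝓝[(support γ)ᶜ] a] fun w => ‖w - a‖ ^ (-(1 / 4) : ℝ) := by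
  have ht := tendsto_norm_sub_nhdsGT ha
  by_cases hend : a ∈ endPoints γ
  · exact (hχ.atEndPoints a hend i j).trans
      ((isLittleO_log_rpow_nhdsGT_zero (by norm_num)).isBigO.comp_tendsto ht)
  · obtain ⟨χp, χm, ⟨-, -, L, R, hLR, hlim⟩, -⟩ := hχ.jump
    have hs : a ∈ openArc γ := ⟨ha, hend⟩
    have h1 : (fun w => χ w i j) =O[𝓝[L ∪ R] a] fun _ => (1 : ℝ) := by
      rw [nhdsWithin_union, Asymptotics.isBigO_sup]
      exact ⟨(tendsto_pi_nhds.1 (tendsto_pi_nhds.1 (hlim a hs).1 i) j).isBigO_one ℝ,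
        (tendsto_pi_nhds.1 (tendsto_pi_nhds.1 (hlim a hs).2 i) j).isBigO_one ℝ⟩
    have h2 : 𝓝[(support γ)ᶜ] a ≤ 𝓝[L ∪ R] a := by
      refine le_inf inf_le_left (le_principal_iff.2 ?_)
      filter_upwards [nhdsWithin_le_nhds (hLR.cover a hs), self_mem_nhdsWithin] with w hw hw'
        using hw.resolve_right hw'
    refine (h1.mono h2).trans (Asymptotics.IsBigO.of_bound 1 ?_)
    filter_upwards [ht.eventually (Ioo_mem_nhdsGT one_pos)] with w hw
    rw [norm_one, one_mul, Real.norm_of_nonneg (Real.rpow_nonneg hw.1.le _)]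
    exact Real.one_le_rpow_of_pos_of_le_one_of_nonpos hw.1 hw.2.le (by norm_num)

/-- The entries of the Cauchy integral are dominated by the potential of the curve. -/
theorem exists_enorm_cauchyInverse_le (hγ : IsPiecewiseSmoothCurve γ B)
    (hER : ContinuousOn (fun t => ER (γ t)) (Icc 0 1))
    (hFL : ContinuousOn FL (support γ)) : ∃ M : ℝ, ∀ z j k,
      ‖cauchyInverse γ ER FL z j k‖ₑ ≤
        1 + ENNReal.ofReal M * ∫⁻ u in Icc (0 : ℝ) 1, ENNReal.ofReal ‖γ u - z‖⁻¹ := by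
  obtain ⟨M₁, hM₁⟩ := isCompact_Icc.exists_bound_of_continuousOn
    (hFL.comp hγ.smooth.1 fun u hu => ⟨u, hu, rfl⟩)
  obtain ⟨M₂, hM₂⟩ := isCompact_Icc.exists_bound_of_continuousOn hER
  obtain ⟨M₃, F, hM₃⟩ := hγ.smooth.exists_bound_deriv (by exact_mod_cast le_top)
  refine ⟨M₁ * M₃ * M₂, fun z j k => ?_⟩
  refine (enorm_add_le _ _).trans (add_le_add ?_ ?_)
  · rw [Matrix.one_apply]
    split_ifs <;> simp
  · unfold cauchyTransform
    rw [intervalIntegral.integral_of_le zero_le_one, integral_Ioc_eq_integral_Ioo,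
      ← lintegral_const_mul' _ _ ENNReal.ofReal_ne_top]
    refine (enorm_integral_le_lintegral_enorm _).trans ?_
    refine le_trans ?_ (lintegral_mono_set Ioo_subset_Icc_self)
    refine lintegral_mono_ae ?_
    have hF : ∀ᵐ w ∂(volume.restrict (Ioo (0 : ℝ) 1)), w ∉ F :=
      ae_restrict_of_ae (measure_eq_zero_iff_ae_notMem.1 (F.finite_toSet.measure_zero _))
    filter_upwards [ae_restrict_mem measurableSet_Ioo, hF] with u hu huF
    have hu' := Ioo_subset_Icc_self hu
    have h1 := (norm_le_pi_norm _ k).trans (hM₁ u hu')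
    have h2 := (norm_le_pi_norm _ j).trans (hM₂ u hu')
    have h3 := hM₃ u hu huF
    have h1' := (norm_nonneg _).trans h1
    have h3' := (norm_nonneg _).trans h3
    rw [← ofReal_norm, norm_div, norm_mul, norm_mul, div_eq_mul_inv]
    have h4 : ‖FL (γ u) k‖ * ‖deriv γ u‖ * ‖ER (γ u) j‖ ≤ M₁ * M₃ * M₂ :=
      mul_le_mul (mul_le_mul h1 h3 (norm_nonneg _) h1') h2 (norm_nonneg _) (by positivity)
    rw [← ENNReal.ofReal_mul ((by positivity : (0 : ℝ) ≤ _).trans h4)]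
    exact ENNReal.ofReal_le_ofReal (mul_le_mul_of_nonneg_right h4 (by positivity))

/-- The entries of the product are dominated, near each point of the curve, by the distance times
an integrable function. -/
theorem exists_enorm_mul_cauchyInverse_le (hγ : IsPiecewiseSmoothCurve γ B)
    (hER : ContinuousOn (fun t => ER (γ t)) (Icc 0 1))
    (hχ : SolvesRHP γ B EL ER χ) (hFL : IsLeftSolution γ EL ER FL) {a : ℂ} (ha : a ∈ support γ)
    (i k : Fin N) : ∃ δ > 0, ∃ Θ : ℂ → ENNReal, ∫⁻ w in ball a 1, Θ w ≠ ⊤ ∧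
      ∀ w ∈ ball a δ, w ∉ support γ →
        ‖(χ w * cauchyInverse γ ER FL w) i k‖ₑ ≤ ENNReal.ofReal ‖w - a‖ * Θ w := by
  obtain ⟨M, hM⟩ := exists_enorm_cauchyInverse_le hγ hER hFL.continuousOn
  have hbig := fun j => (hχ.isBigO_rpow ha i j).exists_nonneg
  choose C hC hCb using hbig
  have hev : ∀ᶠ w in 𝓝[(support γ)ᶜ] a, ∀ j,
      ‖χ w i j‖ ≤ C j * ‖‖w - a‖ ^ (-(1 / 4) : ℝ)‖ := eventually_all.2 fun j => (hCb j).bound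
  obtain ⟨δ, hδ, hball⟩ := Metric.eventually_nhds_iff_ball.1 (eventually_nhdsWithin_iff.1 hev)
  refine ⟨δ, hδ, fun w => ENNReal.ofReal (∑ j, C j) * (ENNReal.ofReal (‖w - a‖ ^ (-(5 / 4) : ℝ)) *
    (1 + ENNReal.ofReal M * ∫⁻ u in Icc (0 : ℝ) 1, ENNReal.ofReal ‖γ u - w‖⁻¹)), ?_, ?_⟩
  · rw [lintegral_const_mul' _ _ ENNReal.ofReal_ne_top]
    refine ENNReal.mul_ne_top ENNReal.ofReal_ne_top ?_
    simp only [mul_add, mul_one]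
    rw [lintegral_add_left (by fun_prop)]
    refine ENNReal.add_ne_top.2 ⟨?_, ?_⟩
    · obtain ⟨C', hC', hC'b⟩ := exists_lintegral_ball_rpow_le (α := 5 / 4) (by norm_num)
        (by norm_num)
      exact ne_top_of_le_ne_top hC' (hC'b a a)
    · have e1 : ∀ w : ℂ, ENNReal.ofReal (‖w - a‖ ^ (-(5 / 4) : ℝ)) * (ENNReal.ofReal M *
          ∫⁻ u in Icc (0 : ℝ) 1, ENNReal.ofReal ‖γ u - w‖⁻¹) = ENNReal.ofReal M *
          ∫⁻ u in Icc (0 : ℝ) 1, ENNReal.ofReal (‖w - a‖ ^ (-(5 / 4) : ℝ) * ‖γ u - w‖⁻¹) := by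
        intro w
        rw [mul_left_comm, ← lintegral_const_mul' _ _ ENNReal.ofReal_ne_top]
        congr 2; ext u
        rw [ENNReal.ofReal_mul (by positivity)]
      simp only [e1]
      rw [lintegral_const_mul' _ _ ENNReal.ofReal_ne_top]
      exact ENNReal.mul_ne_top ENNReal.ofReal_ne_top (hγ.lintegral_potential_ne_top a)
  · intro w hw hwJ
    have hwa : 0 < ‖w - a‖ := norm_pos_iff.2 (sub_ne_zero.2 fun h => hwJ (h ▸ ha))
    set P := 1 + ENNReal.ofReal M * ∫⁻ u in Icc (0 : ℝ) 1, ENNReal.ofReal ‖γ u - w‖⁻¹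
    have e2 : ‖w - a‖ ^ (-(1 / 4) : ℝ) = ‖w - a‖ * ‖w - a‖ ^ (-(5 / 4) : ℝ) := by
      conv_rhs => rw [← Real.rpow_one_add' hwa.le (by norm_num)]
      norm_num
    rw [Matrix.mul_apply]
    calc ‖∑ j, χ w i j * cauchyInverse γ ER FL w j k‖ₑ
        ≤ ∑ j, ‖χ w i j * cauchyInverse γ ER FL w j k‖ₑ := enorm_sum_le _ _
      _ ≤ ∑ j, ENNReal.ofReal (C j * ‖w - a‖ ^ (-(1 / 4) : ℝ)) * P := by
          refine Finset.sum_le_sum fun j _ => ?_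
          rw [enorm_mul]
          refine mul_le_mul' ?_ (hM w j k)
          rw [← ofReal_norm]
          refine ENNReal.ofReal_le_ofReal ((hball w hw hwJ j).trans_eq ?_)
          rw [Real.norm_of_nonneg (Real.rpow_nonneg hwa.le _)]
      _ = _ := by
          rw [← Finset.sum_mul, ← ENNReal.ofReal_sum_of_nonneg fun j _ => mul_nonneg (hC j)
            (Real.rpow_nonneg hwa.le _), ← Finset.sum_mul, e2,
            ENNReal.ofReal_mul (Finset.sum_nonneg fun j _ => hC j), ENNReal.ofReal_mul hwa.le]
          ring

theorem differentiableOn_cauchyInverse (hγ : IsPiecewiseSmoothCurve γ B)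
    (hER : ContinuousOn (fun t => ER (γ t)) (Icc 0 1))
    (hFL : ContinuousOn FL (support γ)) (j k : Fin N) :
    DifferentiableOn ℂ (fun z => cauchyInverse γ ER FL z j k) (support γ)ᶜ :=
  (differentiableOn_const _).add (differentiableOn_cauchyTransform zero_le_one hγ.smooth.1
    (intervalIntegrable_density hγ ((continuous_apply k).comp_continuousOn
      (hFL.comp hγ.smooth.1 fun u hu => ⟨u, hu, rfl⟩))
      ((continuous_apply j).comp_continuousOn hER)))

theorem tendsto_cauchyInverse (hγ : IsPiecewiseSmoothCurve γ B)
    (hER : ContinuousOn (fun t => ER (γ t)) (Icc 0 1))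
    (hFL : ContinuousOn FL (support γ)) (j k : Fin N) :
    Tendsto (fun z => cauchyInverse γ ER FL z j k) (cocompact ℂ)
      (𝓝 ((1 : Matrix (Fin N) (Fin N) ℂ) j k)) := by
  have h := tendsto_cauchyTransform_cocompact zero_le_one hγ.smooth.1
    (intervalIntegrable_density hγ ((continuous_apply k).comp_continuousOn
      (hFL.comp hγ.smooth.1 fun u hu => ⟨u, hu, rfl⟩))
      ((continuous_apply j).comp_continuousOn hER))
  have h1 := h.const_add ((1 : Matrix (Fin N) (Fin N) ℂ) j k)
  rwa [add_zero] at h1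

theorem SolvesRHP.tendsto (hχ : SolvesRHP γ B EL ER χ) (i j : Fin N) :
    Tendsto (fun z => χ z i j) (cocompact ℂ) (𝓝 ((1 : Matrix (Fin N) (Fin N) ℂ) i j)) := by
  rw [← Metric.cobounded_eq_cocompact]
  have h := (hχ.atInfinity i j).trans_tendsto tendsto_inv₀_cobounded
  simpa using h.add_const ((1 : Matrix (Fin N) (Fin N) ℂ) i j)

/-- The solution of the Riemann--Hilbert problem is inverted by `1 + ∫ E_R F_Lᵀ / (s - z) ds`: the
product extends to an entire function that tends to one at infinity. -/
theorem mul_cauchyInverse_eq_one (hγ : IsPiecewiseSmoothCurve γ B)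
    (hEL : PiecewiseContDiff ((⊤ : ℕ∞) : WithTop ℕ∞) (fun t => EL (γ t)) B)
    (hER : PiecewiseContDiff ((⊤ : ℕ∞) : WithTop ℕ∞) (fun t => ER (γ t)) B)
    (horth : ∀ x ∈ support γ, dotProduct (EL x) (ER x) = 0)
    (hχ : SolvesRHP γ B EL ER χ) (hFL : IsLeftSolution γ EL ER FL) {z : ℂ}
    (hz : z ∉ support γ) : χ z * cauchyInverse γ ER FL z = 1 := by
  ext i k
  set H : ℂ → ℂ := fun w => (χ w * cauchyInverse γ ER FL w) i k with hH
  have hHsum : H = fun w => ∑ j, χ w i j * cauchyInverse γ ER FL w j k := by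
    ext w; rw [hH]; simp only [Matrix.mul_apply]
  have hnull := hγ.smooth.volume_support (by simp)
  have hdense : Dense (support γ)ᶜ :=
    Measure.dense_of_ae (measure_eq_zero_iff_ae_notMem.1 hnull)
  have hclosed := hγ.isClosed_support
  have hHd : DifferentiableOn ℂ H (support γ)ᶜ := by
    rw [hHsum]
    exact DifferentiableOn.fun_sum fun j _ => (hχ.holomorphic i j).mul
      (differentiableOn_cauchyInverse hγ hER.1 hFL.continuousOn j k)
  have hnodes : nodes γ B ⊆ support γ := image_mono sdiff_subset
  -- extension across the regular points
  obtain ⟨G, hGd, hG⟩ : ∃ G : ℂ → ℂ, DifferentiableOn ℂ G (nodes γ B)ᶜ ∧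
      ∀ w ∈ (nodes γ B)ᶜ, w ∉ support γ → G w = H w := by
    refine exists_differentiableOn_of_local hdense fun w hw => ?_
    by_cases hwJ : w ∈ support γ
    · obtain ⟨t, ht, rfl⟩ := hwJ
      have ht' : t ∈ Ioo (0 : ℝ) 1 \ B := by
        by_contra h
        exact hw ⟨t, ⟨ht, h⟩, rfl⟩
      exact exists_extension_of_regular hγ hEL hER horth hχ hFL ht' i k
    · obtain ⟨r, hr, hball⟩ := Metric.isOpen_iff.1 hclosed.isOpen_compl w hwJ
      exact ⟨r, hr, H, hHd.mono hball, fun _ _ _ => rfl⟩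
  have hopen : IsOpen (nodes γ B)ᶜ := (nodes_finite γ B).isClosed.isOpen_compl
  -- extension across the nodes
  obtain ⟨G', hGd', hG'⟩ : ∃ G' : ℂ → ℂ, DifferentiableOn ℂ G' univ ∧
      ∀ w ∈ univ, w ∉ support γ → G' w = H w := by
    refine exists_differentiableOn_of_local hdense fun a _ => ?_
    by_cases haS : a ∈ nodes γ B
    · have haJ := hnodes haS
      obtain ⟨δ, hδ, Θ, hΘ, hb⟩ := exists_enorm_mul_cauchyInverse_le hγ hER.1 hχ hFL haJ i k
      have hS' : (nodes γ B \ {a})ᶜ ∈ 𝓝 a :=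
        ((nodes_finite γ B).subset sdiff_subset).isClosed.isOpen_compl.mem_nhds
          fun h => h.2 rfl
      obtain ⟨δ', hδ', hball⟩ := Metric.mem_nhds_iff.1 hS'
      set r := min δ δ'
      have hr : 0 < r := lt_min hδ hδ'
      have hsub : ball a r \ {a} ⊆ (nodes γ B)ᶜ := fun w hw hwS =>
        hball (ball_subset_ball (min_le_right _ _) hw.1) ⟨hwS, hw.2⟩
      have hlit := isLittleO_of_enorm_le hnull hr (hGd.mono hsub) hΘ fun w hw hwJ => by
        rw [hG w (fun h => hwJ (hnodes h)) hwJ]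
        exact hb w (ball_subset_ball (min_le_left _ _) hw) hwJ
      have hinv : Tendsto (fun z => ‖(z - a)⁻¹‖) (𝓝[≠] a) atTop := by
        have h1 : Tendsto (fun z => z - a) (𝓝[≠] a) (𝓝[≠] 0) := by
          refine tendsto_nhdsWithin_iff.2 ⟨?_, ?_⟩
          · have : Continuous fun w : ℂ => w - a := by fun_prop
            simpa using (this.tendsto a).mono_left nhdsWithin_le_nhds
          · filter_upwards [self_mem_nhdsWithin] with w hw using sub_ne_zero.2 hw
        exact tendsto_norm_cobounded_atTop.comp (tendsto_inv₀_nhdsNE_zero.comp h1)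
      have hlit' : (fun z => G z - G a) =o[𝓝[≠] a] fun z => (z - a)⁻¹ :=
        hlit.sub (Asymptotics.isLittleO_const_left.2 (Or.inr hinv))
      refine ⟨r, hr, _, Complex.differentiableOn_update_limUnder_of_isLittleO
        (ball_mem_nhds a hr) (hGd.mono hsub) hlit', fun w hw hwJ => ?_⟩
      have hwa : w ≠ a := fun h => hwJ (h ▸ haJ)
      rw [Function.update_of_ne hwa, hG w (fun h => hwJ (hnodes h)) hwJ]
    · obtain ⟨r, hr, hball⟩ := Metric.isOpen_iff.1 hopen a haS
      exact ⟨r, hr, G, hGd.mono hball, fun w hw hwJ => (hG w (hball hw) hwJ).symm⟩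
  have hlim : Tendsto G' (cocompact ℂ) (𝓝 ((1 : Matrix (Fin N) (Fin N) ℂ) i k)) := by
    have h1 : Tendsto H (cocompact ℂ) (𝓝 (∑ j, (1 : Matrix (Fin N) (Fin N) ℂ) i j *
        (1 : Matrix (Fin N) (Fin N) ℂ) j k)) := by
      rw [hHsum]
      exact tendsto_finsetSum _ fun j _ => (hχ.tendsto i j).mul
        (tendsto_cauchyInverse hγ hER.1 hFL.continuousOn j k)
    rw [← Matrix.mul_apply, one_mul] at h1
    refine h1.congr' ?_
    filter_upwards [(isCompact_Icc.image_of_continuousOn hγ.smooth.1).compl_mem_cocompact]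
      with w hw using (hG' w (mem_univ w) hw).symm
  rw [show (χ z * cauchyInverse γ ER FL z) i k = G' z from (hG' z (mem_univ z) hz).symm]
  exact (differentiableOn_univ.1 hGd').apply_eq_of_tendsto_cocompact z hlim

end Inverse

/-! ### Moving the integrals from the loop to the curve -/

theorem integrableOn_prod_pi {n : ℕ} {α : Fin n → ℝ → ℂ}
    (hα : ∀ i, IntegrableOn (α i) (Icc 0 1)) :
    IntegrableOn (fun t : Fin n → ℝ => ∏ i, α i (t i)) (Icc 0 1) := by
  have h : (Icc 0 1 : Set (Fin n → ℝ)) = univ.pi fun _ => Icc (0 : ℝ) 1 :=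
    (pi_univ_Icc 0 1).symm
  rw [IntegrableOn, h, volume_pi, Measure.restrict_pi_pi]
  exact Integrable.fintype_prod hα

/-- Separation of the first variable in an integral over the unit cube. -/
theorem setIntegral_Icc_succ {n : ℕ} (f : (Fin (n + 1) → ℝ) → ℂ) :
    ∫ t in Icc (0 : Fin (n + 1) → ℝ) 1, f t =
      ∫ p in Icc (0 : ℝ) 1 ×ˢ Icc (0 : Fin n → ℝ) 1, f (Fin.cons p.1 p.2) := by
  have h := (volume_preserving_piFinSuccAbove (fun _ : Fin (n + 1) => ℝ) 0).symm
  have e1 : ∀ p : ℝ × (Fin n → ℝ),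
      (MeasurableEquiv.piFinSuccAbove (fun _ : Fin (n + 1) => ℝ) 0).symm p = Fin.cons p.1 p.2 := by
    intro p
    rw [MeasurableEquiv.piFinSuccAbove_symm_apply]
    simp [Fin.insertNthEquiv]
  have e2 : (MeasurableEquiv.piFinSuccAbove (fun _ : Fin (n + 1) => ℝ) 0).symm ⁻¹' Icc 0 1 =
      Icc (0 : ℝ) 1 ×ˢ Icc (0 : Fin n → ℝ) 1 := by
    ext p
    simp only [mem_preimage, e1, mem_Icc, mem_prod, Pi.le_def, Fin.forall_fin_succ, Fin.cons_zero,
      Fin.cons_succ, Pi.zero_apply, Pi.one_apply]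
    tauto
  rw [← h.setIntegral_preimage_emb (MeasurableEquiv.measurableEmbedding _), e2]
  simp only [e1]

/-- A contour can be moved in each variable of a multiple integral, as soon as this is allowed for
functions of one variable that are holomorphic near the set `V`. -/
theorem setIntegral_pi_contour {Γ γ : ℝ → ℂ} {V : Set ℂ} (hΓ : ContinuousOn Γ (Icc 0 1))
    (hγ : ContinuousOn γ (Icc 0 1)) (hΓV : MapsTo Γ (Icc 0 1) V) (hγV : MapsTo γ (Icc 0 1) V)
    {n : ℕ} {α β : Fin n → ℝ → ℂ} (hα : ∀ i, IntegrableOn (α i) (Icc 0 1))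
    (hβ : ∀ i, IntegrableOn (β i) (Icc 0 1))
    (hαβ : ∀ i, ∀ f : ℂ → ℂ, (∃ U, IsOpen U ∧ V ⊆ U ∧ DifferentiableOn ℂ f U) →
      ∫ t in Icc 0 1, f (Γ t) * α i t = ∫ t in Icc 0 1, f (γ t) * β i t)
    {F : (Fin n → ℂ) → ℂ} (hF : ContinuousOn F {z | ∀ i, z i ∈ V})
    (hFd : ∀ z : Fin n → ℂ, (∀ i, z i ∈ V) → ∀ i, ∃ U, IsOpen U ∧ V ⊆ U ∧
      DifferentiableOn ℂ (fun x => F (Function.update z i x)) U) :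
    ∫ t in Icc (0 : Fin n → ℝ) 1, F (fun i => Γ (t i)) * ∏ i, α i (t i) =
      ∫ t in Icc (0 : Fin n → ℝ) 1, F (fun i => γ (t i)) * ∏ i, β i (t i) := by
  induction n with
  | zero =>
    simp only [Finset.univ_eq_empty, Finset.prod_empty]
    congr 1; ext t
    congr 2; ext i
    exact i.elim0
  | succ n ih =>
    have hcoord : ∀ i, MapsTo (fun t : Fin n → ℝ => t i) (Icc 0 1) (Icc 0 1) := fun i t ht =>
      ⟨ht.1 i, ht.2 i⟩
    -- the integrands are integrable for any choice of the contours
    have hint : ∀ {c c' : ℝ → ℂ} {a : ℝ → ℂ} {b : Fin n → ℝ → ℂ}, ContinuousOn c (Icc 0 1) →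
        ContinuousOn c' (Icc 0 1) → MapsTo c (Icc 0 1) V → MapsTo c' (Icc 0 1) V →
        IntegrableOn a (Icc 0 1) → (∀ i, IntegrableOn (b i) (Icc 0 1)) →
        IntegrableOn (fun p : ℝ × (Fin n → ℝ) => F (Fin.cons (c p.1) fun i => c' (p.2 i)) *
          (a p.1 * ∏ i, b i (p.2 i))) (Icc (0 : ℝ) 1 ×ˢ Icc (0 : Fin n → ℝ) 1) := by
      intro c c' a b hc hc' hcV hcV' ha hb
      refine IntegrableOn.continuousOn_mul (g := fun p : ℝ × (Fin n → ℝ) =>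
        F (Fin.cons (c p.1) fun i => c' (p.2 i))) ?_ ?_ (isCompact_Icc.prod isCompact_Icc)
      · refine hF.comp (continuousOn_pi.2 fun i => ?_) fun p hp i => ?_
        · refine Fin.cases ?_ (fun j => ?_) i
          · simp only [Fin.cons_zero]
            exact hc.comp continuousOn_fst fun p hp => hp.1
          · simp only [Fin.cons_succ]
            exact hc'.comp ((continuous_apply j).comp_continuousOn continuousOn_snd)
              fun p hp => hcoord j hp.2
        · refine Fin.cases ?_ (fun j => ?_) i
          · simpa using hcV hp.1
          · simpa using hcV' (hcoord j hp.2)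
      · rw [IntegrableOn, Measure.volume_eq_prod, ← Measure.prod_restrict]
        exact Integrable.mul_prod ha (integrableOn_prod_pi hb)
    have hcons : ∀ (c c' : ℝ → ℂ) (x : ℝ) (t : Fin n → ℝ),
        (fun i => c ((Fin.cons x t : Fin (n + 1) → ℝ) i)) = Fin.cons (c x) fun i => c (t i) := by
      intro c c' x t
      ext i
      refine Fin.cases ?_ (fun j => ?_) i <;> simp
    simp only [setIntegral_Icc_succ, Fin.prod_univ_succ, Fin.cons_zero, Fin.cons_succ,
      hcons Γ γ, hcons γ γ]
    have i1 := hint hΓ hΓ hΓV hΓV (hα 0) fun i => hα i.succ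
    have i2 := hint hΓ hγ hΓV hγV (hα 0) fun i => hβ i.succ
    have i3 := hint hγ hγ hγV hγV (hβ 0) fun i => hβ i.succ
    calc ∫ p in Icc (0 : ℝ) 1 ×ˢ Icc (0 : Fin n → ℝ) 1,
          F (Fin.cons (Γ p.1) fun i => Γ (p.2 i)) * (α 0 p.1 * ∏ i : Fin n, α i.succ (p.2 i))
        = ∫ x in Icc (0 : ℝ) 1, ∫ t in Icc (0 : Fin n → ℝ) 1,
          F (Fin.cons (Γ x) fun i => Γ (t i)) * (α 0 x * ∏ i : Fin n, α i.succ (t i)) :=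
          setIntegral_prod _ i1
      _ = ∫ x in Icc (0 : ℝ) 1, ∫ t in Icc (0 : Fin n → ℝ) 1,
          F (Fin.cons (Γ x) fun i => γ (t i)) * (α 0 x * ∏ i : Fin n, β i.succ (t i)) := by
          refine setIntegral_congr_fun measurableSet_Icc fun x hx => ?_
          simp only [mul_left_comm _ (α 0 x)]
          rw [integral_const_mul, integral_const_mul]
          congr 1
          refine ih (fun i => hα i.succ) (fun i => hβ i.succ) (fun i => hαβ i.succ)
            (F := fun z => F (Fin.cons (Γ x) z)) ?_ ?_
          · refine hF.comp (by fun_prop) fun z hz i => ?_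
            refine Fin.cases ?_ (fun j => ?_) i
            · simpa using hΓV hx
            · simpa using hz j
          · intro z hz i
            have := hFd (Fin.cons (Γ x) z) (fun i => by
              refine Fin.cases ?_ (fun j => ?_) i
              · simpa using hΓV hx
              · simpa using hz j) i.succ
            simpa only [Fin.cons_update] using this
      _ = ∫ t in Icc (0 : Fin n → ℝ) 1, ∫ x in Icc (0 : ℝ) 1,
          F (Fin.cons (Γ x) fun i => γ (t i)) * (α 0 x * ∏ i : Fin n, β i.succ (t i)) := by
          rw [IntegrableOn, Measure.volume_eq_prod, ← Measure.prod_restrict] at i2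
          exact integral_integral_swap i2
      _ = ∫ t in Icc (0 : Fin n → ℝ) 1, ∫ x in Icc (0 : ℝ) 1,
          F (Fin.cons (γ x) fun i => γ (t i)) * (β 0 x * ∏ i : Fin n, β i.succ (t i)) := by
          refine setIntegral_congr_fun measurableSet_Icc fun t ht => ?_
          simp only [← mul_assoc]
          rw [integral_mul_const, integral_mul_const]
          congr 1
          refine hαβ 0 (fun x => F (Fin.cons x fun i => γ (t i))) ?_
          have := hFd (Fin.cons (γ 0) fun i => γ (t i)) (fun i => by
            refine Fin.cases ?_ (fun j => ?_) i
            · simpa using hγV (left_mem_Icc.2 zero_le_one)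
            · simpa using hγV (hcoord j ht)) 0
          simpa only [Fin.update_cons_zero] using this
      _ = ∫ x in Icc (0 : ℝ) 1, ∫ t in Icc (0 : Fin n → ℝ) 1,
          F (Fin.cons (γ x) fun i => γ (t i)) * (β 0 x * ∏ i : Fin n, β i.succ (t i)) := by
          have i3' := i3
          rw [IntegrableOn, Measure.volume_eq_prod, ← Measure.prod_restrict] at i3'
          exact (integral_integral_swap i3').symm
      _ = _ := (setIntegral_prod _ i3).symm

section Loop
variable {N : ℕ} {γ : ℝ → ℂ} {B : Finset ℝ} {ER FL : ℂ → Fin N → ℂ} {c : Fin N → ℝ}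
  {Γ : ℝ → ℂ} {BΓ : Finset ℝ}

theorem IsSmallLoopAround.support_subset_filled (hΓ : IsSmallLoopAround γ c Γ BΓ) :
    support γ ⊆ filled Γ := fun z hz => Or.inr (by
  change index Γ z ≠ 0
  rw [hΓ.index_eq_one z hz]; exact one_ne_zero)

/-- Against the Cauchy integral of `E_R F_Lᵀ`, integration over the loop becomes integration over
the curve. -/
theorem IsSmallLoopAround.integral_mul_cauchyInverse (hγ : IsPiecewiseSmoothCurve γ B)
    (hER : ContinuousOn (fun t => ER (γ t)) (Icc 0 1)) (hFL : ContinuousOn FL (support γ))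
    (hΓ : IsSmallLoopAround γ c Γ BΓ) (v p : Fin N) {f : ℂ → ℂ} {U : Set ℂ} (hU : IsOpen U)
    (hΓU : filled Γ ⊆ U) (hf : DifferentiableOn ℂ f U) :
    ∫ t in Icc 0 1, f (Γ t) * (cauchyInverse γ ER FL (Γ t) v p * deriv Γ t) =
      ∫ t in Icc 0 1, f (γ t) *
        (-(2 * Real.pi * Complex.I) * (ER (γ t) v * FL (γ t) p) * deriv γ t) := by
  have hcl := hΓ.isClosedCurve
  have hsΓ : support Γ ⊆ U := subset_union_left.trans hΓU
  have hsγ : support γ ⊆ U := hΓ.support_subset_filled.trans hΓU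
  have hmΓ : MapsTo Γ (Icc 0 1) (support Γ) := fun u hu => ⟨u, hu, rfl⟩
  have hmγ : MapsTo γ (Icc 0 1) (support γ) := fun u hu => ⟨u, hu, rfl⟩
  have hind : ∀ z, z ∉ U → index Γ z = 0 := fun z hz => by
    by_contra h
    exact hz (hΓU (Or.inr h))
  have hoff : ∀ z ∈ support γ, z ∉ support Γ := fun z hz hz' =>
    Set.disjoint_left.1 hΓ.disjoint hz' hz
  have hcurve : ∀ (c : ℝ → ℂ) (h : ℂ → ℂ), curveInt c h = ∫ t in Icc 0 1, h (c t) * deriv c t := by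
    intro c h
    rw [curveInt, intervalIntegral.integral_of_le zero_le_one, integral_Icc_eq_integral_Ioc]
  -- Cauchy's theorem
  have h0 : ∫ t in Icc 0 1, f (Γ t) * deriv Γ t = 0 := by
    have hs₀ := hmγ (left_mem_Icc.2 zero_le_one)
    have h := hcl.curveInt_div_sub hU hsΓ hind (f := fun w => f w * (w - γ 0))
      (hf.mul (differentiableOn_id.sub_const _)) (hsγ hs₀) (hoff _ hs₀)
    rw [sub_self, mul_zero, mul_zero, hcurve] at h
    rw [← h]
    refine setIntegral_congr_fun measurableSet_Icc fun t ht => ?_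
    have : Γ t - γ 0 ≠ 0 := sub_ne_zero.2 fun h => hoff _ hs₀ (h ▸ hmΓ ht)
    rw [mul_div_cancel_right₀ _ this]
  -- Cauchy's formula
  have h1 : ∀ u ∈ Icc (0 : ℝ) 1, ∫ t in Icc 0 1, f (Γ t) * deriv Γ t / (γ u - Γ t) =
      -(2 * Real.pi * Complex.I) * f (γ u) := by
    intro u hu
    have h := hcl.curveInt_div_sub hU hsΓ hind hf (hsγ (hmγ hu)) (hoff _ (hmγ hu))
    rw [hΓ.index_eq_one _ (hmγ hu), mul_one, hcurve] at h
    rw [neg_mul, ← h, ← integral_neg]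
    refine setIntegral_congr_fun measurableSet_Icc fun t ht => ?_
    rw [← neg_sub (Γ t) (γ u), div_neg]
    ring
  set ρ : ℝ → ℂ := fun u => FL (γ u) p * deriv γ u * ER (γ u) v with hρ
  have hρi : IntegrableOn ρ (Icc 0 1) :=
    (intervalIntegrable_iff_integrableOn_Icc_of_le zero_le_one).1 (intervalIntegrable_density hγ
      ((continuous_apply p).comp_continuousOn (hFL.comp hγ.smooth.1 hmγ))
      ((continuous_apply v).comp_continuousOn hER))
  have hfi : IntegrableOn (fun t => f (Γ t) * deriv Γ t) (Icc 0 1) :=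
    IntegrableOn.continuousOn_mul (hf.continuousOn.comp hcl.continuousOn fun t ht => hsΓ (hmΓ ht))
      ((intervalIntegrable_iff_integrableOn_Icc_of_le zero_le_one).1 hcl.integrable) isCompact_Icc
  have hprod : IntegrableOn (fun q : ℝ × ℝ => (γ q.2 - Γ q.1)⁻¹ *
      ((f (Γ q.1) * deriv Γ q.1) * ρ q.2)) (Icc 0 1 ×ˢ Icc 0 1) := by
    refine IntegrableOn.continuousOn_mul (g := fun q : ℝ × ℝ => (γ q.2 - Γ q.1)⁻¹) ?_ ?_
      (isCompact_Icc.prod isCompact_Icc)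
    · refine ((hγ.smooth.1.comp continuousOn_snd fun q hq => hq.2).sub
        (hcl.continuousOn.comp continuousOn_fst fun q hq => hq.1)).inv₀ fun q hq => ?_
      exact sub_ne_zero.2 fun h : γ q.2 = Γ q.1 => hoff _ (hmγ hq.2) (h ▸ hmΓ hq.1)
    · rw [IntegrableOn, Measure.volume_eq_prod, ← Measure.prod_restrict]
      exact Integrable.mul_prod hfi hρi
  rw [IntegrableOn, Measure.volume_eq_prod, ← Measure.prod_restrict] at hprod
  have hΨ : ∀ t, f (Γ t) * (cauchyInverse γ ER FL (Γ t) v p * deriv Γ t) =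
      (1 : Matrix (Fin N) (Fin N) ℂ) v p * (f (Γ t) * deriv Γ t) +
      ∫ u in Icc 0 1, (γ u - Γ t)⁻¹ * ((f (Γ t) * deriv Γ t) * ρ u) := by
    intro t
    have e : ∫ u in Icc 0 1, (γ u - Γ t)⁻¹ * ((f (Γ t) * deriv Γ t) * ρ u) =
        (f (Γ t) * deriv Γ t) * cauchyTransform γ ρ 0 1 (Γ t) := by
      rw [cauchyTransform, intervalIntegral.integral_of_le zero_le_one,
        ← integral_Icc_eq_integral_Ioc, ← integral_const_mul]
      congr 1; ext u
      rw [div_eq_mul_inv]; ring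
    rw [e, cauchyInverse, Matrix.of_apply]
    ring
  simp only [hΨ]
  rw [integral_add (hfi.const_mul _) hprod.integral_prod_left, integral_const_mul, h0, mul_zero,
    zero_add, integral_integral_swap hprod]
  refine setIntegral_congr_fun measurableSet_Icc fun u hu => ?_
  have e : ∫ t in Icc 0 1, (γ u - Γ t)⁻¹ * ((f (Γ t) * deriv Γ t) * ρ u) =
      ρ u * ∫ t in Icc 0 1, f (Γ t) * deriv Γ t / (γ u - Γ t) := by
    rw [← integral_const_mul]
    congr 1; ext t
    rw [div_eq_mul_inv]; ring
  refine e.trans ?_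
  rw [h1 u hu, hρ]
  ring

end Loop

/-! ### Expansion of the determinants -/

/-- Multilinearity of the determinant in its rows, expanded over all choices of summands. -/
theorem det_of_sum_rows {n ι : Type*} [Fintype n] [DecidableEq n] [Fintype ι]
    (x : n → ι → ℂ) (A : ι → n → n → ℂ) :
    (Matrix.of fun i j => ∑ p, x i p * A p i j).det =
      ∑ p : n → ι, (∏ i, x i (p i)) * (Matrix.of fun i j => A (p i) i j).det := by
  classical
  have h := (Matrix.detRowAlternating (R := ℂ) (n := n)).toMultilinearMap.map_sum
    fun i p => fun j => x i p * A p i j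
  have e1 : (Matrix.of fun i j => ∑ p, x i p * A p i j) =
      fun i => ∑ p, fun j => x i p * A p i j := by
    ext i j; simp [Finset.sum_apply]
  rw [e1]
  refine h.trans (Finset.sum_congr rfl fun p _ => ?_)
  exact Matrix.det_mul_column (fun i => x i (p i)) (Matrix.of fun i j => A (p i) i j)

theorem det_of_sum_cols {n ι : Type*} [Fintype n] [DecidableEq n] [Fintype ι]
    (x : n → ι → ℂ) (A : ι → n → n → ℂ) :
    (Matrix.of fun i j => ∑ k, x j k * A k i j).det =
      ∑ k : n → ι, (∏ j, x j (k j)) * (Matrix.of fun i j => A (k j) i j).det := by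
  rw [← Matrix.det_transpose]
  refine (det_of_sum_rows x fun k j i => A k i j).trans (Finset.sum_congr rfl fun k _ => ?_)
  rw [← Matrix.det_transpose (Matrix.of fun i j => A (k j) i j)]
  rfl

/-- The kernel `χ_{pl}(w - i c_l) / (z - w + i c_l)`, from which both `W` and `M` are built. -/
def shiftedKernel {N : ℕ} (c : Fin N → ℝ) (χ : ℂ → Matrix (Fin N) (Fin N) ℂ) (p l : Fin N)
    (z w : ℂ) : ℂ :=
  χ (w - Complex.I * c l) p l / (z - w + Complex.I * c l)

/-- The determinants of the kernels `shiftedKernel`, as functions of the `n` points. -/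
def shiftedDet {N : ℕ} (c : Fin N → ℝ) (χ : ℂ → Matrix (Fin N) (Fin N) ℂ) {n : ℕ}
    (p k : Fin n → Fin N) (z : Fin n → ℂ) : ℂ :=
  (Matrix.of fun i j => shiftedKernel c χ (p i) (k j) (z i) (z j)).det

section Kernels
variable {N : ℕ} {γ : ℝ → ℂ} {B : Finset ℝ} {EL ER FL : ℂ → Fin N → ℂ} {c : Fin N → ℝ}
  {χ : ℂ → Matrix (Fin N) (Fin N) ℂ} {g : Fin N → ℂ} {v : Fin N → Fin N}
  {Γ : ℝ → ℂ} {BΓ : Finset ℝ}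

theorem IsSmallLoopAround.sub_notMem_support (hΓ : IsSmallLoopAround γ c Γ BΓ) {w : ℂ}
    (hw : w ∈ filled Γ) (l : Fin N) : w - Complex.I * c l ∉ support γ := fun h =>
  hΓ.small l _ (hΓ.support_subset_filled h) w hw (by ring)

/-- The kernel `W` factors through `shiftedKernel`, with `F_L` as row and `E_R` as column factor. -/
theorem kernelW_eq (x y : ℂ) : kernelW c g v ER FL χ x y =
    ∑ k, -(g k * ER y (v k)) * ∑ p, FL x p * shiftedKernel c χ p k x y := by
  unfold kernelW shiftedKernel
  rw [← Finset.sum_neg_distrib]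
  refine Finset.sum_congr rfl fun k _ => ?_
  rw [Matrix.mulVec_single_one, single_one_dotProduct, dotProduct, neg_mul, mul_assoc]
  simp only [Matrix.col_apply, ← mul_div_assoc]
  rw [← Finset.sum_div]
  ring

/-- The kernel `M` factors through `shiftedKernel`, with rows of an inverse of `χ(x)` as row
factor. -/
theorem kernelM_eq {Ψ : Matrix (Fin N) (Fin N) ℂ} {x y : ℂ} (hΨ : χ x * Ψ = 1) (k l : Fin N) :
    kernelM c g v χ x y k l =
      ∑ p, g k / (2 * Real.pi * Complex.I) * Ψ (v k) p * shiftedKernel c χ p l x y := by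
  unfold kernelM shiftedKernel
  rw [Matrix.of_apply, Matrix.inv_eq_right_inv hΨ, Matrix.mulVec_single_one,
    single_one_dotProduct, Matrix.col_apply, Matrix.mul_apply, Finset.mul_sum, Finset.sum_div]
  refine Finset.sum_congr rfl fun p _ => ?_
  rw [div_eq_mul_inv, div_eq_mul_inv, div_eq_mul_inv, mul_inv]
  ring

theorem det_kernelW {n : ℕ} (s : Fin n → ℂ) :
    (Matrix.of fun i j => kernelW c g v ER FL χ (s i) (s j)).det =
      ∑ k : Fin n → Fin N, ∑ p : Fin n → Fin N,
        (∏ i, -(g (k i) * ER (s i) (v (k i))) * FL (s i) (p i)) * shiftedDet c χ p k s := by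
  simp only [kernelW_eq]
  rw [det_of_sum_cols (fun j k => -(g k * ER (s j) (v k)))
    fun k i j => ∑ p, FL (s i) p * shiftedKernel c χ p k (s i) (s j)]
  refine Finset.sum_congr rfl fun k _ => ?_
  rw [det_of_sum_rows (fun i p => FL (s i) p)
    fun p i j => shiftedKernel c χ p (k j) (s i) (s j), Finset.mul_sum]
  refine Finset.sum_congr rfl fun p _ => ?_
  rw [Finset.prod_mul_distrib, mul_assoc]
  rfl

theorem det_kernelM {n : ℕ} {Ψ : ℂ → Matrix (Fin N) (Fin N) ℂ} (k : Fin n → Fin N) (z : Fin n → ℂ)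
    (hΨ : ∀ i, χ (z i) * Ψ (z i) = 1) :
    (Matrix.of fun i j => kernelM c g v χ (z i) (z j) (k i) (k j)).det =
      ∑ p : Fin n → Fin N, (∏ i, g (k i) / (2 * Real.pi * Complex.I) * Ψ (z i) (v (k i)) (p i)) *
        shiftedDet c χ p k z := by
  simp only [kernelM_eq (hΨ _)]
  exact det_of_sum_rows (fun i p => g (k i) / (2 * Real.pi * Complex.I) * Ψ (z i) (v (k i)) p)
    fun p i j => shiftedKernel c χ p (k j) (z i) (z j)

theorem continuousOn_shiftedKernel (hχ : SolvesRHP γ B EL ER χ)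
    (hΓ : IsSmallLoopAround γ c Γ BΓ) (p l : Fin N) :
    ContinuousOn (fun q : ℂ × ℂ => shiftedKernel c χ p l q.1 q.2) (filled Γ ×ˢ filled Γ) := by
  refine ContinuousOn.div ?_ (by fun_prop) fun q hq => hΓ.small l _ hq.1 _ hq.2
  exact (hχ.holomorphic p l).continuousOn.comp (by fun_prop) fun q hq =>
    hΓ.sub_notMem_support hq.2 l

theorem continuousOn_shiftedDet (hχ : SolvesRHP γ B EL ER χ)
    (hΓ : IsSmallLoopAround γ c Γ BΓ) {n : ℕ}
    (p k : Fin n → Fin N) : ContinuousOn (shiftedDet c χ p k) {z | ∀ i, z i ∈ filled Γ} := by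
  refine continuous_id.matrix_det.comp_continuousOn
    (continuousOn_pi.2 fun i => continuousOn_pi.2 fun j => ?_)
  exact (continuousOn_shiftedKernel hχ hΓ (p i) (k j)).comp
    (f := fun z : Fin n → ℂ => (z i, z j)) (by fun_prop) fun z hz => ⟨hz i, hz j⟩

/-- The determinants are holomorphic in each point near the filled loop. -/
theorem differentiableOn_shiftedDet (hγ : IsPiecewiseSmoothCurve γ B) (hc : ∀ l, c l ≠ 0)
    (hχ : SolvesRHP γ B EL ER χ) (hΓ : IsSmallLoopAround γ c Γ BΓ) {n : ℕ}
    (p k : Fin n → Fin N) {z : Fin n → ℂ} (hz : ∀ i, z i ∈ filled Γ) (i : Fin n) :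
    ∃ U, IsOpen U ∧ filled Γ ⊆ U ∧
      DifferentiableOn ℂ (fun x => shiftedDet c χ p k (Function.update z i x)) U := by
  refine ⟨(⋂ l, (fun x => x - Complex.I * c l) ⁻¹' (support γ)ᶜ) ∩
    ((⋂ j, ⋂ l, (fun x => x - z j + Complex.I * c l) ⁻¹' {0}ᶜ) ∩
      ⋂ j, ⋂ l, (fun x => z j - x + Complex.I * c l) ⁻¹' {0}ᶜ), ?_, ?_, ?_⟩
  · refine IsOpen.inter ?_ (IsOpen.inter ?_ ?_)
    · exact isOpen_iInter_of_finite fun l =>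
        hγ.isClosed_support.isOpen_compl.preimage (by fun_prop)
    · exact isOpen_iInter_of_finite fun j => isOpen_iInter_of_finite fun l =>
        isOpen_compl_singleton.preimage (by fun_prop)
    · exact isOpen_iInter_of_finite fun j => isOpen_iInter_of_finite fun l =>
        isOpen_compl_singleton.preimage (by fun_prop)
  · intro x hx
    simp only [mem_inter_iff, mem_iInter, mem_preimage, mem_compl_iff, mem_singleton_iff]
    exact ⟨fun l => hΓ.sub_notMem_support hx l, fun j l => hΓ.small l _ hx _ (hz j),
      fun j l => hΓ.small l _ (hz j) _ hx⟩
  · set U := (⋂ l, (fun x => x - Complex.I * c l) ⁻¹' (support γ)ᶜ) ∩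
      ((⋂ j, ⋂ l, (fun x => x - z j + Complex.I * c l) ⁻¹' {0}ᶜ) ∩
        ⋂ j, ⋂ l, (fun x => z j - x + Complex.I * c l) ⁻¹' {0}ᶜ) with hU
    have hmem : ∀ x ∈ U, (∀ l, x - Complex.I * c l ∉ support γ) ∧
        (∀ j l, x - z j + Complex.I * c l ≠ 0) ∧ ∀ j l, z j - x + Complex.I * c l ≠ 0 := by
      intro x hx
      simpa only [hU, mem_inter_iff, mem_iInter, mem_preimage, mem_compl_iff,
        mem_singleton_iff] using hx
    have hy : ∀ a, DifferentiableOn ℂ (fun x => Function.update z i x a) U := by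
      intro a
      by_cases ha : a = i
      · subst ha; simp only [Function.update_self]; exact differentiableOn_id
      · simp only [Function.update_of_ne ha]; exact differentiableOn_const _
    simp only [shiftedDet, Matrix.det_apply', Matrix.of_apply]
    refine DifferentiableOn.fun_sum fun σ _ => (differentiableOn_const _).mul
      (DifferentiableOn.fun_finsetProd fun b _ => ?_)
    refine DifferentiableOn.div ?_ (((hy _).sub (hy b)).add (differentiableOn_const _)) ?_
    · refine (hχ.holomorphic (p (σ b)) (k b)).comp ((hy b).sub (differentiableOn_const _))
        fun x hx => ?_
      by_cases hb : b = i
      · subst hb; simpa using (hmem x hx).1 (k b)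
      · simpa [Function.update_of_ne hb] using hΓ.sub_notMem_support (hz b) (k b)
    · intro x hx
      obtain ⟨-, h1, h2⟩ := hmem x hx
      by_cases ha : σ b = i <;> by_cases hb : b = i
      · rw [ha, hb, sub_self, zero_add]
        exact mul_ne_zero Complex.I_ne_zero (Complex.ofReal_ne_zero.2 (hc _))
      · rw [ha, Function.update_self, Function.update_of_ne hb]
        exact h1 b _
      · rw [hb, Function.update_self, Function.update_of_ne (hb ▸ ha)]
        exact h2 _ _
      · rw [Function.update_of_ne ha, Function.update_of_ne hb]
        exact hΓ.small _ _ (hz _) _ (hz b)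

end Kernels

/-! ### Hadamard's inequality -/

/-- **Hadamard's inequality**: the determinant of a complex matrix is bounded by the product of the
Euclidean norms of its rows. -/
theorem norm_det_le_prod_norm {n : ℕ} (A : Matrix (Fin n) (Fin n) ℂ) :
    ‖A.det‖ ≤ ∏ i, ‖WithLp.toLp 2 (A i)‖ := by
  set w : Fin n → EuclideanSpace ℂ (Fin n) := fun i => WithLp.toLp 2 (A i) with hw
  have hfin : Module.finrank ℂ (EuclideanSpace ℂ (Fin n)) = Fintype.card (Fin n) := by simp
  set b := InnerProductSpace.gramSchmidtOrthonormalBasis hfin w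
  set e := EuclideanSpace.basisFun (Fin n) ℂ
  have hb : b.toBasis.det w = ∏ i, inner ℂ (b i) (w i) :=
    InnerProductSpace.gramSchmidtOrthonormalBasis_det hfin w
  have h1 : e.toBasis.det w = e.toBasis.det b * b.toBasis.det w := by
    rw [Module.Basis.det_apply, Module.Basis.det_apply, Module.Basis.det_apply, ← Matrix.det_mul,
      ← OrthonormalBasis.coe_toBasis b, Module.Basis.toMatrix_mul_toMatrix]
  have h2 : e.toBasis.det w = A.det := by
    rw [Module.Basis.det_apply, ← Matrix.det_transpose]
    congr 1
  rw [← h2, h1, norm_mul, e.det_to_matrix_orthonormalBasis b, one_mul, hb, norm_prod]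
  refine Finset.prod_le_prod (fun i _ => norm_nonneg _) fun i _ => ?_
  refine (norm_inner_le_norm _ _).trans_eq ?_
  rw [b.orthonormal.1 i, one_mul]

theorem norm_det_le_of_forall_le {n : ℕ} {A : Matrix (Fin n) (Fin n) ℂ} {K : ℝ} (hK : 0 ≤ K)
    (hA : ∀ i j, ‖A i j‖ ≤ K) : ‖A.det‖ ≤ (√n * K) ^ n := by
  refine (norm_det_le_prod_norm A).trans ?_
  refine (Finset.prod_le_prod (fun i _ => norm_nonneg _) fun i _ => ?_).trans_eq
    (by rw [Finset.prod_const, Finset.card_univ, Fintype.card_fin])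
  rw [EuclideanSpace.norm_eq, ← Real.sqrt_sq hK, ← Real.sqrt_mul (Nat.cast_nonneg n)]
  refine Real.sqrt_le_sqrt ?_
  calc ∑ j, ‖A i j‖ ^ 2 ≤ ∑ _j : Fin n, K ^ 2 :=
        Finset.sum_le_sum fun j _ => pow_le_pow_left₀ (norm_nonneg _) (hA i j) 2
    _ = n * K ^ 2 := by simp

/-- The majorant provided by Hadamard's inequality is summable. By `n ^ n ≤ e ^ n n!` the square
of its general term is at most `(e K ^ 2) ^ n / n!`. -/
theorem summable_sqrt_mul_pow_div_factorial {K : ℝ} (hK : 0 ≤ K) :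
    Summable fun n : ℕ => (n.factorial : ℝ)⁻¹ * (√n * K) ^ n := by
  have h1 := (Real.summable_pow_div_factorial (4 * (Real.exp 1 * K ^ 2))).add
    (summable_geometric_of_lt_one (r := 1 / 4) (by norm_num) (by norm_num))
  refine Summable.of_nonneg_of_le (fun n => by positivity) (fun n => ?_) h1
  set T := (n.factorial : ℝ)⁻¹ * (√n * K) ^ n with hT
  have hT0 : 0 ≤ T := by positivity
  have hf : (0 : ℝ) < n.factorial := by exact_mod_cast n.factorial_pos
  -- the square of the term is dominated by a term of an exponential series
  have hsq : T ^ 2 ≤ (Real.exp 1 * K ^ 2) ^ n / n.factorial := by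
    have h2 := Real.pow_div_factorial_le_exp (n : ℝ) (Nat.cast_nonneg n) n
    have h3 : T ^ 2 = (n : ℝ) ^ n / n.factorial * ((K ^ 2) ^ n / n.factorial) := by
      rw [hT, mul_pow, mul_pow, mul_pow, ← pow_mul, mul_comm n 2, pow_mul,
        Real.sq_sqrt (Nat.cast_nonneg n), pow_right_comm K n 2]
      field_simp
    rw [h3, mul_pow, ← Real.exp_nat_mul, mul_one, mul_div_assoc]
    exact mul_le_mul_of_nonneg_right h2 (by positivity)
  have h4 : (4 : ℝ) ^ n * T ^ 2 ≤ (4 * (Real.exp 1 * K ^ 2)) ^ n / n.factorial := by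
    rw [mul_pow 4, mul_div_assoc]
    exact mul_le_mul_of_nonneg_left hsq (by positivity)
  have h5 : (4 : ℝ) ^ n = (2 ^ n) ^ 2 := by rw [← pow_mul, mul_comm, pow_mul]; norm_num
  have h6 : (1 / 4 : ℝ) ^ n = ((1 / 2) ^ n) ^ 2 := by rw [← pow_mul, mul_comm, pow_mul]; norm_num
  have h7 : (2 : ℝ) ^ n * (1 / 2) ^ n = 1 := by rw [← mul_pow]; norm_num
  have h8 : T ≤ (2 ^ n * T) ^ 2 + ((1 / 2) ^ n) ^ 2 := by
    have h9 := two_mul_le_add_sq (2 ^ n * T) ((1 / 2) ^ n)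
    have h10 : 2 * (2 ^ n * T) * (1 / 2) ^ n = 2 * T := by linear_combination 2 * T * h7
    linarith
  rw [mul_pow, ← h5] at h8
  linarith

/-! ### Equality of the Fredholm series -/

/-- A Fredholm series converges absolutely as soon as the kernel is bounded on the curve. -/
theorem summable_fredholmTerm {γ : ℝ → ℂ} (hγ : IntegrableOn (deriv γ) (Icc 0 1))
    {W : ℂ → ℂ → ℂ} {K : ℝ} (hK : 0 ≤ K)
    (hW : ∀ s ∈ Icc (0 : ℝ) 1, ∀ t ∈ Icc (0 : ℝ) 1, ‖W (γ s) (γ t)‖ ≤ K) :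
    Summable (fredholmTerm γ (scalarKernel W)) := by
  set L := ∫ t in Icc (0 : ℝ) 1, ‖deriv γ t‖ with hL
  have hL0 : 0 ≤ L := integral_nonneg fun t => norm_nonneg _
  refine Summable.of_norm_bounded (summable_sqrt_mul_pow_div_factorial (mul_nonneg hK hL0))
    fun n => ?_
  have hprod : ∫ t in Icc (0 : Fin n → ℝ) 1, ∏ i, ‖deriv γ (t i)‖ = L ^ n := by
    rw [← pi_univ_Icc, volume_pi]
    simp only [Pi.zero_apply, Pi.one_apply]
    rw [Measure.restrict_pi_pi, integral_fintype_prod_eq_prod (fun _ t => ‖deriv γ t‖)]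
    simp [hL]
  have hint : IntegrableOn (fun t : Fin n → ℝ => (√n * K) ^ n * ∏ i, ‖deriv γ (t i)‖)
      (Icc 0 1) := by
    have h := (integrableOn_prod_pi (n := n) fun _ => hγ).norm
    simp only [norm_prod] at h
    exact h.const_mul _
  unfold fredholmTerm
  rw [norm_mul, norm_inv, Complex.norm_natCast, ← mul_assoc √n, mul_pow (√n * K)]
  refine mul_le_mul_of_nonneg_left ?_ (by positivity)
  rw [Fintype.sum_unique, ← hprod, ← integral_const_mul]
  refine norm_integral_le_of_norm_le hint ?_
  filter_upwards [ae_restrict_mem measurableSet_Icc] with t ht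
  rw [fredholmIntegrand, norm_mul, norm_prod]
  refine mul_le_mul_of_nonneg_right (norm_det_le_of_forall_le hK fun i j => ?_)
    (Finset.prod_nonneg fun i _ => norm_nonneg _)
  exact hW _ ⟨ht.1 i, ht.2 i⟩ _ ⟨ht.1 j, ht.2 j⟩

section Series
variable {N : ℕ} {γ : ℝ → ℂ} {B : Finset ℝ} {EL ER FL : ℂ → Fin N → ℂ} {c : Fin N → ℝ}
  {χ : ℂ → Matrix (Fin N) (Fin N) ℂ} {g : Fin N → ℂ} {v : Fin N → Fin N}
  {Γ : ℝ → ℂ} {BΓ : Finset ℝ}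

/-- The density on the loop that goes with the Cauchy integral. -/
def loopDensity (γ Γ : ℝ → ℂ) (ER FL : ℂ → Fin N → ℂ) (a p : Fin N) (t : ℝ) : ℂ :=
  cauchyInverse γ ER FL (Γ t) a p * deriv Γ t

/-- The density on the curve that replaces `loopDensity`. -/
def curveDensity (γ : ℝ → ℂ) (ER FL : ℂ → Fin N → ℂ) (a p : Fin N) (t : ℝ) : ℂ :=
  -(2 * Real.pi * Complex.I) * (ER (γ t) a * FL (γ t) p) * deriv γ t

theorem fredholmIntegrand_kernelM {n : ℕ} (k : Fin n → Fin N) (t : Fin n → ℝ)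
    (h : ∀ i, χ (Γ (t i)) * cauchyInverse γ ER FL (Γ (t i)) = 1) :
    fredholmIntegrand Γ (kernelM c g v χ) n k t =
      ∑ p : Fin n → Fin N, (∏ i, g (k i) / (2 * Real.pi * Complex.I)) *
        (shiftedDet c χ p k (fun i => Γ (t i)) *
          ∏ i, loopDensity γ Γ ER FL (v (k i)) (p i) (t i)) := by
  rw [fredholmIntegrand, det_kernelM k _ h, Finset.sum_mul]
  refine Finset.sum_congr rfl fun p _ => ?_
  simp only [loopDensity, Finset.prod_mul_distrib]
  ring

theorem fredholmIntegrand_kernelW {n : ℕ} (u : Fin n → Unit) (t : Fin n → ℝ) :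
    fredholmIntegrand γ (scalarKernel (kernelW c g v ER FL χ)) n u t =
      ∑ k : Fin n → Fin N, ∑ p : Fin n → Fin N, (∏ i, g (k i) / (2 * Real.pi * Complex.I)) *
        (shiftedDet c χ p k (fun i => γ (t i)) *
          ∏ i, curveDensity γ ER FL (v (k i)) (p i) (t i)) := by
  have h := det_kernelW (c := c) (g := g) (v := v) (ER := ER) (FL := FL) (χ := χ)
    fun i => γ (t i)
  rw [fredholmIntegrand]
  simp only [scalarKernel, Matrix.of_apply]
  rw [h, Finset.sum_mul]
  refine Finset.sum_congr rfl fun k _ => ?_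
  rw [Finset.sum_mul]
  refine Finset.sum_congr rfl fun p _ => ?_
  rw [mul_right_comm, ← Finset.prod_mul_distrib, mul_comm (shiftedDet c χ p k _) (∏ i, _),
    ← mul_assoc, ← Finset.prod_mul_distrib]
  congr 1
  refine Finset.prod_congr rfl fun i _ => ?_
  have hpi : (2 * Real.pi * Complex.I : ℂ) ≠ 0 := Complex.two_pi_I_ne_zero
  rw [curveDensity]
  field_simp

theorem integrableOn_loopDensity (hγ : IsPiecewiseSmoothCurve γ B)
    (hER : ContinuousOn (fun t => ER (γ t)) (Icc 0 1)) (hFL : ContinuousOn FL (support γ))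
    (hΓ : IsSmallLoopAround γ c Γ BΓ) (a p : Fin N) :
    IntegrableOn (loopDensity γ Γ ER FL a p) (Icc 0 1) :=
  IntegrableOn.continuousOn_mul ((differentiableOn_cauchyInverse hγ hER hFL a p).continuousOn.comp
    hΓ.smooth.1 fun t ht => Set.disjoint_left.1 hΓ.disjoint ⟨t, ht, rfl⟩)
    ((intervalIntegrable_iff_integrableOn_Icc_of_le zero_le_one).1 hΓ.isClosedCurve.integrable)
    isCompact_Icc

theorem integrableOn_curveDensity (hγ : IsPiecewiseSmoothCurve γ B)
    (hER : ContinuousOn (fun t => ER (γ t)) (Icc 0 1)) (hFL : ContinuousOn FL (support γ))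
    (a p : Fin N) : IntegrableOn (curveDensity γ ER FL a p) (Icc 0 1) :=
  IntegrableOn.continuousOn_mul (continuousOn_const.mul
    (((continuous_apply a).comp_continuousOn hER).mul ((continuous_apply p).comp_continuousOn
      (hFL.comp hγ.smooth.1 fun u hu => ⟨u, hu, rfl⟩))))
    ((intervalIntegrable_iff_integrableOn_Icc_of_le zero_le_one).1 hγ.intervalIntegrable_deriv)
    isCompact_Icc

theorem integrableOn_shiftedDet_mul (hχ : SolvesRHP γ B EL ER χ)
    (hΓ : IsSmallLoopAround γ c Γ BΓ) {C : ℝ → ℂ} (hC : ContinuousOn C (Icc 0 1))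
    (hCV : MapsTo C (Icc 0 1) (filled Γ)) {n : ℕ} (p k : Fin n → Fin N) {α : Fin n → ℝ → ℂ}
    (hα : ∀ i, IntegrableOn (α i) (Icc 0 1)) :
    IntegrableOn (fun t : Fin n → ℝ => shiftedDet c χ p k (fun i => C (t i)) * ∏ i, α i (t i))
      (Icc 0 1) :=
  IntegrableOn.continuousOn_mul
    ((continuousOn_shiftedDet hχ hΓ p k).comp (continuousOn_pi.2 fun i =>
      hC.comp (continuous_apply i).continuousOn fun _ ht => ⟨ht.1 i, ht.2 i⟩)
      fun _ ht i => hCV ⟨ht.1 i, ht.2 i⟩)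
    (integrableOn_prod_pi hα) isCompact_Icc

theorem mapsTo_filled (Γ : ℝ → ℂ) : MapsTo Γ (Icc 0 1) (filled Γ) :=
  fun u hu => Or.inl ⟨u, hu, rfl⟩

theorem IsSmallLoopAround.mapsTo_curve (hΓ : IsSmallLoopAround γ c Γ BΓ) :
    MapsTo γ (Icc 0 1) (filled Γ) := fun u hu => hΓ.support_subset_filled ⟨u, hu, rfl⟩

theorem mul_cauchyInverse_loop (hγ : IsPiecewiseSmoothCurve γ B)
    (hEL : PiecewiseContDiff ((⊤ : ℕ∞) : WithTop ℕ∞) (fun t => EL (γ t)) B)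
    (hER : PiecewiseContDiff ((⊤ : ℕ∞) : WithTop ℕ∞) (fun t => ER (γ t)) B)
    (horth : ∀ x ∈ support γ, dotProduct (EL x) (ER x) = 0)
    (hχ : SolvesRHP γ B EL ER χ) (hFL : IsLeftSolution γ EL ER FL)
    (hΓ : IsSmallLoopAround γ c Γ BΓ) {n : ℕ} {t : Fin n → ℝ} (ht : t ∈ Icc 0 1) (i : Fin n) :
    χ (Γ (t i)) * cauchyInverse γ ER FL (Γ (t i)) = 1 :=
  mul_cauchyInverse_eq_one hγ hEL hER horth hχ hFL
    (Set.disjoint_left.1 hΓ.disjoint ⟨t i, ⟨ht.1 i, ht.2 i⟩, rfl⟩)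

theorem integrableOn_fredholmIntegrand_kernelW (hγ : IsPiecewiseSmoothCurve γ B)
    (hER : ContinuousOn (fun t => ER (γ t)) (Icc 0 1))
    (hχ : SolvesRHP γ B EL ER χ) (hFL : IsLeftSolution γ EL ER FL)
    (hΓ : IsSmallLoopAround γ c Γ BΓ) {n : ℕ} (u : Fin n → Unit) :
    IntegrableOn (fredholmIntegrand γ (scalarKernel (kernelW c g v ER FL χ)) n u) (Icc 0 1) := by
  have e : fredholmIntegrand γ (scalarKernel (kernelW c g v ER FL χ)) n u = _ :=
    funext fun t => fredholmIntegrand_kernelW u t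
  rw [e]
  exact integrable_finsetSum _ fun k _ => integrable_finsetSum _ fun p _ =>
    (integrableOn_shiftedDet_mul hχ hΓ hγ.smooth.1 hΓ.mapsTo_curve p k fun i =>
      integrableOn_curveDensity hγ hER hFL.continuousOn _ _).const_mul _

theorem integrableOn_fredholmIntegrand_kernelM (hγ : IsPiecewiseSmoothCurve γ B)
    (hEL : PiecewiseContDiff ((⊤ : ℕ∞) : WithTop ℕ∞) (fun t => EL (γ t)) B)
    (hER : PiecewiseContDiff ((⊤ : ℕ∞) : WithTop ℕ∞) (fun t => ER (γ t)) B)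
    (horth : ∀ x ∈ support γ, dotProduct (EL x) (ER x) = 0)
    (hχ : SolvesRHP γ B EL ER χ) (hFL : IsLeftSolution γ EL ER FL)
    (hΓ : IsSmallLoopAround γ c Γ BΓ) {n : ℕ} (k : Fin n → Fin N) :
    IntegrableOn (fredholmIntegrand Γ (kernelM c g v χ) n k) (Icc 0 1) := by
  refine IntegrableOn.congr_fun ?_ (fun t ht => (fredholmIntegrand_kernelM k t
    (mul_cauchyInverse_loop hγ hEL hER horth hχ hFL hΓ ht)).symm) measurableSet_Icc
  exact integrable_finsetSum _ fun p _ =>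
    (integrableOn_shiftedDet_mul hχ hΓ hΓ.smooth.1 (mapsTo_filled Γ) p k fun i =>
      integrableOn_loopDensity hγ hER.1 hFL.continuousOn hΓ _ _).const_mul _

/-- The two Fredholm series agree term by term. -/
theorem fredholmTerm_kernelW_eq (hγ : IsPiecewiseSmoothCurve γ B)
    (hEL : PiecewiseContDiff ((⊤ : ℕ∞) : WithTop ℕ∞) (fun t => EL (γ t)) B)
    (hER : PiecewiseContDiff ((⊤ : ℕ∞) : WithTop ℕ∞) (fun t => ER (γ t)) B)
    (horth : ∀ x ∈ support γ, dotProduct (EL x) (ER x) = 0) (hc : ∀ l, c l ≠ 0)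
    (hχ : SolvesRHP γ B EL ER χ) (hFL : IsLeftSolution γ EL ER FL)
    (hΓ : IsSmallLoopAround γ c Γ BΓ) (n : ℕ) :
    fredholmTerm γ (scalarKernel (kernelW c g v ER FL χ)) n =
      fredholmTerm Γ (kernelM c g v χ) n := by
  have hα : ∀ a p, IntegrableOn (loopDensity γ Γ ER FL a p) (Icc 0 1) :=
    integrableOn_loopDensity hγ hER.1 hFL.continuousOn hΓ
  have hβ : ∀ a p, IntegrableOn (curveDensity γ ER FL a p) (Icc 0 1) :=
    integrableOn_curveDensity hγ hER.1 hFL.continuousOn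
  have iW := fun p k : Fin n → Fin N => integrableOn_shiftedDet_mul hχ hΓ hγ.smooth.1
    hΓ.mapsTo_curve p k (α := fun i => curveDensity γ ER FL (v (k i)) (p i)) fun i => hβ _ _
  have iM := fun p k : Fin n → Fin N => integrableOn_shiftedDet_mul hχ hΓ hΓ.smooth.1
    (mapsTo_filled Γ) p k
    (α := fun i => loopDensity γ Γ ER FL (v (k i)) (p i)) fun i => hα _ _
  unfold fredholmTerm
  congr 1
  rw [Fintype.sum_unique]
  simp only [fredholmIntegrand_kernelW]
  rw [integral_finsetSum _ fun k _ => integrable_finsetSum _ fun p _ => (iW p k).const_mul _]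
  refine Finset.sum_congr rfl fun k _ => ?_
  rw [setIntegral_congr_fun measurableSet_Icc fun t ht => fredholmIntegrand_kernelM k t
    (mul_cauchyInverse_loop hγ hEL hER horth hχ hFL hΓ ht),
    integral_finsetSum _ fun p _ => (iW p k).const_mul _,
    integral_finsetSum _ fun p _ => (iM p k).const_mul _]
  refine Finset.sum_congr rfl fun p _ => ?_
  rw [integral_const_mul, integral_const_mul]
  congr 1
  refine (setIntegral_pi_contour hΓ.smooth.1 hγ.smooth.1 (mapsTo_filled Γ)
    hΓ.mapsTo_curve (fun i => hα _ _) (fun i => hβ _ _) ?_ (continuousOn_shiftedDet hχ hΓ p k)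
    fun z hz i => differentiableOn_shiftedDet hγ hc hχ hΓ p k hz i).symm
  rintro i f ⟨U, hU, hVU, hf⟩
  exact hΓ.integral_mul_cauchyInverse hγ hER.1 hFL.continuousOn _ _ hU hVU hf

theorem exists_norm_kernelW_le (hγ : IsPiecewiseSmoothCurve γ B)
    (hER : ContinuousOn (fun t => ER (γ t)) (Icc 0 1))
    (hχ : SolvesRHP γ B EL ER χ) (hFL : IsLeftSolution γ EL ER FL)
    (hΓ : IsSmallLoopAround γ c Γ BΓ) : ∃ K, 0 ≤ K ∧ ∀ s ∈ Icc (0 : ℝ) 1, ∀ t ∈ Icc (0 : ℝ) 1,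
      ‖kernelW c g v ER FL χ (γ s) (γ t)‖ ≤ K := by
  have hFLc := hFL.continuousOn.comp hγ.smooth.1 fun u hu => ⟨u, hu, rfl⟩
  have hcont : ContinuousOn (fun q : ℝ × ℝ => kernelW c g v ER FL χ (γ q.1) (γ q.2))
      (Icc 0 1 ×ˢ Icc 0 1) := by
    simp only [kernelW_eq]
    refine continuousOn_finsetSum _ fun k _ => ContinuousOn.mul ?_
      (continuousOn_finsetSum _ fun p _ => ContinuousOn.mul ?_ ?_)
    · exact (continuousOn_const.mul (((continuous_apply (v k)).comp_continuousOn hER).comp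
        continuousOn_snd fun q hq => hq.2)).neg
    · exact ((continuous_apply p).comp_continuousOn hFLc).comp continuousOn_fst fun q hq => hq.1
    · exact (continuousOn_shiftedKernel hχ hΓ p k).comp
        ((hγ.smooth.1.comp continuousOn_fst fun q hq => hq.1).prodMk
          (hγ.smooth.1.comp continuousOn_snd fun q hq => hq.2))
        fun q hq => ⟨hΓ.mapsTo_curve hq.1, hΓ.mapsTo_curve hq.2⟩
  obtain ⟨K, hK⟩ := (isCompact_Icc.prod isCompact_Icc).exists_bound_of_continuousOn hcont
  have h0 : (0 : ℝ) ∈ Icc (0 : ℝ) 1 := left_mem_Icc.2 zero_le_one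
  exact ⟨K, (norm_nonneg _).trans (hK (0, 0) ⟨h0, h0⟩), fun s hs t ht => hK (s, t) ⟨hs, ht⟩⟩

end Series

end ShiftKernel

end

theorem mainTheorem3 (N : ℕ)
    -- the curve and the smooth functions on it
    (γ : ℝ → ℂ) (B : Finset ℝ) (hγ : ShiftKernel.IsPiecewiseSmoothCurve γ B)
    (EL ER : ℂ → Fin N → ℂ)
    (hEL : ShiftKernel.PiecewiseContDiff ((⊤ : ℕ∞) : WithTop ℕ∞) (fun t => EL (γ t)) B)
    (hER : ShiftKernel.PiecewiseContDiff ((⊤ : ℕ∞) : WithTop ℕ∞) (fun t => ER (γ t)) B)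
    (horth : ∀ x ∈ ShiftKernel.support γ, dotProduct (EL x) (ER x) = 0)
    -- the shifts, the weights and the labels
    (c : Fin N → ℝ) (hc : ∀ n, c n ≠ 0) (g : Fin N → ℂ) (v : Fin N → Fin N)
    -- the solutions of the Riemann--Hilbert problem and of the linear integral equation
    (χ : ℂ → Matrix (Fin N) (Fin N) ℂ) (hχ : ShiftKernel.SolvesRHP γ B EL ER χ)
    (FL : ℂ → Fin N → ℂ) (hFL : ShiftKernel.IsLeftSolution γ EL ER FL)
    -- the loop
    (Γ : ℝ → ℂ) (BΓ : Finset ℝ) (hΓ : ShiftKernel.IsSmallLoopAround γ c Γ BΓ) :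
    ShiftKernel.FredholmConvergent γ
        (ShiftKernel.scalarKernel (ShiftKernel.kernelW c g v ER FL χ)) ∧
      ShiftKernel.FredholmConvergent Γ (ShiftKernel.kernelM c g v χ) ∧
      ShiftKernel.fredholmDet γ
          (ShiftKernel.scalarKernel (ShiftKernel.kernelW c g v ER FL χ)) =
        ShiftKernel.fredholmDet Γ (ShiftKernel.kernelM c g v χ) := by
  have hterm := ShiftKernel.fredholmTerm_kernelW_eq (g := g) (v := v) hγ hEL hER horth hc hχ hFL hΓ
  obtain ⟨K, hK, hKb⟩ := ShiftKernel.exists_norm_kernelW_le (g := g) (v := v) hγ hER.1 hχ hFL hΓ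
  have hsum := ShiftKernel.summable_fredholmTerm
    ((intervalIntegrable_iff_integrableOn_Icc_of_le zero_le_one).1 hγ.intervalIntegrable_deriv)
    hK hKb
  refine ⟨⟨fun n u => ShiftKernel.integrableOn_fredholmIntegrand_kernelW hγ hER.1 hχ hFL hΓ u,
    hsum⟩, ⟨fun n k => ShiftKernel.integrableOn_fredholmIntegrand_kernelM hγ hEL hER horth hχ hFL
    hΓ k, ?_⟩, tsum_congr hterm⟩
  exact hsum.congr fun n => hterm n
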